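/- Let $T>0$, $\alpha\in(0,1)$, and let $f\colon[0,T]\times\mathbb R\to\mathbb R$ be continuously differentiable with $|f(\tau,x)|\le\gamma(1+|x|)$ for all $(\tau,x)\in[0,T]\times\mathbb R$ and some $\gamma\ge0$. For $t\in[0,T]$ let $AC^\alpha[0,t]$ be the set of functions $x\colon[0,t]\to\mathbb R$ of the form $x(\tau)=x(0)+\frac1{\Gamma(\alpha)}\int_0^\tau\frac{\ell(\xi)}{(\tau-\xi)^{1-\alpha}}\,d\xi$, $\tau\in[0,t]$, with $\ell$ Lebesgue measurable and essentially bounded on $[0,t]$. For such $x$, let $({}^CD^\alpha_{0+}x)(\tau)=\frac1{\Gamma(1-\alpha)}\frac{d}{d\tau}\int_0^\tau\frac{x(\xi)-x(0)}{(\tau-\xi)^{\alpha}}\,d\xi$, which exists for a.e. $\tau\in[0,t]$. Let $G$ be the set of pairs $(t,w)$ with $t\in[0,T)$ and $w\in AC^\alpha[0,t]$. A solution of the Cauchy problem with initial data $(t,w)\in G$ is a function $x\in AC^\alpha[0,T]$ with $x(\tau)=w(\tau)$ for $\tau\in[0,t]$ and $({}^CD^\alpha_{0+}x)(\tau)=f(\tau,x(\tau))$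 for a.e. $\tau\in[t,T]$. A functional $\varphi\colon G\to\mathbb R$ is called $ci$-differentiable of order $\alpha$ at $(t,w)\in G$, with $ci$-derivatives $\partial_t^\alpha\varphi(t,w)=d\in\mathbb R$ and $\nabla^\alpha\varphi(t,w)=e\in\mathbb R$, if for every $\lambda\in AC^\alpha[0,T]$ with $\lambda|_{[0,t]}=w$ there is a function $o\colon(0,\infty)\to\mathbb R$ with $o(\delta)/\delta\to0$ as $\delta\to0^+$ such that, for all $\tau\in(t,T)$, $$\varphi(\tau,\lambda|_{[0,\tau]})-\varphi(t,w)=d\,(\tau-t)+e\int_t^\tau({}^CD^\alpha_{0+}\lambda)(\xi)\,d\xi+o(\tau-t).$$ **Theorem.** For every $(t,w)\in G$ the Cauchy problem has a unique solution $x(\cdot)=x(\cdot\mid t,w)$. Put $\rho(t,w)=x(T\mid t,w)$. Fix $(t,w)\in G$ and $x(\cdot)=x(\cdot\mid t,w)$, and set $$\bar p(\tau)=-\frac{1-\alpha}{\Gamma(\alpha)}\,\frac{T-\tau}{T-t}\int_0^t\frac{({}^CD^\alpha_{0+}w)(\xi)}{(\tau-\xi)^{2-\alpha}}\,d\xi,\qquad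 \bar q(\tau)=\frac1{\Gamma(\alpha)(\tau-t)^{1-\alpha}},\qquad \tau\in(t,T],$$ $$a(\tau)=\frac{\partial f}{\partial x}(\tau,x(\tau)),\qquad b(\tau)=\frac{T-\tau}{T-t}\,\frac{\partial f}{\partial\tau}(\tau,x(\tau))-\frac{\alpha f(\tau,x(\tau))}{T-t},\qquad \tau\in[t,T],$$ with one-sided derivatives $\partial f/\partial\tau$ at $\tau=0$ and $\tau=T$. Let $C^{1-\alpha}(t,T]$ be the space of continuous functions $p\colon(t,T]\to\mathbb R$ for which $\tau\mapsto(\tau-t)^{1-\alpha}p(\tau)$ is bounded. Then each of the equations $$p(\tau)=\bar p(\tau)+\frac1{\Gamma(\alpha)}\int_t^\tau\frac{a(\xi)p(\xi)+b(\xi)}{(\tau-\xi)^{1-\alpha}}\,d\xi,\qquad q(\tau)=\bar q(\tau)+\frac1{\Gamma(\alpha)}\int_t^\tau\frac{a(\xi)q(\xi)}{(\tau-\xi)^{1-\alpha}}\,d\xi,\qquad\tau\in(t,T],$$ has a unique solution $p$, respectively $q$, in $C^{1-\alpha}(t,T]$. The functional $\rho$ is $ci$-differentiable of order $\alpha$ at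 $(t,w)$, its $ci$-derivatives there are uniquely determined, and $$\partial_t^\alpha\rho(t,w)=p(T),\qquad\nabla^\alpha\rho(t,w)=q(T).$$ -/

import Mathlib

open Set MeasureTheory Filter Topology

noncomputable section

namespace CaputoCauchy

/-- Membership in `AC^α[0, t]`: on `[0, t]`, `x` is `x(0)` plus the Riemann–Liouville fractional
integral of order `α` of a Lebesgue measurable, essentially bounded function `ℓ`.
Functions on `[0, t]` are represented by functions on `ℝ`; only the values on `[0, t]` matter. -/
def IsAC (α t : ℝ) (x : ℝ → ℝ) : Prop :=
  ∃ l : ℝ → ℝ, MemLp l ⊤ (volume.restrict (Icc 0 t)) ∧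
    ∀ τ ∈ Icc 0 t,
      x τ = x 0 + 1 / Real.Gamma α * ∫ ξ in (0 : ℝ)..τ, l ξ / (τ - ξ) ^ (1 - α)

/-- The Caputo fractional derivative of order `α` with lower limit `0`, at the point `τ`.
For `τ` in the open interval `(0, t)` it depends only on the values of `x` on `[0, t]`. -/
def caputoDeriv (α : ℝ) (x : ℝ → ℝ) (τ : ℝ) : ℝ :=
  1 / Real.Gamma (1 - α) * deriv (fun s => ∫ ξ in (0 : ℝ)..s, (x ξ - x 0) / (s - ξ) ^ α) τ

/-- The set `G` of admissible initial data: pairs of a number `t ∈ [0, T)` and a function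
`w ∈ AC^α[0, t]`. A function on `[0, t]` is represented by its extension by zero to `ℝ`, so that
two pairs are equal exactly when the numbers `t` and the functions on `[0, t]` are. -/
@[ext]
structure InitialData (α T : ℝ) where
  t : ℝ
  w : ℝ → ℝ
  t_mem : t ∈ Ico 0 T
  w_eq_zero : ∀ ξ, ξ ∉ Icc 0 t → w ξ = 0
  w_isAC : IsAC α t w

theorem IsAC.restrict {α T τ : ℝ} {y : ℝ → ℝ} (hy : IsAC α T y) (hτ : τ ∈ Ico 0 T) :
    IsAC α τ ((Icc 0 τ).indicator y) := by
  obtain ⟨l, hl, h⟩ := hy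
  refine ⟨l, hl.mono_measure (Measure.restrict_mono (Icc_subset_Icc le_rfl hτ.2.le) le_rfl), ?_⟩
  intro s hs
  rw [indicator_of_mem hs, indicator_of_mem (left_mem_Icc.2 hτ.1)]
  exact h s ⟨hs.1, hs.2.trans hτ.2.le⟩

/-- The element `(τ, y_τ)` of `G`, where `y_τ` is the restriction of `y ∈ AC^α[0, T]` to
`[0, τ]`. -/
def InitialData.ofRestrict {α T : ℝ} (y : ℝ → ℝ) (hy : IsAC α T y) (τ : ℝ) (hτ : τ ∈ Ico 0 T) :
    InitialData α T where
  t := τ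
  w := (Icc 0 τ).indicator y
  t_mem := hτ
  w_eq_zero := fun _ hξ => indicator_of_notMem hξ y
  w_isAC := hy.restrict hτ

theorem InitialData.mem_Ico {α T : ℝ} (g : InitialData α T) {τ : ℝ} (hτ : τ ∈ Ioo g.t T) :
    τ ∈ Ico 0 T :=
  ⟨g.t_mem.1.trans hτ.1.le, hτ.2⟩

/-- `x` is a solution of the Cauchy problem with initial data `(t, w)`: it belongs to
`AC^α[0, T]`, equals `w` on `[0, t]`, and its Caputo derivative at `τ` is `f(τ, x(τ))` for
a.e. `τ ∈ [t, T]`. Only the values of `x` on `[0, T]` matter. -/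
def IsCauchySolution (α T : ℝ) (f : ℝ → ℝ → ℝ) (g : InitialData α T) (x : ℝ → ℝ) : Prop :=
  IsAC α T x ∧ (∀ τ ∈ Icc 0 g.t, x τ = g.w τ) ∧
    ∀ᵐ τ ∂(volume.restrict (Icc g.t T)), caputoDeriv α x τ = f τ (x τ)

open Classical in
/-- The functional `ρ(t, w) = x(T | t, w)` on `G`, where `x(· | t, w)` is the solution of the
Cauchy problem (the value `0` is used if there were no solution). -/
def rho (α T : ℝ) (f : ℝ → ℝ → ℝ) (g : InitialData α T) : ℝ :=
  if h : ∃ x, IsCauchySolution α T f g x then h.choose T else 0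

/-- `φ` is `ci`-differentiable of order `α` at `g = (t, w)`, with `ci`-derivatives `d` (in `t`)
and `e` (the gradient): along every admissible extension `y ∈ AC^α[0, T]` of `w`, the increment
of `φ` has a first-order expansion for `τ ∈ (t, T)`, with a remainder that may depend on
`g` and `y`. -/
def HasCiDerivAt {α T : ℝ} (φ : InitialData α T → ℝ) (g : InitialData α T) (d e : ℝ) : Prop :=
  ∀ (y : ℝ → ℝ) (hy : IsAC α T y), (∀ ξ ∈ Icc 0 g.t, y ξ = g.w ξ) →
    ∃ o : ℝ → ℝ, Tendsto (fun δ => o δ / δ) (𝓝[>] 0) (𝓝 0) ∧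
      ∀ (τ : ℝ) (hτ : τ ∈ Ioo g.t T),
        φ (InitialData.ofRestrict y hy τ (g.mem_Ico hτ)) - φ g =
          d * (τ - g.t) + e * (∫ ξ in g.t..τ, caputoDeriv α y ξ) + o (τ - g.t)

/-- The free term of the integral equation for `p`. -/
def pBar {α T : ℝ} (g : InitialData α T) (τ : ℝ) : ℝ :=
  -((1 - α) / Real.Gamma α) * ((T - τ) / (T - g.t)) *
    ∫ ξ in (0 : ℝ)..g.t, caputoDeriv α g.w ξ / (τ - ξ) ^ (2 - α)

/-- The free term of the integral equation for `q`. -/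
def qBar {α T : ℝ} (g : InitialData α T) (τ : ℝ) : ℝ :=
  1 / (Real.Gamma α * (τ - g.t) ^ (1 - α))

/-- The coefficient `a(τ) = ∂f/∂x (τ, x(τ))`. -/
def coeffA (f : ℝ → ℝ → ℝ) (x : ℝ → ℝ) (τ : ℝ) : ℝ :=
  deriv (fun z => f τ z) (x τ)

/-- The coefficient
`b(τ) = ((T - τ)/(T - t)) ∂f/∂τ (τ, x(τ)) - α f(τ, x(τ))/(T - t)`; the derivative in `τ` is
taken within `[0, T]`, hence is one-sided at `τ = 0` and `τ = T`. -/
def coeffB (α T t : ℝ) (f : ℝ → ℝ → ℝ) (x : ℝ → ℝ) (τ : ℝ) : ℝ :=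
  (T - τ) / (T - t) * derivWithin (fun s => f s (x τ)) (Icc 0 T) τ
    - α * f τ (x τ) / (T - t)

/-- Membership in `C^{1-α}(t, T]`: `p` is continuous on `(t, T]` and `(τ - t)^{1-α} p(τ)` is
bounded there. Only the values of `p` on `(t, T]` matter. -/
def IsWeightedContinuous (α t T : ℝ) (p : ℝ → ℝ) : Prop :=
  ContinuousOn p (Ioc t T) ∧ ∃ C : ℝ, ∀ τ ∈ Ioc t T, |(τ - t) ^ (1 - α) * p τ| ≤ C

/-- `p ∈ C^{1-α}(t, T]` solves the linear Volterra equation for `p` along `x`. -/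
def IsSolutionP {α T : ℝ} (f : ℝ → ℝ → ℝ) (g : InitialData α T) (x p : ℝ → ℝ) : Prop :=
  IsWeightedContinuous α g.t T p ∧
    ∀ τ ∈ Ioc g.t T,
      p τ = pBar g τ + 1 / Real.Gamma α *
        ∫ ξ in g.t..τ, (coeffA f x ξ * p ξ + coeffB α T g.t f x ξ) / (τ - ξ) ^ (1 - α)

/-- `q ∈ C^{1-α}(t, T]` solves the linear Volterra equation for `q` along `x`. -/
def IsSolutionQ {α T : ℝ} (f : ℝ → ℝ → ℝ) (g : InitialData α T) (x q : ℝ → ℝ) : Prop :=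
  IsWeightedContinuous α g.t T q ∧
    ∀ τ ∈ Ioc g.t T,
      q τ = qBar g τ + 1 / Real.Gamma α *
        ∫ ξ in g.t..τ, (coeffA f x ξ * q ξ) / (τ - ξ) ^ (1 - α)

end CaputoCauchy

end

/-! Write `I^a` for `fracInt` and `D` for the Caputo derivative. Since `I^(1-α) I^α = I^1`, a
function in `AC^α` equals its initial value plus `I^α` of its own Caputo derivative, so the Cauchy
problem is the Volterra equation `x = m + I^α f(·, x)` on `[t, T]`, where `m` (`memory`) carries the
whole history `w`. Truncating `f` at the radius of an a priori bound and contracting in an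
exponentially weighted norm produces the solution (`exists_isCauchySolution`); a singular Gronwall
inequality gives uniqueness.

Put `k = f(t, w(t))`. The gradient comes from sensitivity. Restarting from `(σ, y_σ)` changes the
solution by a Volterra equation whose free term is a kernel integral of `Dy - Dx` over `[t, σ]`. As
`σ → t` this acts like a point impulse at `t` of mass `∫ (Dy - Dx)`; the response to a unit impulse
has free term `qBar` and is propagated by the linearized equation, so it is `q`. Hence the increment
of `ρ` is `q(T) ∫ (Dy - Dx) + o(σ - t)` (`volterra_perturbation`). As `Dx = f(·, x)` almost
everywhere and this is continuous, `∫ Dx = k (σ - t) + o(σ - t)`, so the gradient is `q(T)` and the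
derivative in time is `-k q(T)` (`IsCauchySolution.hasCiDerivAt_rho`).

It remains to see that `p(T) = -k q(T)`. The solution is the primitive of a function `v` with `v =
m' + k qBar + I^α (f_τ + f_x v)`; this is obtained by passing to the limit in Picard iterates
together with their derivatives (`IsCauchySolution.exists_deriv`). Multiplying `v` by `(T - s)/(T -
t)` and commuting this factor past `I^α` produces precisely the coefficient `b`, turns `m'` into
`pBar`, and leaves `k qBar` with coefficient one. So `u = (T - s)/(T - t) v` solves the equation for
`p` with the extra free term `k qBar`; by linearity `u = p + k q`, and `u(T) = 0`.

Every estimate allows a singularity `(s - c)^(b-1)` at the left end. The common tool is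
`exists_wt_contraction`: in the norm weighted by `(s - c)^(b-1) exp(λ (s - c))` with `λ` large, a
multiple of `I^a` has norm at most one half, uniformly in `c`. -/

noncomputable section

namespace CaputoCauchy

/-! ### Fractional integrals, power kernels and the Beta integral. -/

/-- The Riemann–Liouville fractional integral of order `a` with lower limit `c`. -/
def fracInt (a c : ℝ) (φ : ℝ → ℝ) (s : ℝ) : ℝ :=
  1 / Real.Gamma a * ∫ ξ in c..s, φ ξ / (s - ξ) ^ (1 - a)

theorem div_rpow_one_sub {y : ℝ} (hy : 0 ≤ y) (u a : ℝ) : u / y ^ (1 - a) = u * y ^ (a - 1) := by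
  rw [show a - 1 = -(1 - a) by ring, Real.rpow_neg hy, div_eq_mul_inv]

theorem intervalIntegrable_sub_left_rpow {b : ℝ} (hb : 0 < b) (c u v : ℝ) :
    IntervalIntegrable (fun ξ => (ξ - c) ^ (b - 1)) volume u v := by
  have := (intervalIntegral.intervalIntegrable_rpow' (a := u - c) (b := v - c)
    (by linarith : -1 < b - 1)).comp_sub_right c
  simpa using this

theorem intervalIntegrable_sub_right_rpow {b : ℝ} (hb : 0 < b) (s u v : ℝ) :
    IntervalIntegrable (fun ξ => (s - ξ) ^ (b - 1)) volume u v := by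
  have := (intervalIntegral.intervalIntegrable_rpow' (a := s - u) (b := s - v)
    (by linarith : -1 < b - 1)).comp_sub_left s
  simpa using this

theorem integral_sub_left_rpow {b : ℝ} (hb : 0 < b) {c s : ℝ} :
    ∫ ξ in c..s, (ξ - c) ^ (b - 1) = (s - c) ^ b / b := by
  rw [intervalIntegral.integral_comp_sub_right (fun x => x ^ (b - 1)),
    integral_rpow (Or.inl (by linarith))]
  simp [Real.zero_rpow hb.ne']

theorem integral_sub_right_rpow {b : ℝ} (hb : 0 < b) {c d s : ℝ} :
    ∫ ξ in c..d, (s - ξ) ^ (b - 1) = ((s - c) ^ b - (s - d) ^ b) / b := by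
  rw [intervalIntegral.integral_comp_sub_left (fun x => x ^ (b - 1)),
    integral_rpow (Or.inl (by linarith))]
  simp

/-- Each factor is singular at one end only, so the interval is cut at its midpoint and on either
half one factor is continuous. -/
theorem intervalIntegrable_rpow_mul_rpow {a b : ℝ} (ha : 0 < a) (hb : 0 < b) {c s : ℝ}
    (hcs : c ≤ s) :
    IntervalIntegrable (fun ξ => (ξ - c) ^ (b - 1) * (s - ξ) ^ (a - 1)) volume c s := by
  rcases hcs.eq_or_lt with rfl | hcs
  · simp
  have h1 : IntervalIntegrable (fun ξ => (ξ - c) ^ (b - 1) * (s - ξ) ^ (a - 1))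
      volume c ((c + s) / 2) := by
    refine (intervalIntegrable_sub_left_rpow hb c _ _).mul_continuousOn ?_
    intro ξ hξ
    rw [uIcc_of_le (by linarith)] at hξ
    exact ((continuousAt_const.sub continuousAt_id).rpow_const
      (Or.inl (by have := hξ.2; show s - ξ ≠ 0; intro h0; linarith))).continuousWithinAt
  have h2 : IntervalIntegrable (fun ξ => (ξ - c) ^ (b - 1) * (s - ξ) ^ (a - 1))
      volume ((c + s) / 2) s := by
    refine (intervalIntegrable_sub_right_rpow ha s _ _).continuousOn_mul ?_
    intro ξ hξ
    rw [uIcc_of_le (by linarith)] at hξ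
    exact ((continuousAt_id.sub continuousAt_const).rpow_const
      (Or.inl (by have := hξ.1; show ξ - c ≠ 0; intro h0; linarith))).continuousWithinAt
  exact h1.trans h2

/-- Translation reduces this to the scaled complex Beta integral; both bases are nonnegative on the
interval, so complex and real powers agree there. -/
theorem integral_rpow_mul_rpow {a b : ℝ} (ha : 0 < a) (hb : 0 < b) {c s : ℝ} (hcs : c < s) :
    ∫ ξ in c..s, (ξ - c) ^ (b - 1) * (s - ξ) ^ (a - 1) =
      Real.Gamma b * Real.Gamma a / Real.Gamma (b + a) * (s - c) ^ (b + a - 1) := by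
  have hr : 0 < s - c := sub_pos.2 hcs
  have e1 : ∫ ξ in c..s, (ξ - c) ^ (b - 1) * (s - ξ) ^ (a - 1) =
      ∫ x in (0 : ℝ)..(s - c), x ^ (b - 1) * ((s - c) - x) ^ (a - 1) := by
    rw [← sub_self c, ← intervalIntegral.integral_comp_sub_right
      (fun x => x ^ (b - 1) * ((s - c) - x) ^ (a - 1))]
    simp
  have e2 := Complex.betaIntegral_scaled (b : ℂ) (a : ℂ) hr
  rw [Complex.betaIntegral_eq_Gamma_mul_div _ _ (by simpa) (by simpa)] at e2
  have e3 : ∫ x in (0 : ℝ)..(s - c), (x : ℂ) ^ ((b : ℂ) - 1) *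
      (((s - c : ℝ) : ℂ) - x) ^ ((a : ℂ) - 1) =
      ((∫ x in (0 : ℝ)..(s - c), x ^ (b - 1) * ((s - c) - x) ^ (a - 1) : ℝ) : ℂ) := by
    rw [← intervalIntegral.integral_ofReal]
    refine intervalIntegral.integral_congr fun x hx => ?_
    rw [uIcc_of_le hr.le] at hx
    rw [Complex.ofReal_mul, Complex.ofReal_cpow hx.1, Complex.ofReal_cpow (sub_nonneg.2 hx.2)]
    push_cast
    rfl
  rw [e3] at e2
  rw [e1]
  have : ((∫ x in (0 : ℝ)..(s - c), x ^ (b - 1) * ((s - c) - x) ^ (a - 1) : ℝ) : ℂ) =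
     ((Real.Gamma b * Real.Gamma a / Real.Gamma (b + a) * (s - c) ^ (b + a - 1) : ℝ) : ℂ) := by
    rw [e2]
    simp only [Complex.Gamma_ofReal, ← Complex.ofReal_add, ← Complex.ofReal_one,
      ← Complex.ofReal_sub]
    rw [← Complex.ofReal_cpow hr.le]
    push_cast
    ring
  exact_mod_cast this

/-! ### Elementary calculus of fractional integrals with a power singularity. -/

section Kernel

variable {a b c s : ℝ} {φ ψ : ℝ → ℝ}

/-- Discards the right end, where the kernel is singular and locality of the Caputo derivative is
not available. -/
theorem ae_Ioc_of_forall_Ioo {p : ℝ → Prop} (h : ∀ ξ ∈ Ioo c s, p ξ) :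
    ∀ᵐ ξ ∂(volume.restrict (Ioc c s)), p ξ := by
  rw [← restrict_Ioo_eq_restrict_Ioc]
  exact (ae_restrict_iff' measurableSet_Ioo).2 (ae_of_all _ h)

theorem aestronglyMeasurable_kernel (hφ : AEStronglyMeasurable φ (volume.restrict (Ioc c s))) :
    AEStronglyMeasurable (fun ξ => φ ξ / (s - ξ) ^ (1 - a)) (volume.restrict (Ioc c s)) := by
  simp_rw [div_eq_mul_inv]
  refine hφ.mul (Measurable.aestronglyMeasurable ?_)
  fun_prop

theorem intervalIntegrable_kernel (ha : 0 < a) (hb : 0 < b) (hcs : c ≤ s) {C : ℝ}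
    (hφ : AEStronglyMeasurable φ (volume.restrict (Ioc c s)))
    (hC : ∀ᵐ ξ ∂(volume.restrict (Ioc c s)), |φ ξ| ≤ C * (ξ - c) ^ (b - 1)) :
    IntervalIntegrable (fun ξ => φ ξ / (s - ξ) ^ (1 - a)) volume c s := by
  rw [intervalIntegrable_iff_integrableOn_Ioc_of_le hcs]
  have := (intervalIntegrable_iff_integrableOn_Ioc_of_le hcs).1
    ((intervalIntegrable_rpow_mul_rpow ha hb hcs).const_mul C)
  refine this.mono' (aestronglyMeasurable_kernel hφ) ?_
  filter_upwards [hC, ae_restrict_mem measurableSet_Ioc] with ξ h1 h2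
  have h3 : 0 ≤ s - ξ := sub_nonneg.2 h2.2
  rw [div_rpow_one_sub h3, norm_mul, Real.norm_eq_abs, Real.norm_eq_abs,
    abs_of_nonneg (Real.rpow_nonneg h3 _), ← mul_assoc]
  exact mul_le_mul_of_nonneg_right h1 (Real.rpow_nonneg h3 _)

theorem fracInt_const_mul (k : ℝ) : fracInt a c (fun ξ => k * φ ξ) s = k * fracInt a c φ s := by
  simp only [fracInt, mul_div_assoc, intervalIntegral.integral_const_mul]
  ring

theorem fracInt_add (hφ : IntervalIntegrable (fun ξ => φ ξ / (s - ξ) ^ (1 - a)) volume c s)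
    (hψ : IntervalIntegrable (fun ξ => ψ ξ / (s - ξ) ^ (1 - a)) volume c s) :
    fracInt a c (fun ξ => φ ξ + ψ ξ) s = fracInt a c φ s + fracInt a c ψ s := by
  simp only [fracInt, add_div, intervalIntegral.integral_add hφ hψ]
  ring

theorem fracInt_sub (hφ : IntervalIntegrable (fun ξ => φ ξ / (s - ξ) ^ (1 - a)) volume c s)
    (hψ : IntervalIntegrable (fun ξ => ψ ξ / (s - ξ) ^ (1 - a)) volume c s) :
    fracInt a c (fun ξ => φ ξ - ψ ξ) s = fracInt a c φ s - fracInt a c ψ s := by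
  simp only [fracInt, sub_div, intervalIntegral.integral_sub hφ hψ]
  ring

theorem fracInt_congr_ae (hcs : c ≤ s) (h : ∀ᵐ ξ ∂(volume.restrict (Ioc c s)), φ ξ = ψ ξ) :
    fracInt a c φ s = fracInt a c ψ s := by
  simp only [fracInt, intervalIntegral.integral_of_le hcs]
  congr 1
  refine integral_congr_ae ?_
  filter_upwards [h] with ξ hξ
  rw [hξ]

theorem fracInt_congr (hcs : c ≤ s) (h : ∀ ξ ∈ Ioo c s, φ ξ = ψ ξ) :
    fracInt a c φ s = fracInt a c ψ s :=
  fracInt_congr_ae hcs (ae_Ioc_of_forall_Ioo h)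

theorem abs_fracInt_le (ha : 0 < a) (hcs : c ≤ s)
    (hψ : IntervalIntegrable (fun ξ => ψ ξ / (s - ξ) ^ (1 - a)) volume c s)
    (h : ∀ᵐ ξ ∂(volume.restrict (Ioc c s)), |φ ξ| ≤ ψ ξ) :
    |fracInt a c φ s| ≤ fracInt a c ψ s := by
  have hΓ : 0 < 1 / Real.Gamma a := one_div_pos.2 (Real.Gamma_pos_of_pos ha)
  simp only [fracInt, abs_mul, abs_of_pos hΓ, intervalIntegral.integral_of_le hcs]
  refine mul_le_mul_of_nonneg_left ?_ hΓ.le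
  rw [← Real.norm_eq_abs]
  refine (norm_integral_le_integral_norm _).trans ?_
  refine integral_mono_of_nonneg (ae_of_all _ fun _ => norm_nonneg _)
    ((intervalIntegrable_iff_integrableOn_Ioc_of_le hcs).1 hψ) ?_
  filter_upwards [h, ae_restrict_mem measurableSet_Ioc] with ξ h1 h2
  have h3 : 0 ≤ (s - ξ) ^ (1 - a) := Real.rpow_nonneg (sub_nonneg.2 h2.2) _
  rw [norm_div, Real.norm_eq_abs, Real.norm_eq_abs, abs_of_nonneg h3]
  exact div_le_div_of_nonneg_right h1 h3

theorem fracInt_rpow (ha : 0 < a) (hb : 0 < b) (hcs : c < s) :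
    fracInt a c (fun ξ => (ξ - c) ^ (b - 1)) s =
      Real.Gamma b / Real.Gamma (b + a) * (s - c) ^ (b + a - 1) := by
  have hΓ := (Real.Gamma_pos_of_pos ha).ne'
  have : ∫ ξ in c..s, (ξ - c) ^ (b - 1) / (s - ξ) ^ (1 - a) =
      ∫ ξ in c..s, (ξ - c) ^ (b - 1) * (s - ξ) ^ (a - 1) := by
    refine intervalIntegral.integral_congr fun ξ hξ => ?_
    rw [uIcc_of_le hcs.le] at hξ
    exact div_rpow_one_sub (sub_nonneg.2 hξ.2) _ _
  rw [fracInt, this, integral_rpow_mul_rpow ha hb hcs]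
  field_simp

/-- Comparison with the exact value on a power: `I^a` improves the exponent of the singularity by
`a`. -/
theorem abs_fracInt_le_rpow (ha : 0 < a) (hb : 0 < b) (hcs : c < s) {C : ℝ}
    (h : ∀ᵐ ξ ∂(volume.restrict (Ioc c s)), |φ ξ| ≤ C * (ξ - c) ^ (b - 1)) :
    |fracInt a c φ s| ≤
      C * (Real.Gamma b / Real.Gamma (b + a)) * (s - c) ^ (b + a - 1) := by
  refine (abs_fracInt_le ha hcs.le ?_ h).trans_eq ?_
  · refine intervalIntegrable_kernel ha hb hcs.le (C := |C|) ?_ ?_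
    · exact (by fun_prop : Measurable fun ξ : ℝ => C * (ξ - c) ^ (b - 1)).aestronglyMeasurable
    · refine ae_Ioc_of_forall_Ioo fun ξ hξ => ?_
      rw [abs_mul, abs_of_nonneg (Real.rpow_nonneg (sub_nonneg.2 hξ.1.le) _)]
  · rw [fracInt_const_mul, fracInt_rpow ha hb hcs, mul_assoc]

end Kernel

/-! ### Exponentially weighted estimates and the singular Gronwall inequality. -/

/-- The Bielecki weight with a power singularity at `c`. -/
def wt (b lam c s : ℝ) : ℝ := (s - c) ^ (b - 1) * Real.exp (lam * (s - c))

theorem wt_pos {b lam c s : ℝ} (h : c < s) : 0 < wt b lam c s :=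
  mul_pos (Real.rpow_pos_of_pos (sub_pos.2 h) _) (Real.exp_pos _)

theorem rpow_le_wt {b lam c s : ℝ} (hlam : 0 ≤ lam) (h : c ≤ s) :
    (s - c) ^ (b - 1) ≤ wt b lam c s :=
  le_mul_of_one_le_right (Real.rpow_nonneg (sub_nonneg.2 h) _)
    (Real.one_le_exp (mul_nonneg hlam (sub_nonneg.2 h)))

theorem wt_le_rpow {b lam c s T : ℝ} (hlam : 0 ≤ lam) (h : c ≤ s) (hs : s ≤ c + T) :
    wt b lam c s ≤ Real.exp (lam * T) * (s - c) ^ (b - 1) := by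
  rw [wt, mul_comm]
  refine mul_le_mul_of_nonneg_right ?_ (Real.rpow_nonneg (sub_nonneg.2 h) _)
  exact Real.exp_le_exp.2 (mul_le_mul_of_nonneg_left (by linarith) hlam)

/-- Extending the integral to the half-line gives a Gamma integral. The factor `(1 / lam) ^ b` is
what makes the weighted norm of the fractional integral small. -/
theorem integral_rpow_mul_exp_neg_le {b lam : ℝ} (hb : 0 < b) (hlam : 0 < lam) {r : ℝ}
    (hr : 0 ≤ r) :
    IntervalIntegrable (fun x => x ^ (b - 1) * Real.exp (-(lam * x))) volume 0 r ∧
    ∫ x in (0 : ℝ)..r, x ^ (b - 1) * Real.exp (-(lam * x)) ≤ (1 / lam) ^ b * Real.Gamma b := by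
  have hI : IntegrableOn (fun x => x ^ (b - 1) * Real.exp (-(lam * x))) (Ioi 0) := by
    have := integrableOn_rpow_mul_exp_neg_mul_rpow (p := 1) (s := b - 1) (b := lam)
      (by linarith) one_pos hlam
    simpa [Real.rpow_one] using this
  rw [intervalIntegrable_iff_integrableOn_Ioc_of_le hr, intervalIntegral.integral_of_le hr,
    ← Real.integral_rpow_mul_exp_neg_mul_Ioi hb hlam]
  refine ⟨hI.mono_set Ioc_subset_Ioi_self, setIntegral_mono_set hI ?_
    (Ioc_subset_Ioi_self).eventuallyLE⟩
  refine (ae_restrict_iff' measurableSet_Ioi).2 (ae_of_all _ fun x hx => ?_)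
  exact mul_nonneg (Real.rpow_nonneg (le_of_lt hx) _) (Real.exp_pos _).le

/-- Subadditivity of the power `1 - b`, divided by all three powers. It acts as a partial fraction:
a product of singularities at the two ends becomes a sum, with the singularity of the weight at `x +
y` factored out. -/
theorem rpow_mul_rpow_le {b x y : ℝ} (hb0 : 0 ≤ b) (hb1 : b ≤ 1) (hx : 0 < x) (hy : 0 < y) :
    x ^ (b - 1) * y ^ (b - 1) ≤ (x + y) ^ (b - 1) * (x ^ (b - 1) + y ^ (b - 1)) := by
  have h := Real.rpow_add_le_add_rpow hx.le hy.le (p := 1 - b) (by linarith) (by linarith)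
  have e : ∀ z : ℝ, 0 < z → z ^ (b - 1) = (z ^ (1 - b))⁻¹ := fun z hz => by
    rw [show b - 1 = -(1 - b) by ring, Real.rpow_neg hz.le]
  have hx' := Real.rpow_pos_of_pos hx (1 - b)
  have hy' := Real.rpow_pos_of_pos hy (1 - b)
  have hxy := Real.rpow_pos_of_pos (add_pos hx hy) (1 - b)
  rw [e x hx, e y hy, e _ (add_pos hx hy)]
  rw [inv_add_inv hx'.ne' hy'.ne', ← mul_inv, inv_mul_eq_div, div_div,
    inv_eq_one_div, div_le_div_iff₀ (by positivity) (by positivity)]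
  nlinarith [mul_pos hx' hy']

/-- Both `z ^ (b - 1)` and `exp (-(lam * z))` decrease, so the mixed product is dominated by the
pure one at the smaller of `x` and `y`. -/
theorem rpow_mul_exp_swap_le {b lam x y : ℝ} (hb1 : b ≤ 1) (hlam : 0 ≤ lam) (hx : 0 < x)
    (hy : 0 < y) :
    x ^ (b - 1) * Real.exp (-(lam * y)) ≤
      x ^ (b - 1) * Real.exp (-(lam * x)) + y ^ (b - 1) * Real.exp (-(lam * y)) := by
  have hx' := Real.rpow_pos_of_pos hx (b - 1)
  have hy' := Real.rpow_pos_of_pos hy (b - 1)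
  rcases le_total x y with h | h
  · have : Real.exp (-(lam * y)) ≤ Real.exp (-(lam * x)) := Real.exp_le_exp.2 (by nlinarith)
    have := mul_le_mul_of_nonneg_left this hx'.le
    have := mul_pos hy' (Real.exp_pos (-(lam * y)))
    linarith
  · have : x ^ (b - 1) ≤ y ^ (b - 1) := Real.rpow_le_rpow_of_nonpos hy h (by linarith)
    have := mul_le_mul_of_nonneg_right this (Real.exp_pos (-(lam * y))).le
    have := mul_pos hx' (Real.exp_pos (-(lam * x)))
    linarith

theorem intervalIntegrable_wt_kernel {a b lam : ℝ} (ha : 0 < a) (hb : 0 < b) (hlam : 0 ≤ lam)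
    {c s : ℝ} (hcs : c ≤ s) :
    IntervalIntegrable (fun ξ => wt b lam c ξ / (s - ξ) ^ (1 - a)) volume c s := by
  refine intervalIntegrable_kernel ha hb hcs (C := Real.exp (lam * (s - c))) ?_ ?_
  · exact (by unfold wt; fun_prop : Measurable (wt b lam c)).aestronglyMeasurable
  · refine ae_Ioc_of_forall_Ioo fun ξ hξ => ?_
    rw [abs_of_pos (wt_pos hξ.1)]
    exact wt_le_rpow hlam hξ.1.le (by linarith [hξ.2])

/-- Lowering the kernel exponent from `a - 1` to `b - 1` costs `T ^ (a - b)`. The two preceding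
inequalities then bound the integrand by the weight at `s` times one profile measured from `c` and
two measured from `s`, each integrating to at most a Gamma value; hence the factor 3. -/
theorem fracInt_wt_le {a b lam T : ℝ} (ha : 0 < a) (hb : 0 < b) (hba : b ≤ a) (ha1 : a ≤ 1)
    (hlam : 0 < lam) {c s : ℝ} (hcs : c < s) (hs : s ≤ c + T) :
    fracInt a c (wt b lam c) s ≤
      3 * Real.Gamma b / Real.Gamma a * T ^ (a - b) * (1 / lam) ^ b * wt b lam c s := by
  have hr : 0 < s - c := sub_pos.2 hcs
  have hΓ := Real.Gamma_pos_of_pos ha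
  have hrT : s - c ≤ T := by linarith
  obtain ⟨i1, j1⟩ := integral_rpow_mul_exp_neg_le hb hlam hr.le
  set k : ℝ → ℝ := fun x => x ^ (b - 1) * Real.exp (-(lam * x)) with hk
  have i2 : IntervalIntegrable (fun ξ => k (ξ - c)) volume c s := by
    simpa using i1.comp_sub_right c
  have i3 : IntervalIntegrable (fun ξ => k (s - ξ)) volume c s := by
    have := i1.comp_sub_left s
    simp only [sub_zero, sub_sub_cancel] at this
    exact this.symm
  have e2 : ∫ ξ in c..s, k (ξ - c) = ∫ x in (0 : ℝ)..(s - c), k x := by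
    rw [intervalIntegral.integral_comp_sub_right k, sub_self]
  have e3 : ∫ ξ in c..s, k (s - ξ) = ∫ x in (0 : ℝ)..(s - c), k x := by
    rw [intervalIntegral.integral_comp_sub_left k, sub_self]
  have key : ∫ ξ in c..s, wt b lam c ξ / (s - ξ) ^ (1 - a) ≤
      ∫ ξ in c..s, T ^ (a - b) * wt b lam c s * (k (ξ - c) + 2 * k (s - ξ)) := by
    refine intervalIntegral.integral_mono_on_of_le_Ioo hcs.le
      (intervalIntegrable_wt_kernel ha hb hlam.le hcs.le) ((i2.add (i3.const_mul 2)).const_mul _) ?_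
    intro ξ hξ
    have hx : 0 < ξ - c := sub_pos.2 hξ.1
    have hy : 0 < s - ξ := sub_pos.2 hξ.2
    set x := ξ - c
    set y := s - ξ
    have hxy : s - c = x + y := by simp [x, y]
    have hyT : y ≤ T := by linarith
    have hT : 0 < T := hy.trans_le hyT
    rw [div_rpow_one_sub hy.le]
    have g1 : y ^ (a - 1) ≤ T ^ (a - b) * y ^ (b - 1) := by
      rw [show a - 1 = (a - b) + (b - 1) by ring, Real.rpow_add hy]
      exact mul_le_mul_of_nonneg_right (Real.rpow_le_rpow hy.le hyT (by linarith))
        (Real.rpow_nonneg hy.le _)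
    have g2 := rpow_mul_rpow_le hb.le (hba.trans ha1) hx hy
    have g3 := rpow_mul_exp_swap_le (hba.trans ha1) hlam.le hx hy
    have g4 : Real.exp (lam * x) = Real.exp (lam * (x + y)) * Real.exp (-(lam * y)) := by
      rw [← Real.exp_add]; ring_nf
    have hTp := Real.rpow_pos_of_pos hT (a - b)
    have hxp := Real.rpow_pos_of_pos hx (b - 1)
    have hyp := Real.rpow_pos_of_pos hy (b - 1)
    have hrp := Real.rpow_pos_of_pos (add_pos hx hy) (b - 1)
    simp only [wt, hk]
    rw [hxy]
    change x ^ (b - 1) * Real.exp (lam * x) * y ^ (a - 1) ≤ _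
    rw [g4]
    set E := Real.exp (lam * (x + y))
    set ey := Real.exp (-(lam * y))
    have hE : 0 < E := Real.exp_pos _
    have hey : 0 < ey := Real.exp_pos _
    calc x ^ (b - 1) * (E * ey) * y ^ (a - 1)
        ≤ x ^ (b - 1) * (E * ey) * (T ^ (a - b) * y ^ (b - 1)) :=
          mul_le_mul_of_nonneg_left g1 (by positivity)
      _ = T ^ (a - b) * (E * ey) * (x ^ (b - 1) * y ^ (b - 1)) := by ring
      _ ≤ T ^ (a - b) * (E * ey) * ((x + y) ^ (b - 1) * (x ^ (b - 1) + y ^ (b - 1))) :=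
          mul_le_mul_of_nonneg_left g2 (by positivity)
      _ = T ^ (a - b) * ((x + y) ^ (b - 1) * E) * (x ^ (b - 1) * ey + y ^ (b - 1) * ey) := by ring
      _ ≤ T ^ (a - b) * ((x + y) ^ (b - 1) * E) * (x ^ (b - 1) * Real.exp (-(lam * x)) +
            2 * (y ^ (b - 1) * ey)) :=
          mul_le_mul_of_nonneg_left (by linarith) (by positivity)
  rw [intervalIntegral.integral_const_mul, intervalIntegral.integral_add i2 (i3.const_mul 2),
    intervalIntegral.integral_const_mul, e2, e3] at key
  have hT : 0 < T := hr.trans_le hrT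
  have hw := wt_pos (b := b) (lam := lam) hcs
  calc fracInt a c (wt b lam c) s ≤ 1 / Real.Gamma a * (T ^ (a - b) * wt b lam c s *
        (3 * ((1 / lam) ^ b * Real.Gamma b))) := by
        refine mul_le_mul_of_nonneg_left (key.trans ?_) (by positivity)
        refine mul_le_mul_of_nonneg_left ?_ (by positivity)
        linarith
    _ = _ := by field_simp

/-- For `b = 1` the weight is a pure exponential and factors out of the convolution exactly. The
general estimate does not reach this case when `a < 1`, because it needs `b ≤ a`. -/
theorem fracInt_wt_one_le {a lam : ℝ} (ha : 0 < a) (hlam : 0 < lam) {c s : ℝ} (hcs : c < s) :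
    fracInt a c (wt 1 lam c) s ≤ (1 / lam) ^ a * wt 1 lam c s := by
  have hr : 0 < s - c := sub_pos.2 hcs
  have hΓ := Real.Gamma_pos_of_pos ha
  obtain ⟨i1, j1⟩ := integral_rpow_mul_exp_neg_le ha hlam hr.le
  have e : ∫ ξ in c..s, wt 1 lam c ξ / (s - ξ) ^ (1 - a) =
      wt 1 lam c s * ∫ x in (0 : ℝ)..(s - c), x ^ (a - 1) * Real.exp (-(lam * x)) := by
    rw [← sub_self s, ← intervalIntegral.integral_comp_sub_left
      (fun x => x ^ (a - 1) * Real.exp (-(lam * x))), ← intervalIntegral.integral_const_mul]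
    refine intervalIntegral.integral_congr fun ξ hξ => ?_
    rw [uIcc_of_le hcs.le] at hξ
    simp only [div_rpow_one_sub (sub_nonneg.2 hξ.2), wt, sub_self, Real.rpow_zero, one_mul]
    rw [show lam * (ξ - c) = lam * (s - c) + -(lam * (s - ξ)) by ring, Real.exp_add]
    ring
  rw [fracInt, e]
  calc _ ≤ 1 / Real.Gamma a * (wt 1 lam c s * ((1 / lam) ^ a * Real.Gamma a)) := by
        refine mul_le_mul_of_nonneg_left ?_ (by positivity)
        exact mul_le_mul_of_nonneg_left j1 (wt_pos hcs).le
    _ = _ := by field_simp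

/-- The constants carry a positive power of `1 / lam`. It matters that `lam` depends on the length
`T` but not on the left end `c`, which later moves with the initial time. -/
theorem exists_wt_contraction {a b : ℝ} (ha : 0 < a) (ha1 : a ≤ 1) (hb : 0 < b)
    (hba : b ≤ a ∨ b = 1) (T K : ℝ) (hK : 0 ≤ K) :
    ∃ lam : ℝ, 0 < lam ∧ ∀ c s : ℝ, c < s → s ≤ c + T →
      K * fracInt a c (wt b lam c) s ≤ 1 / 2 * wt b lam c s := by
  have aux : ∀ e : ℝ, 0 < e → ∀ D : ℝ, ∃ lam : ℝ, 0 < lam ∧ D * (1 / lam) ^ e ≤ 1 / 2 := by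
    intro e he D
    have h1 : Tendsto (fun lam : ℝ => D * (1 / lam) ^ e) atTop (𝓝 (D * 0)) := by
      refine Tendsto.const_mul D ?_
      have h2 : Tendsto (fun lam : ℝ => 1 / lam) atTop (𝓝 0) := by
        simpa using tendsto_inv_atTop_zero (𝕜 := ℝ)
      have := h2.rpow_const (p := e) (Or.inr he.le)
      rwa [Real.zero_rpow he.ne'] at this
    rw [mul_zero] at h1
    obtain ⟨l, h3, h4⟩ := ((h1.eventually_le_const (by norm_num : (0 : ℝ) < 1 / 2)).and
      (eventually_gt_atTop 0)).exists
    exact ⟨l, h4, h3⟩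
  rcases hba with hba | rfl
  · obtain ⟨lam, h1, h2⟩ := aux b hb (K * (3 * Real.Gamma b / Real.Gamma a * T ^ (a - b)))
    refine ⟨lam, h1, fun c s hcs hs => ?_⟩
    refine (mul_le_mul_of_nonneg_left (fracInt_wt_le ha hb hba ha1 h1 hcs hs) hK).trans ?_
    refine le_trans (le_of_eq ?_) (mul_le_mul_of_nonneg_right h2 (wt_pos hcs).le)
    ring
  · obtain ⟨lam, h1, h2⟩ := aux a ha K
    refine ⟨lam, h1, fun c s hcs hs => ?_⟩
    refine (mul_le_mul_of_nonneg_left (fracInt_wt_one_le ha h1 hcs) hK).trans ?_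
    refine le_trans (le_of_eq ?_) (mul_le_mul_of_nonneg_right h2 (wt_pos hcs).le)
    ring

/-- If `|φ| ≤ C ω` with `ω` the weight, then so is `|K I^a φ| ≤ (C / 2) ω`. -/
theorem abs_fracInt_le_wt {a b lam c d K C : ℝ} (ha : 0 < a) (hb : 0 < b) (hlam : 0 < lam)
    (hK : 0 ≤ K) (hC : 0 ≤ C)
    (hw : ∀ s ∈ Ioc c d, K * fracInt a c (wt b lam c) s ≤ 1 / 2 * wt b lam c s)
    {φ : ℝ → ℝ} (hφ : ∀ s ∈ Ioc c d, |φ s| ≤ C * wt b lam c s) :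
    ∀ s ∈ Ioc c d, K * |fracInt a c φ s| ≤ C / 2 * wt b lam c s := by
  intro s hs
  have h1 : |fracInt a c φ s| ≤ fracInt a c (fun ξ => C * wt b lam c ξ) s := by
    refine abs_fracInt_le ha hs.1.le ?_ ?_
    · simpa [mul_div_assoc] using (intervalIntegrable_wt_kernel ha hb hlam.le hs.1.le).const_mul C
    · exact ae_Ioc_of_forall_Ioo fun ξ hξ => hφ ξ ⟨hξ.1, hξ.2.le.trans hs.2⟩
  rw [fracInt_const_mul] at h1
  calc K * |fracInt a c φ s| ≤ K * (C * fracInt a c (wt b lam c) s) :=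
        mul_le_mul_of_nonneg_left h1 hK
    _ = C * (K * fracInt a c (wt b lam c) s) := by ring
    _ ≤ C * (1 / 2 * wt b lam c s) := mul_le_mul_of_nonneg_left (hw s hs) hC
    _ = _ := by ring

/-- Gronwall inequality with a weakly singular kernel and a weight singular at the left end. -/
theorem fractional_gronwall {a b : ℝ} (ha : 0 < a) (ha1 : a ≤ 1) (hb : 0 < b)
    (hba : b ≤ a ∨ b = 1) (T K : ℝ) (hK : 0 ≤ K) :
    ∃ B : ℝ, 0 < B ∧ ∀ (c d M : ℝ) (z : ℝ → ℝ), d ≤ c + T → 0 ≤ M →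
      (∃ C, ∀ s ∈ Ioc c d, |z s| ≤ C * (s - c) ^ (b - 1)) →
      (∀ s ∈ Ioc c d, |z s| ≤ M * (s - c) ^ (b - 1) + K * fracInt a c (fun ξ => |z ξ|) s) →
      ∀ s ∈ Ioc c d, |z s| ≤ B * M * (s - c) ^ (b - 1) := by
  obtain ⟨lam, hlam, hw⟩ := exists_wt_contraction ha ha1 hb hba T K hK
  refine ⟨2 * Real.exp (lam * T), by positivity, fun c d M z hd hM ⟨C, hC⟩ hz s hs => ?_⟩
  -- Reinserting a bound into the hypothesis replaces its constant `E` by `M + E / 2`, whose fixed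
  -- point is `2 * M`; the excess halves at each pass.
  have step : ∀ n : ℕ, ∀ s ∈ Ioc c d, |z s| ≤ (2 * M + |C| / 2 ^ n) * wt b lam c s := by
    intro n
    induction n with
    | zero =>
      intro s hs
      have h1 := rpow_le_wt (b := b) hlam.le hs.1.le
      have h2 : 0 ≤ (s - c) ^ (b - 1) := Real.rpow_nonneg (sub_nonneg.2 hs.1.le) _
      calc |z s| ≤ C * (s - c) ^ (b - 1) := hC s hs
        _ ≤ |C| * (s - c) ^ (b - 1) := mul_le_mul_of_nonneg_right (le_abs_self C) h2
        _ ≤ |C| * wt b lam c s := mul_le_mul_of_nonneg_left h1 (abs_nonneg C)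
        _ ≤ _ := by
          refine mul_le_mul_of_nonneg_right ?_ (wt_pos hs.1).le
          simp; positivity
    | succ n ih =>
      intro s hs
      have h1 := abs_fracInt_le_wt (φ := fun ξ => |z ξ|) ha hb hlam hK
        (by positivity : 0 ≤ 2 * M + |C| / 2 ^ n)
        (fun s hs => hw c s hs.1 (hs.2.trans hd)) (fun s hs => by rw [abs_abs]; exact ih s hs) s hs
      have h2 := mul_le_mul_of_nonneg_left (rpow_le_wt (b := b) hlam.le hs.1.le) hM
      have h3 := mul_le_mul_of_nonneg_left (le_abs_self (fracInt a c (fun ξ => |z ξ|) s)) hK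
      have e : (2 * M + |C| / 2 ^ (n + 1)) * wt b lam c s =
        M * wt b lam c s + (2 * M + |C| / 2 ^ n) / 2 * wt b lam c s := by
        rw [pow_succ]; ring
      rw [e]
      linarith [hz s hs]
  have lim : Tendsto (fun n : ℕ => (2 * M + |C| / 2 ^ n) * wt b lam c s) atTop
      (𝓝 ((2 * M + 0) * wt b lam c s)) := by
    refine Tendsto.mul_const _ (Tendsto.const_add _ ?_)
    have := (tendsto_pow_atTop_nhds_zero_of_lt_one (r := (1 / 2 : ℝ)) (by norm_num)
      (by norm_num)).const_mul |C|
    simpa [div_eq_mul_inv] using this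
  have h1 := ge_of_tendsto' lim fun n => step n s hs
  have h2 := mul_le_mul_of_nonneg_left
    (wt_le_rpow (b := b) hlam.le hs.1.le (hs.2.trans hd)) (by positivity : 0 ≤ 2 * M)
  calc |z s| ≤ 2 * M * wt b lam c s := by simpa using h1
    _ ≤ _ := h2
    _ = _ := by ring

/-! ### Fubini on a triangle and the semigroup property. -/

/-- Interchange of the order of integration over a triangle. -/
theorem integral_triangle_swap {c s : ℝ} (hcs : c ≤ s) {k : ℝ × ℝ → ℝ}
    (hk : AEStronglyMeasurable k ((volume.restrict (Ioc c s)).prod (volume.restrict (Ioc c s))))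
    (h1 : ∀ ξ ∈ Ioo c s, IntervalIntegrable (fun η => k (η, ξ)) volume ξ s)
    (h2 : IntervalIntegrable (fun ξ => ∫ η in ξ..s, ‖k (η, ξ)‖) volume c s) :
    ∫ η in c..s, ∫ ξ in c..η, k (η, ξ) = ∫ ξ in c..s, ∫ η in ξ..s, k (η, ξ) := by
  set A : Set (ℝ × ℝ) := {p | p.2 < p.1} with hA
  have hAm : MeasurableSet A := measurableSet_lt measurable_snd measurable_fst
  have sec : ∀ g : ℝ × ℝ → ℝ, ∀ ξ, (fun η => A.indicator g (η, ξ)) =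
      (Ioi ξ).indicator fun η => g (η, ξ) := by
    intro g ξ
    ext η
    simp [indicator, hA]
  have sec' : ∀ η, (fun ξ => A.indicator k (η, ξ)) =
      (Iio η).indicator fun ξ => k (η, ξ) := by
    intro η
    ext ξ
    simp [indicator, hA]
  have inter : ∀ ξ, c < ξ → Ioc c s ∩ Ioi ξ = Ioc ξ s := by
    intro ξ hξ
    rw [Ioc_inter_Ioi, max_eq_right hξ.le]
  have intg : ∀ g : ℝ × ℝ → ℝ, ∀ ξ ∈ Ioc c s,
      ∫ η in Ioc c s, A.indicator g (η, ξ) = ∫ η in ξ..s, g (η, ξ) := by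
    intro g ξ hξ
    rw [sec, setIntegral_indicator measurableSet_Ioi, inter ξ hξ.1,
      intervalIntegral.integral_of_le hξ.2]
  have intg' : ∀ η ∈ Ioc c s,
      ∫ ξ in Ioc c s, A.indicator k (η, ξ) = ∫ ξ in c..η, k (η, ξ) := by
    intro η hη
    rw [sec', setIntegral_indicator measurableSet_Iio, intervalIntegral.integral_of_le hη.1.le,
      ← integral_Ioc_eq_integral_Ioo.symm]
    congr 2
    ext ξ
    simp only [mem_inter_iff, mem_Ioc, mem_Iio, mem_Ioo]
    exact ⟨fun h => ⟨h.1.1, h.2⟩, fun h => ⟨⟨h.1, h.2.le.trans hη.2⟩, h.2⟩⟩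
  -- Fubini is applied on the square to the kernel cut off by the indicator of the triangle.
  have hint : Integrable (A.indicator k)
      ((volume.restrict (Ioc c s)).prod (volume.restrict (Ioc c s))) := by
    rw [integrable_prod_iff' (hk.indicator hAm)]
    constructor
    · refine ae_Ioc_of_forall_Ioo fun ξ hξ => ?_
      rw [sec, integrable_indicator_iff measurableSet_Ioi, IntegrableOn,
        Measure.restrict_restrict measurableSet_Ioi, inter_comm, inter ξ hξ.1]
      exact (intervalIntegrable_iff_integrableOn_Ioc_of_le hξ.2.le).1 (h1 ξ hξ)
    · refine ((intervalIntegrable_iff_integrableOn_Ioc_of_le hcs).1 h2).congr ?_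
      filter_upwards [ae_restrict_mem measurableSet_Ioc] with ξ hξ
      refine (intg (fun p => ‖k p‖) ξ hξ).symm.trans ?_
      congr 1
      ext η
      rw [norm_indicator_eq_indicator_norm]
  have := integral_integral_swap (f := fun η ξ => A.indicator k (η, ξ)) hint
  rw [intervalIntegral.integral_of_le hcs, intervalIntegral.integral_of_le hcs]
  rw [setIntegral_congr_fun measurableSet_Ioc fun η hη => (intg' η hη),
    setIntegral_congr_fun measurableSet_Ioc fun ξ hξ => (intg k ξ hξ)] at this
  exact this

theorem aestronglyMeasurable_comp_snd_mul {c s : ℝ} {φ : ℝ → ℝ} {g : ℝ × ℝ → ℝ}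
    {μ : Measure ℝ} [SFinite μ]
    (hφ : AEStronglyMeasurable φ (volume.restrict (Ioc c s))) (hg : Measurable g) :
    AEStronglyMeasurable (fun p : ℝ × ℝ => g p * φ p.2)
      (μ.prod (volume.restrict (Ioc c s))) :=
  hg.aestronglyMeasurable.mul hφ.comp_snd

/-- The semigroup property of Riemann–Liouville integrals. -/
theorem fracInt_fracInt {a b c s : ℝ} {φ : ℝ → ℝ} (ha : 0 < a) (hb : 0 < b) (hab : 1 ≤ a + b)
    (hcs : c ≤ s) (hφ : IntervalIntegrable φ volume c s) :
    fracInt a c (fracInt b c φ) s = fracInt (a + b) c φ s := by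
  have hΓa := Real.Gamma_pos_of_pos ha
  have hΓb := Real.Gamma_pos_of_pos hb
  have hΓab := Real.Gamma_pos_of_pos (add_pos ha hb)
  set k : ℝ × ℝ → ℝ := fun p => ((p.1 - p.2) ^ (b - 1) * (s - p.1) ^ (a - 1)) * φ p.2 with hk
  have hφm := ((intervalIntegrable_iff_integrableOn_Ioc_of_le hcs).1 hφ).aestronglyMeasurable
  have hkm : AEStronglyMeasurable k
      ((volume.restrict (Ioc c s)).prod (volume.restrict (Ioc c s))) :=
    aestronglyMeasurable_comp_snd_mul hφm (by fun_prop)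
  set D := Real.Gamma b * Real.Gamma a / Real.Gamma (b + a)
  have hin : ∀ ξ ∈ Ioo c s, ∫ η in ξ..s, k (η, ξ) = D * (φ ξ / (s - ξ) ^ (1 - (a + b))) := by
    intro ξ hξ
    simp only [hk]
    rw [intervalIntegral.integral_mul_const, integral_rpow_mul_rpow ha hb hξ.2,
      div_rpow_one_sub (sub_pos.2 hξ.2).le, add_comm b a]
    simp only [D, add_comm b a]; ring
  have swap := integral_triangle_swap hcs hkm ?_ ?_
  · have e1 : ∫ η in c..s, ∫ ξ in c..η, k (η, ξ) =
        ∫ η in c..s, Real.Gamma b * (fracInt b c φ η / (s - η) ^ (1 - a)) := by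
      refine intervalIntegral.integral_congr fun η hη => ?_
      rw [uIcc_of_le hcs] at hη
      rw [div_rpow_one_sub (sub_nonneg.2 hη.2), fracInt, ← mul_assoc, ← mul_assoc,
        mul_one_div_cancel hΓb.ne', one_mul, ← intervalIntegral.integral_mul_const]
      refine intervalIntegral.integral_congr fun ξ hξ => ?_
      rw [uIcc_of_le hη.1] at hξ
      simp only [hk]
      rw [div_rpow_one_sub (sub_nonneg.2 hξ.2)]
      ring
    have e2 : ∫ ξ in c..s, ∫ η in ξ..s, k (η, ξ) =
        ∫ ξ in c..s, D * (φ ξ / (s - ξ) ^ (1 - (a + b))) := by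
      rw [intervalIntegral.integral_of_le hcs, intervalIntegral.integral_of_le hcs]
      exact integral_congr_ae (ae_Ioc_of_forall_Ioo hin)
    rw [e1, e2, intervalIntegral.integral_const_mul, intervalIntegral.integral_const_mul] at swap
    have : ∫ η in c..s, fracInt b c φ η / (s - η) ^ (1 - a) =
        D / Real.Gamma b * ∫ ξ in c..s, φ ξ / (s - ξ) ^ (1 - (a + b)) := by
      field_simp; linarith
    rw [fracInt, this, fracInt]
    simp only [D, add_comm b a]
    field_simp
  · intro ξ hξ
    simp only [hk]
    exact (intervalIntegrable_rpow_mul_rpow ha hb hξ.2.le).mul_const _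
  -- Here `1 ≤ a + b` enters: the composed kernel is continuous, so integrability of `φ` alone
  -- suffices.
  · have hI : IntervalIntegrable (fun ξ => |φ ξ| * (D * (s - ξ) ^ (a + b - 1))) volume c s := by
      refine hφ.abs.mul_continuousOn (ContinuousOn.mul continuousOn_const ?_)
      exact (continuousOn_const.sub continuousOn_id).rpow_const
        fun _ _ => Or.inr (by linarith)
    rw [intervalIntegrable_iff_integrableOn_Ioc_of_le hcs] at hI ⊢
    refine hI.congr (ae_Ioc_of_forall_Ioo fun ξ hξ => ?_)
    have : ∫ η in ξ..s, ‖k (η, ξ)‖ =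
        ∫ η in ξ..s, ((η - ξ) ^ (b - 1) * (s - η) ^ (a - 1)) * |φ ξ| := by
      refine intervalIntegral.integral_congr fun η hη => ?_
      rw [uIcc_of_le hξ.2.le] at hη
      have h3 := Real.rpow_nonneg (sub_nonneg.2 hη.1) (b - 1)
      have h4 := Real.rpow_nonneg (sub_nonneg.2 hη.2) (a - 1)
      simp only [hk, norm_mul, Real.norm_eq_abs, abs_of_nonneg h3, abs_of_nonneg h4]
    simp only
    rw [this, intervalIntegral.integral_mul_const, integral_rpow_mul_rpow ha hb hξ.2,
      add_comm b a]
    simp only [D, add_comm b a]; ring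

theorem fracInt_one (c : ℝ) (φ : ℝ → ℝ) (s : ℝ) : fracInt 1 c φ s = ∫ ξ in c..s, φ ξ := by
  simp [fracInt]

/-! ### The Caputo derivative as inverse of the fractional integral. -/

section Caputo

variable {α t : ℝ} {x : ℝ → ℝ}

theorem ae_restrict_Icc_iff {p : ℝ → Prop} {c d : ℝ} :
    (∀ᵐ ξ ∂(volume.restrict (Icc c d)), p ξ) ↔ ∀ᵐ ξ ∂(volume.restrict (Ioc c d)), p ξ := by
  rw [restrict_Ioc_eq_restrict_Icc]

theorem memLp_top_intervalIntegrable {l : ℝ → ℝ}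
    (hl : MemLp l ⊤ (volume.restrict (Icc 0 t))) (ht : 0 ≤ t) :
    IntervalIntegrable l volume 0 t := by
  rw [intervalIntegrable_iff_integrableOn_Icc_of_le ht]
  exact hl.integrable le_top

theorem memLp_top_bound {l : ℝ → ℝ} {c d : ℝ} (hl : MemLp l ⊤ (volume.restrict (Icc c d))) :
    ∃ C, 0 ≤ C ∧ ∀ᵐ ξ ∂(volume.restrict (Ioc c d)), |l ξ| ≤ C := by
  refine ⟨(eLpNormEssSup l (volume.restrict (Icc c d))).toReal, ENNReal.toReal_nonneg, ?_⟩
  rw [← ae_restrict_Icc_iff]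
  have hfin : eLpNormEssSup l (volume.restrict (Icc c d)) ≠ ⊤ := by
    rw [← eLpNorm_exponent_top]; exact hl.2.ne
  filter_upwards [ae_le_eLpNormEssSup (f := l) (μ := volume.restrict (Icc c d))] with ξ hξ
  rw [← Real.norm_eq_abs, ← toReal_enorm]
  exact ENNReal.toReal_mono hfin hξ

/-- The Caputo derivative of `x(0) + I^α l` is `l` almost everywhere. -/
theorem caputoDeriv_ae_eq (hα0 : 0 < α) (hα1 : α < 1) (ht : 0 ≤ t) {l : ℝ → ℝ}
    (hl : MemLp l ⊤ (volume.restrict (Icc 0 t)))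
    (hx : ∀ τ ∈ Icc 0 t, x τ = x 0 + fracInt α 0 l τ) :
    ∀ᵐ τ ∂(volume.restrict (Ioc 0 t)), caputoDeriv α x τ = l τ := by
  have hli := memLp_top_intervalIntegrable hl ht
  have hΓ := (Real.Gamma_pos_of_pos (sub_pos.2 hα1)).ne'
  have key : ∀ s ∈ Icc 0 t, ∫ ξ in (0 : ℝ)..s, (x ξ - x 0) / (s - ξ) ^ α =
      Real.Gamma (1 - α) * ∫ ξ in (0 : ℝ)..s, l ξ := by
    intro s hs
    -- The integral being differentiated is, up to a Gamma factor, `I^(1-α) I^α l = I^1 l`; Lebesgue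
    -- differentiation then recovers `l`.
    have h1 := fracInt_fracInt (sub_pos.2 hα1) hα0 (by linarith) hs.1
      (hli.mono_set (by rw [uIcc_of_le ht, uIcc_of_le hs.1]; exact Icc_subset_Icc le_rfl hs.2))
    rw [sub_add_cancel, fracInt_one] at h1
    rw [← h1, fracInt, sub_sub_cancel, ← mul_assoc, mul_one_div_cancel hΓ, one_mul]
    refine intervalIntegral.integral_congr fun ξ hξ => ?_
    rw [uIcc_of_le hs.1] at hξ
    rw [hx ξ ⟨hξ.1, hξ.2.trans hs.2⟩, add_sub_cancel_left]
  have h2 := hli.ae_hasDerivAt_integral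
  rw [← restrict_Ioo_eq_restrict_Ioc, ae_restrict_iff' measurableSet_Ioo]
  filter_upwards [h2] with τ h3 hτ
  rw [uIcc_of_le ht] at h3
  have h4 := (h3 ⟨hτ.1.le, hτ.2.le⟩ 0 ⟨le_rfl, ht⟩).const_mul (Real.Gamma (1 - α))
  have h5 : HasDerivAt (fun s => ∫ ξ in (0 : ℝ)..s, (x ξ - x 0) / (s - ξ) ^ α)
      (Real.Gamma (1 - α) * l τ) τ := by
    refine h4.congr_of_eventuallyEq ?_
    filter_upwards [Ioo_mem_nhds hτ.1 hτ.2] with s hs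
    exact key s ⟨hs.1.le, hs.2.le⟩
  rw [caputoDeriv, h5.deriv, ← mul_assoc, one_div_mul_cancel hΓ, one_mul]

theorem IsAC.memLp_caputoDeriv (hα0 : 0 < α) (hα1 : α < 1) (ht : 0 ≤ t) (hx : IsAC α t x) :
    MemLp (caputoDeriv α x) ⊤ (volume.restrict (Icc 0 t)) := by
  obtain ⟨l, hl, h⟩ := hx
  refine hl.ae_eq ?_
  rw [EventuallyEq, ae_restrict_Icc_iff]
  filter_upwards [caputoDeriv_ae_eq hα0 hα1 ht hl h] with ξ hξ using hξ.symm

/-- The unspecified density in the definition agrees almost everywhere with the Caputo derivative,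
which can therefore serve as the canonical one. -/
theorem IsAC.eq_fracInt (hα0 : 0 < α) (hα1 : α < 1) (ht : 0 ≤ t) (hx : IsAC α t x) :
    ∀ τ ∈ Icc 0 t, x τ = x 0 + fracInt α 0 (caputoDeriv α x) τ := by
  obtain ⟨l, hl, h⟩ := hx
  intro τ hτ
  rw [h τ hτ]
  congr 1
  refine fracInt_congr_ae hτ.1 ?_
  have := ae_mono (Measure.restrict_mono (Ioc_subset_Ioc_right hτ.2) le_rfl)
    (caputoDeriv_ae_eq hα0 hα1 ht hl h)
  filter_upwards [this] with ξ hξ using hξ.symm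

/-- The Caputo derivative is local: it only depends on the past. -/
theorem caputoDeriv_congr {y : ℝ → ℝ} (h : ∀ ξ ∈ Icc 0 t, x ξ = y ξ) {τ : ℝ} (hτ : τ ∈ Ioo 0 t) :
    caputoDeriv α x τ = caputoDeriv α y τ := by
  rw [caputoDeriv, caputoDeriv]
  congr 1
  refine EventuallyEq.deriv_eq ?_
  filter_upwards [Ioo_mem_nhds hτ.1 hτ.2] with s hs
  refine intervalIntegral.integral_congr fun ξ hξ => ?_
  rw [uIcc_of_le hs.1.le] at hξ
  rw [h ξ ⟨hξ.1, hξ.2.trans hs.2.le⟩, h 0 ⟨le_rfl, hτ.1.le.trans hτ.2.le⟩]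

end Caputo

/-! ### Hölder continuity of fractional integrals of bounded functions. -/

section Bounded

variable {a c d M : ℝ} {l : ℝ → ℝ}

theorem intervalIntegrable_kernel_of_bounded (ha : 0 < a) {u v s : ℝ} (huv : u ≤ v) (hvs : v ≤ s)
    (hl : AEStronglyMeasurable l (volume.restrict (Ioc u v)))
    (hM : ∀ᵐ ξ ∂(volume.restrict (Ioc u v)), |l ξ| ≤ M) :
    IntervalIntegrable (fun ξ => l ξ / (s - ξ) ^ (1 - a)) volume u v := by
  rw [intervalIntegrable_iff_integrableOn_Ioc_of_le huv]
  refine Integrable.mono' (((intervalIntegrable_iff_integrableOn_Ioc_of_le huv).1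
    (intervalIntegrable_sub_right_rpow ha s u v)).const_mul M) ?_ ?_
  · simp_rw [div_eq_mul_inv]
    exact hl.mul (by fun_prop : Measurable fun ξ : ℝ => ((s - ξ) ^ (1 - a))⁻¹).aestronglyMeasurable
  · filter_upwards [hM, ae_restrict_mem measurableSet_Ioc] with ξ h1 h2
    have h3 : 0 ≤ s - ξ := sub_nonneg.2 (h2.2.trans hvs)
    rw [div_rpow_one_sub h3, norm_mul, Real.norm_eq_abs, Real.norm_eq_abs,
      abs_of_nonneg (Real.rpow_nonneg h3 _)]
    exact mul_le_mul_of_nonneg_right h1 (Real.rpow_nonneg h3 _)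

theorem abs_integral_kernel_le (ha : 0 < a) {u v s : ℝ} (huv : u ≤ v) (hvs : v ≤ s)
    (hM : ∀ᵐ ξ ∂(volume.restrict (Ioc u v)), |l ξ| ≤ M) :
    |∫ ξ in u..v, l ξ / (s - ξ) ^ (1 - a)| ≤ M * (((s - u) ^ a - (s - v) ^ a) / a) := by
  rw [← integral_sub_right_rpow ha, ← intervalIntegral.integral_const_mul,
    intervalIntegral.integral_of_le huv, intervalIntegral.integral_of_le huv, ← Real.norm_eq_abs]
  refine (norm_integral_le_integral_norm _).trans ?_
  refine integral_mono_of_nonneg (ae_of_all _ fun _ => norm_nonneg _)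
    (((intervalIntegrable_iff_integrableOn_Ioc_of_le huv).1
    (intervalIntegrable_sub_right_rpow ha s u v)).const_mul M) ?_
  filter_upwards [hM, ae_restrict_mem measurableSet_Ioc] with ξ h1 h2
  have h3 : 0 ≤ s - ξ := sub_nonneg.2 (h2.2.trans hvs)
  rw [div_rpow_one_sub h3, norm_mul, Real.norm_eq_abs, Real.norm_eq_abs,
    abs_of_nonneg (Real.rpow_nonneg h3 _)]
  exact mul_le_mul_of_nonneg_right h1 (Real.rpow_nonneg h3 _)

theorem aestronglyMeasurable_mono_Ioc {u v : ℝ} (hcu : c ≤ u) (hvd : v ≤ d)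
    (hl : AEStronglyMeasurable l (volume.restrict (Ioc c d))) :
    AEStronglyMeasurable l (volume.restrict (Ioc u v)) :=
  hl.mono_measure (Measure.restrict_mono (Ioc_subset_Ioc hcu hvd) le_rfl)

theorem ae_mono_Ioc {p : ℝ → Prop} {u v : ℝ} (hcu : c ≤ u) (hvd : v ≤ d)
    (h : ∀ᵐ ξ ∂(volume.restrict (Ioc c d)), p ξ) :
    ∀ᵐ ξ ∂(volume.restrict (Ioc u v)), p ξ :=
  ae_mono (Measure.restrict_mono (Ioc_subset_Ioc hcu hvd) le_rfl) h

/-- As `a ≤ 1`, the kernel decreases in its base point, so the difference has a constant sign and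
its absolute value integrates explicitly. -/
theorem abs_integral_kernel_sub_le (ha : 0 < a) (ha1 : a ≤ 1) {u v s s' : ℝ} (huv : u ≤ v)
    (hvs : v ≤ s) (hss : s ≤ s')
    (hM : ∀ᵐ ξ ∂(volume.restrict (Ioc u v)), |l ξ| ≤ M) :
    |∫ ξ in u..v, l ξ * ((s - ξ) ^ (a - 1) - (s' - ξ) ^ (a - 1))| ≤
      M * (((s - u) ^ a - (s - v) ^ a) / a - ((s' - u) ^ a - (s' - v) ^ a) / a) := by
  have i1 := intervalIntegrable_sub_right_rpow ha s u v
  have i2 := intervalIntegrable_sub_right_rpow ha s' u v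
  rw [← integral_sub_right_rpow ha, ← integral_sub_right_rpow ha,
    ← intervalIntegral.integral_sub i1 i2, ← intervalIntegral.integral_const_mul,
    intervalIntegral.integral_of_le huv, intervalIntegral.integral_of_le huv, ← Real.norm_eq_abs]
  refine (norm_integral_le_integral_norm _).trans ?_
  refine integral_mono_of_nonneg (ae_of_all _ fun _ => norm_nonneg _)
    (((intervalIntegrable_iff_integrableOn_Ioc_of_le huv).1 (i1.sub i2)).const_mul M) ?_
  rw [← restrict_Ioo_eq_restrict_Ioc] at hM ⊢
  filter_upwards [hM, ae_restrict_mem measurableSet_Ioo] with ξ h1 h2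
  have h3 : 0 < s - ξ := sub_pos.2 (h2.2.trans_le hvs)
  have h4 : (s' - ξ) ^ (a - 1) ≤ (s - ξ) ^ (a - 1) :=
    Real.rpow_le_rpow_of_nonpos h3 (by linarith) (by linarith)
  rw [norm_mul, Real.norm_eq_abs, Real.norm_eq_abs, abs_of_nonneg (sub_nonneg.2 h4)]
  exact mul_le_mul_of_nonneg_right h1 (sub_nonneg.2 h4)

/-- The change of kernel on `[c, s]` and the new piece on `[s, s']` contribute at most `M (s' - s)^a
/ a` each, which explains the factor 2. -/
theorem abs_fracInt_sub_le (ha : 0 < a) (ha1 : a ≤ 1)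
    (hl : AEStronglyMeasurable l (volume.restrict (Ioc c d))) (hM0 : 0 ≤ M)
    (hM : ∀ᵐ ξ ∂(volume.restrict (Ioc c d)), |l ξ| ≤ M) {s s' : ℝ} (hcs : c ≤ s) (hss : s ≤ s')
    (hsd : s' ≤ d) :
    |fracInt a c l s' - fracInt a c l s| ≤
      1 / Real.Gamma a * (2 * M / a) * (s' - s) ^ a := by
  have hΓ := one_div_pos.2 (Real.Gamma_pos_of_pos ha)
  have i1 := intervalIntegrable_kernel_of_bounded ha (s := s') hcs hss
    (aestronglyMeasurable_mono_Ioc le_rfl (hss.trans hsd) hl)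
    (ae_mono_Ioc le_rfl (hss.trans hsd) hM)
  have i2 := intervalIntegrable_kernel_of_bounded ha (s := s') hss le_rfl
    (aestronglyMeasurable_mono_Ioc hcs hsd hl) (ae_mono_Ioc hcs hsd hM)
  have i3 := intervalIntegrable_kernel_of_bounded ha (s := s) hcs le_rfl
    (aestronglyMeasurable_mono_Ioc le_rfl (hss.trans hsd) hl)
    (ae_mono_Ioc le_rfl (hss.trans hsd) hM)
  have b1 := abs_integral_kernel_sub_le (l := l) ha ha1 hcs le_rfl hss
    (ae_mono_Ioc le_rfl (hss.trans hsd) hM)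
  have b2 := abs_integral_kernel_le (l := l) ha hss le_rfl (ae_mono_Ioc hcs hsd hM)
  have e1 : ∫ ξ in c..s, l ξ * ((s - ξ) ^ (a - 1) - (s' - ξ) ^ (a - 1)) =
      (∫ ξ in c..s, l ξ / (s - ξ) ^ (1 - a)) - ∫ ξ in c..s, l ξ / (s' - ξ) ^ (1 - a) := by
    rw [← intervalIntegral.integral_sub i3 i1]
    refine intervalIntegral.integral_congr fun ξ hξ => ?_
    rw [uIcc_of_le hcs] at hξ
    simp only [div_rpow_one_sub (sub_nonneg.2 hξ.2),
      div_rpow_one_sub (sub_nonneg.2 (hξ.2.trans hss))]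
    ring
  rw [e1] at b1
  simp only [sub_self, Real.zero_rpow ha.ne', sub_zero] at b1 b2
  have mono : (s - c) ^ a ≤ (s' - c) ^ a :=
    Real.rpow_le_rpow (sub_nonneg.2 hcs) (by linarith) ha.le
  rw [fracInt, fracInt, ← mul_sub, abs_mul, abs_of_pos hΓ, mul_assoc,
    ← intervalIntegral.integral_add_adjacent_intervals i1 i2]
  refine mul_le_mul_of_nonneg_left ?_ hΓ.le
  have h5 : M * ((s - c) ^ a / a - ((s' - c) ^ a - (s' - s) ^ a) / a) ≤
      M * ((s' - s) ^ a / a) := by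
    refine mul_le_mul_of_nonneg_left ?_ hM0
    rw [← sub_div]
    exact div_le_div_of_nonneg_right (by linarith) ha.le
  have e2 : 2 * M / a * (s' - s) ^ a = M * ((s' - s) ^ a / a) + M * ((s' - s) ^ a / a) := by ring
  rw [e2]
  rw [abs_le] at b1 b2 ⊢
  constructor <;> linarith [b1.1, b1.2, b2.1, b2.2]

theorem continuousOn_fracInt_of_bounded (ha : 0 < a) (ha1 : a ≤ 1)
    (hl : AEStronglyMeasurable l (volume.restrict (Ioc c d)))
    (hM : ∀ᵐ ξ ∂(volume.restrict (Ioc c d)), |l ξ| ≤ M) :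
    ContinuousOn (fracInt a c l) (Icc c d) := by
  have hM' : ∀ᵐ ξ ∂(volume.restrict (Ioc c d)), |l ξ| ≤ |M| := by
    filter_upwards [hM] with ξ h using h.trans (le_abs_self M)
  set D := 1 / Real.Gamma a * (2 * |M| / a)
  intro s hs
  have key : ∀ s' ∈ Icc c d, |fracInt a c l s' - fracInt a c l s| ≤ D * |s' - s| ^ a := by
    intro s' hs'
    rcases le_total s s' with h | h
    · rw [abs_of_nonneg (sub_nonneg.2 h)]
      exact abs_fracInt_sub_le ha ha1 hl (abs_nonneg M) hM' hs.1 h hs'.2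
    · rw [abs_sub_comm s' s, abs_of_nonneg (sub_nonneg.2 h), abs_sub_comm]
      exact abs_fracInt_sub_le ha ha1 hl (abs_nonneg M) hM' hs'.1 h hs.2
  rw [ContinuousWithinAt, tendsto_iff_norm_sub_tendsto_zero]
  refine squeeze_zero' (Eventually.of_forall fun _ => norm_nonneg _)
    (eventually_nhdsWithin_of_forall key) ?_
  have : Continuous fun s' : ℝ => D * |s' - s| ^ a :=
    continuous_const.mul ((continuous_id.sub continuous_const).abs.rpow_const
      fun _ => Or.inr ha.le)
  have h := (this.tendsto s).mono_left (nhdsWithin_le_nhds (s := Icc c d))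
  simpa [Real.zero_rpow ha.ne'] using h

end Bounded

/-! ### Weighted continuous functions and their stability under fractional integration. -/

/-- Continuity on `(c, d]` with a singularity at `c` of order at most `(s - c) ^ (b - 1)`. -/
def WCont (b c d : ℝ) (φ : ℝ → ℝ) : Prop :=
  ContinuousOn φ (Ioc c d) ∧ ∃ C, ∀ s ∈ Ioc c d, |φ s| ≤ C * (s - c) ^ (b - 1)

namespace WCont

variable {a b c d : ℝ} {φ ψ : ℝ → ℝ}

theorem aestronglyMeasurable (hφ : WCont b c d φ) {s : ℝ} (hs : s ≤ d) :
    AEStronglyMeasurable φ (volume.restrict (Ioc c s)) :=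
  (hφ.1.mono (Ioc_subset_Ioc_right hs)).aestronglyMeasurable measurableSet_Ioc

theorem intervalIntegrable_kernel (hφ : WCont b c d φ) (ha : 0 < a) (hb : 0 < b) {s : ℝ}
    (hs : s ∈ Icc c d) : IntervalIntegrable (fun ξ => φ ξ / (s - ξ) ^ (1 - a)) volume c s := by
  obtain ⟨C, hC⟩ := hφ.2
  refine CaputoCauchy.intervalIntegrable_kernel ha hb hs.1 (C := C)
    (hφ.aestronglyMeasurable hs.2) ?_
  exact ae_Ioc_of_forall_Ioo fun ξ hξ => hC ξ ⟨hξ.1, hξ.2.le.trans hs.2⟩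

theorem intervalIntegrable (hφ : WCont b c d φ) (hb : 0 < b) {s : ℝ}
    (hs : s ∈ Icc c d) : IntervalIntegrable φ volume c s := by
  simpa using hφ.intervalIntegrable_kernel one_pos hb hs

theorem add (hφ : WCont b c d φ) (hψ : WCont b c d ψ) : WCont b c d fun s => φ s + ψ s := by
  obtain ⟨h1, C, hC⟩ := hφ
  obtain ⟨h2, D, hD⟩ := hψ
  refine ⟨h1.add h2, C + D, fun s hs => ?_⟩
  rw [add_mul]
  exact (abs_add_le _ _).trans (add_le_add (hC s hs) (hD s hs))

theorem mul_left {k : ℝ → ℝ} {M : ℝ} (hφ : WCont b c d φ) (hk : ContinuousOn k (Ioc c d))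
    (hM : ∀ s ∈ Ioc c d, |k s| ≤ M) : WCont b c d fun s => k s * φ s := by
  obtain ⟨h1, C, hC⟩ := hφ
  refine ⟨hk.mul h1, M * C, fun s hs => ?_⟩
  rw [abs_mul, mul_assoc]
  exact mul_le_mul (hM s hs) (hC s hs) (abs_nonneg _) ((abs_nonneg _).trans (hM s hs))

theorem const_mul (hφ : WCont b c d φ) (k : ℝ) : WCont b c d fun s => k * φ s :=
  hφ.mul_left continuousOn_const fun _ _ => le_rfl

theorem sub (hφ : WCont b c d φ) (hψ : WCont b c d ψ) : WCont b c d fun s => φ s - ψ s := by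
  simpa [sub_eq_add_neg] using hφ.add (hψ.const_mul (-1))

theorem of_bounded (hb : b ≤ 1) (hφ : ContinuousOn φ (Ioc c d)) {M : ℝ}
    (hM : ∀ s ∈ Ioc c d, |φ s| ≤ M) : WCont b c d φ := by
  -- For `b ≤ 1` the power `(s - c) ^ (b - 1)` is smallest at `s = d`, which fixes the constant.
  refine ⟨hφ, M * ((d - c) ^ (b - 1))⁻¹, fun s hs => ?_⟩
  have h0 : 0 < s - c := sub_pos.2 hs.1
  have h1 : 0 < d - c := h0.trans_le (by linarith [hs.2])
  have h2 : (d - c) ^ (b - 1) ≤ (s - c) ^ (b - 1) :=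
    Real.rpow_le_rpow_of_nonpos h0 (by linarith [hs.2]) (by linarith)
  have h3 := Real.rpow_pos_of_pos h1 (b - 1)
  have h4 : 0 ≤ M := (abs_nonneg _).trans (hM s hs)
  refine (hM s hs).trans ?_
  rw [mul_assoc]
  refine le_mul_of_one_le_right h4 ?_
  rw [inv_mul_eq_div, one_le_div h3]
  exact h2

theorem of_continuousOn_Icc (hb : b ≤ 1) (hφ : ContinuousOn φ (Icc c d)) : WCont b c d φ := by
  obtain ⟨M, hM⟩ := isCompact_Icc.exists_bound_of_continuousOn hφ
  exact of_bounded hb (hφ.mono Ioc_subset_Icc_self) fun s hs => hM s (Ioc_subset_Icc_self hs)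

theorem congr (hφ : WCont b c d φ) (h : ∀ s ∈ Ioc c d, ψ s = φ s) : WCont b c d ψ := by
  obtain ⟨h1, C, hC⟩ := hφ
  exact ⟨h1.congr h, C, fun s hs => by rw [h s hs]; exact hC s hs⟩

/-- Rescaling to `[0, 1]` moves the dependence on `s` from the kernel and the limits into the
argument of `φ`, ready for dominated convergence. -/
theorem fracInt_eq_scaled {s : ℝ} (hs : c < s) :
    CaputoCauchy.fracInt a c φ s = 1 / Real.Gamma a *
      ((s - c) ^ a * ∫ u in (0 : ℝ)..1, φ ((s - c) * u + c) * (1 - u) ^ (a - 1)) := by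
  have h0 : 0 < s - c := sub_pos.2 hs
  have h1 := intervalIntegral.integral_comp_mul_add (E := ℝ)
    (fun ξ => φ ξ / (s - ξ) ^ (1 - a)) (a := 0) (b := 1) h0.ne' c
  simp only [mul_zero, zero_add, mul_one, sub_add_cancel, smul_eq_mul] at h1
  rw [CaputoCauchy.fracInt]
  congr 1
  have h2 : ∫ ξ in c..s, φ ξ / (s - ξ) ^ (1 - a) = (s - c) *
      ∫ u in (0 : ℝ)..1, φ ((s - c) * u + c) / (s - ((s - c) * u + c)) ^ (1 - a) := by
    rw [h1]; field_simp
  have h4 : ∫ u in (0 : ℝ)..1, φ ((s - c) * u + c) / (s - ((s - c) * u + c)) ^ (1 - a) =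
      (s - c) ^ (a - 1) * ∫ u in (0 : ℝ)..1, φ ((s - c) * u + c) * (1 - u) ^ (a - 1) := by
    rw [← intervalIntegral.integral_const_mul]
    refine intervalIntegral.integral_congr fun u hu => ?_
    rw [uIcc_of_le zero_le_one] at hu
    have h3 : s - ((s - c) * u + c) = (s - c) * (1 - u) := by ring
    rw [h3, div_rpow_one_sub (mul_nonneg h0.le (sub_nonneg.2 hu.2)),
      Real.mul_rpow h0.le (sub_nonneg.2 hu.2)]
    ring
  rw [h2, h4, Real.rpow_sub_one h0.ne']
  field_simp

theorem continuousOn_fracInt (hφ : WCont b c d φ) (ha : 0 < a) (hb : 0 < b) (hb1 : b ≤ 1) :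
    ContinuousOn (CaputoCauchy.fracInt a c φ) (Ioc c d) := by
  obtain ⟨hφc, C, hC⟩ := hφ
  refine ContinuousOn.congr (f := fun s => 1 / Real.Gamma a *
      ((s - c) ^ a * ∫ u in (0 : ℝ)..1, φ ((s - c) * u + c) * (1 - u) ^ (a - 1))) ?_
    fun s hs => fracInt_eq_scaled hs.1
  refine continuousOn_const.mul (ContinuousOn.mul ?_ ?_)
  · exact (continuousOn_id.sub continuousOn_const).rpow_const fun _ _ => Or.inr ha.le
  intro s₀ hs₀
  -- Only `s` beyond the midpoint of `c` and `s₀` matter near `s₀`; there `(s - c) ^ (b - 1)` is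
  -- bounded, and the remaining factor is a Beta integrand.
  have hr : 0 < (s₀ - c) / 2 := by linarith [hs₀.1]
  have hmap : ∀ s ∈ Ioc c d, ∀ u ∈ Ioc (0 : ℝ) 1, (s - c) * u + c ∈ Ioc c d := by
    intro s hs u hu
    have : 0 < s - c := sub_pos.2 hs.1
    constructor
    · nlinarith [mul_pos this hu.1]
    · nlinarith [hu.2, hs.2]
  refine intervalIntegral.continuousWithinAt_of_dominated_interval
    (bound := fun u => |C| * ((s₀ - c) / 2) ^ (b - 1) * (u ^ (b - 1) * (1 - u) ^ (a - 1)))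
    ?_ ?_ ?_ ?_
  · refine eventually_nhdsWithin_of_forall fun s hs => ?_
    rw [uIoc_of_le zero_le_one]
    refine AEStronglyMeasurable.mul (ContinuousOn.aestronglyMeasurable ?_ measurableSet_Ioc)
      (by fun_prop : Measurable fun u : ℝ => (1 - u) ^ (a - 1)).aestronglyMeasurable
    exact hφc.comp (by fun_prop) fun u hu => hmap s hs u hu
  · have : ∀ᶠ s in 𝓝[Ioc c d] s₀, (s₀ + c) / 2 < s :=
      mem_nhdsWithin_of_mem_nhds (lt_mem_nhds (by linarith [hs₀.1]))
    filter_upwards [this, self_mem_nhdsWithin] with s h1 hs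
    refine ae_of_all _ fun u hu => ?_
    rw [uIoc_of_le zero_le_one] at hu
    have h2 : 0 ≤ (1 - u) ^ (a - 1) := Real.rpow_nonneg (by linarith [hu.2]) _
    have h3 := hC _ (hmap s hs u hu)
    have h5 : 0 < s - c := sub_pos.2 hs.1
    rw [add_sub_cancel_right, Real.mul_rpow h5.le hu.1.le] at h3
    have h6 : (s - c) ^ (b - 1) ≤ ((s₀ - c) / 2) ^ (b - 1) :=
      Real.rpow_le_rpow_of_nonpos hr (by linarith) (by linarith)
    have h7 := Real.rpow_nonneg hu.1.le (b - 1)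
    have h8 := Real.rpow_nonneg h5.le (b - 1)
    rw [norm_mul, Real.norm_eq_abs, Real.norm_eq_abs, abs_of_nonneg h2, ← mul_assoc]
    refine mul_le_mul_of_nonneg_right (h3.trans ?_) h2
    rw [← mul_assoc]
    refine mul_le_mul_of_nonneg_right ?_ h7
    exact mul_le_mul (le_abs_self C) h6 h8 (abs_nonneg C)
  · have := intervalIntegrable_rpow_mul_rpow ha hb (zero_le_one' ℝ)
    simp only [sub_zero] at this
    exact this.const_mul _
  · refine ae_of_all _ fun u hu => ?_
    rw [uIoc_of_le zero_le_one] at hu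
    refine ContinuousWithinAt.mul ?_ continuousWithinAt_const
    exact (hφc _ (hmap s₀ hs₀ u hu)).comp (f := fun s => (s - c) * u + c)
      (by fun_prop : Continuous fun s : ℝ => (s - c) * u + c).continuousWithinAt
      fun s hs => hmap s hs u hu

theorem fracInt (hφ : WCont b c d φ) (ha : 0 < a) (hb : 0 < b) (hb1 : b ≤ 1) :
    WCont b c d (CaputoCauchy.fracInt a c φ) := by
  refine ⟨hφ.continuousOn_fracInt ha hb hb1, ?_⟩
  obtain ⟨hφc, C, hC⟩ := hφ
  refine ⟨|C| * (Real.Gamma b / Real.Gamma (b + a)) * (d - c) ^ a, fun s hs => ?_⟩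
  have h0 : 0 < s - c := sub_pos.2 hs.1
  have hΓ : 0 < Real.Gamma b / Real.Gamma (b + a) :=
    div_pos (Real.Gamma_pos_of_pos hb) (Real.Gamma_pos_of_pos (add_pos hb ha))
  refine (abs_fracInt_le_rpow ha hb hs.1 (C := |C|) ?_).trans ?_
  · refine ae_Ioc_of_forall_Ioo fun ξ hξ => (hC ξ ⟨hξ.1, hξ.2.le.trans hs.2⟩).trans ?_
    exact mul_le_mul_of_nonneg_right (le_abs_self C) (Real.rpow_nonneg (sub_pos.2 hξ.1).le _)
  · rw [show b + a - 1 = a + (b - 1) by ring, Real.rpow_add h0, ← mul_assoc]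
    refine mul_le_mul_of_nonneg_right ?_ (Real.rpow_nonneg h0.le _)
    refine mul_le_mul_of_nonneg_left ?_ (by positivity)
    exact Real.rpow_le_rpow h0.le (by linarith [hs.2]) ha.le

end WCont

/-! ### Volterra equations by contraction. -/

/-- Solvability of Volterra equations of the second kind with a weakly singular kernel and a
Lipschitz nonlinearity. -/
theorem exists_volterra_solution {a c d K : ℝ} (ha : 0 < a) (ha1 : a ≤ 1) (hK : 0 ≤ K)
    {N : ℝ → ℝ → ℝ} {h : ℝ → ℝ}
    (hLip : ∀ ξ ∈ Ioc c d, ∀ y y', |N ξ y - N ξ y'| ≤ K * |y - y'|)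
    (hN : ∀ z, WCont a c d z → WCont a c d fun ξ => N ξ (z ξ))
    (hh : WCont a c d h) :
    ∃ z, WCont a c d z ∧ ∀ s ∈ Ioc c d, z s = h s + fracInt a c (fun ξ => N ξ (z ξ)) s := by
  obtain ⟨lam, hlam, hw⟩ := exists_wt_contraction ha ha1 ha (Or.inl le_rfl) (d - c) K hK
  let X := BoundedContinuousFunction (Ioc c d) ℝ
  -- The unknown is divided by the weight, so the plain supremum norm on bounded continuous
  -- functions is the weighted norm in which the equation contracts; completeness comes for free.
  let E : X → ℝ → ℝ := fun u s => if hs : s ∈ Ioc c d then wt a lam c s * u ⟨s, hs⟩ else 0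
  have wtc : ContinuousOn (wt a lam c) (Ioc c d) := by
    refine ContinuousOn.mul ?_ (by fun_prop)
    exact (continuousOn_id.sub continuousOn_const).rpow_const
      fun s hs => Or.inl (sub_pos.2 hs.1).ne'
  have hE : ∀ u s (hs : s ∈ Ioc c d), E u s = wt a lam c s * u ⟨s, hs⟩ := by
    intro u s hs
    simp only [E, dif_pos hs]
  have hEW : ∀ u, WCont a c d (E u) := by
    intro u
    refine ⟨?_, Real.exp (lam * (d - c)) * ‖u‖, fun s hs => ?_⟩
    · rw [continuousOn_iff_continuous_domRestrict]
      refine ((continuousOn_iff_continuous_domRestrict.1 wtc).mul u.continuous).congr fun s => ?_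
      simp [hE u s s.2]
    · rw [hE u s hs, abs_mul, abs_of_pos (wt_pos hs.1)]
      have h1 : |u ⟨s, hs⟩| ≤ ‖u‖ := u.norm_coe_le_norm ⟨s, hs⟩
      have h2 := wt_le_rpow (b := a) (T := d - c) hlam.le hs.1.le (by linarith [hs.2])
      calc wt a lam c s * |u ⟨s, hs⟩| ≤ (Real.exp (lam * (d - c)) * (s - c) ^ (a - 1)) * ‖u‖ :=
            mul_le_mul h2 h1 (abs_nonneg _) ((wt_pos hs.1).le.trans h2)
        _ = _ := by ring
  let R : X → ℝ → ℝ := fun u s => h s + fracInt a c (fun ξ => N ξ (E u ξ)) s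
  have hR : ∀ u, WCont a c d (R u) := fun u => hh.add ((hN _ (hEW u)).fracInt ha ha ha1)
  have hQb : ∀ u, ∃ C, ∀ s : Ioc c d, ‖R u s / wt a lam c s‖ ≤ C := by
    intro u
    obtain ⟨-, C, hC⟩ := hR u
    refine ⟨|C|, fun s => ?_⟩
    have hp := wt_pos (b := a) (lam := lam) s.2.1
    rw [norm_div, Real.norm_eq_abs, Real.norm_eq_abs, abs_of_pos hp, div_le_iff₀ hp]
    refine (hC s s.2).trans ?_
    exact mul_le_mul (le_abs_self C) (rpow_le_wt hlam.le s.2.1.le)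
      (Real.rpow_nonneg (sub_pos.2 s.2.1).le _) (abs_nonneg C)
  have hQc : ∀ u, Continuous fun s : Ioc c d => R u s / wt a lam c s := by
    intro u
    refine (continuousOn_iff_continuous_domRestrict.1 (hR u).1).div
      (continuousOn_iff_continuous_domRestrict.1 wtc) fun s => (wt_pos s.2.1).ne'
  let Φ : X → X := fun u => BoundedContinuousFunction.ofNormedAddCommGroup
    (fun s : Ioc c d => R u s / wt a lam c s) (hQc u) (hQb u).choose (hQb u).choose_spec
  have hΦ : ContractingWith (1 / 2) Φ := by
    refine ⟨by norm_num, LipschitzWith.of_dist_le_mul fun u v => ?_⟩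
    rw [BoundedContinuousFunction.dist_le (by positivity)]
    intro s
    have hp := wt_pos (b := a) (lam := lam) s.2.1
    have hs : (s : ℝ) ∈ Icc c d := Ioc_subset_Icc_self s.2
    change |R u s / wt a lam c s - R v s / wt a lam c s| ≤ _
    have e : R u s - R v s = fracInt a c (fun ξ => N ξ (E u ξ) - N ξ (E v ξ)) s := by
      rw [fracInt_sub ((hN _ (hEW u)).intervalIntegrable_kernel ha ha hs)
        ((hN _ (hEW v)).intervalIntegrable_kernel ha ha hs)]
      simp only [R]; ring
    have hdiff : ∀ r ∈ Ioc c d, |E u r - E v r| ≤ dist u v * wt a lam c r := by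
      intro r hr
      rw [hE u r hr, hE v r hr, ← mul_sub, abs_mul, abs_of_pos (wt_pos hr.1), mul_comm]
      have h0 : |u ⟨r, hr⟩ - v ⟨r, hr⟩| ≤ dist u v :=
        (Real.dist_eq _ _).symm.trans_le
          (BoundedContinuousFunction.dist_coe_le_dist (f := u) (g := v) ⟨r, hr⟩)
      exact mul_le_mul_of_nonneg_right h0 (wt_pos hr.1).le
    have h1 := abs_fracInt_le_wt (φ := fun ξ => |E u ξ - E v ξ|) ha ha hlam hK
      dist_nonneg (fun r hr => hw c r hr.1 (by linarith [hr.2]))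
      (fun r hr => by rw [abs_abs]; exact hdiff r hr) s s.2
    have h2 : |fracInt a c (fun ξ => N ξ (E u ξ) - N ξ (E v ξ)) s| ≤
        fracInt a c (fun ξ => K * |E u ξ - E v ξ|) s := by
      refine abs_fracInt_le ha hs.1 ?_ (ae_Ioc_of_forall_Ioo fun ξ hξ =>
        hLip ξ ⟨hξ.1, hξ.2.le.trans hs.2⟩ _ _)
      have hW := (hEW u).sub (hEW v)
      have hW' : WCont a c d fun ξ => K * |E u ξ - E v ξ| :=
        ⟨continuousOn_const.mul hW.1.abs, (WCont.const_mul hW K).2.imp fun C hC s hs => by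
          rw [abs_mul, abs_abs, ← abs_mul]; exact hC s hs⟩
      exact hW'.intervalIntegrable_kernel ha ha hs
    rw [fracInt_const_mul] at h2
    rw [← sub_div, e, abs_div, abs_of_pos hp, div_le_iff₀ hp]
    have h3 := mul_le_mul_of_nonneg_left (le_abs_self (fracInt a c (fun ξ => |E u ξ - E v ξ|) s)) hK
    refine (h2.trans (h3.trans h1)).trans_eq ?_
    push_cast
    ring
  refine ⟨E (ContractingWith.fixedPoint Φ hΦ), hEW _, fun s hs => ?_⟩
  set u := ContractingWith.fixedPoint Φ hΦ
  have hfix : Φ u = u := hΦ.fixedPoint_isFixedPt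
  have : u ⟨s, hs⟩ = R u s / wt a lam c s := by
    conv_lhs => rw [← hfix]
    rfl
  rw [hE u s hs, this, mul_div_cancel₀ _ (wt_pos hs.1).ne']

/-! ### The nonlinearity on the closed strip: partial derivatives, moduli, chain rule. -/

section Smooth

variable {T : ℝ} {f : ℝ → ℝ → ℝ}

theorem uniqueDiffOn_strip (hT : 0 < T) : UniqueDiffOn ℝ (Icc 0 T ×ˢ (univ : Set ℝ)) :=
  (uniqueDiffOn_Icc hT).prod uniqueDiffOn_univ

theorem hasFDerivWithinAt_strip
    (hf : ContDiffOn ℝ 1 (fun z : ℝ × ℝ => f z.1 z.2) (Icc 0 T ×ˢ univ)) {ξ : ℝ}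
    (hξ : ξ ∈ Icc 0 T) (y : ℝ) :
    HasFDerivWithinAt (fun z : ℝ × ℝ => f z.1 z.2)
      (fderivWithin ℝ (fun z : ℝ × ℝ => f z.1 z.2) (Icc 0 T ×ˢ univ) (ξ, y))
      (Icc 0 T ×ˢ univ) (ξ, y) :=
  (hf.differentiableOn one_ne_zero (ξ, y) ⟨hξ, mem_univ y⟩).hasFDerivWithinAt

/-- The strip has no boundary in the second variable, so the derivative within it restricts to a
genuine two-sided derivative even when `ξ` is an end of `[0, T]`. -/
theorem hasDerivAt_snd_fderivWithin
    (hf : ContDiffOn ℝ 1 (fun z : ℝ × ℝ => f z.1 z.2) (Icc 0 T ×ˢ univ)) {ξ : ℝ}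
    (hξ : ξ ∈ Icc 0 T) (y : ℝ) :
    HasDerivAt (fun z => f ξ z)
      (fderivWithin ℝ (fun z : ℝ × ℝ => f z.1 z.2) (Icc 0 T ×ˢ univ) (ξ, y) (0, 1)) y := by
  have h1 := hasFDerivWithinAt_strip hf hξ y
  have h2 : HasDerivWithinAt (fun z : ℝ => (ξ, z)) ((0 : ℝ), (1 : ℝ)) univ y :=
    (hasDerivWithinAt_const y univ ξ).prodMk (hasDerivWithinAt_id y univ)
  have h3 := h1.comp_hasDerivWithinAt (f := fun z : ℝ => (ξ, z)) y h2
    fun z _ => ⟨hξ, mem_univ z⟩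
  exact hasDerivWithinAt_univ.1 h3

theorem hasDerivWithinAt_fst_fderivWithin
    (hf : ContDiffOn ℝ 1 (fun z : ℝ × ℝ => f z.1 z.2) (Icc 0 T ×ˢ univ)) {ξ : ℝ}
    (hξ : ξ ∈ Icc 0 T) (y : ℝ) :
    HasDerivWithinAt (fun s => f s y)
      (fderivWithin ℝ (fun z : ℝ × ℝ => f z.1 z.2) (Icc 0 T ×ˢ univ) (ξ, y) (1, 0))
      (Icc 0 T) ξ := by
  have h1 := hasFDerivWithinAt_strip hf hξ y
  have h2 : HasDerivWithinAt (fun z : ℝ => (z, y)) ((1 : ℝ), (0 : ℝ)) (Icc 0 T) ξ :=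
    (hasDerivWithinAt_id ξ _).prodMk (hasDerivWithinAt_const ξ _ y)
  exact h1.comp_hasDerivWithinAt (f := fun z : ℝ => (z, y)) ξ h2
    fun z hz => ⟨hz, mem_univ y⟩

theorem continuousOn_strip_snd (hT : 0 < T)
    (hf : ContDiffOn ℝ 1 (fun z : ℝ × ℝ => f z.1 z.2) (Icc 0 T ×ˢ univ)) :
    ContinuousOn (fun z : ℝ × ℝ => deriv (fun y => f z.1 y) z.2) (Icc 0 T ×ˢ univ) := by
  have h := hf.continuousOn_fderivWithin (uniqueDiffOn_strip hT) le_rfl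
  refine (h.clm_apply (continuousOn_const (c := ((0 : ℝ), (1 : ℝ))))).congr fun z hz => ?_
  exact (hasDerivAt_snd_fderivWithin hf hz.1 z.2).deriv

theorem continuousOn_strip_fst (hT : 0 < T)
    (hf : ContDiffOn ℝ 1 (fun z : ℝ × ℝ => f z.1 z.2) (Icc 0 T ×ˢ univ)) :
    ContinuousOn (fun z : ℝ × ℝ => derivWithin (fun s => f s z.2) (Icc 0 T) z.1)
      (Icc 0 T ×ˢ univ) := by
  have h := hf.continuousOn_fderivWithin (uniqueDiffOn_strip hT) le_rfl
  refine (h.clm_apply (continuousOn_const (c := ((1 : ℝ), (0 : ℝ))))).congr fun z hz => ?_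
  exact (hasDerivWithinAt_fst_fderivWithin hf hz.1 z.2).derivWithin (uniqueDiffOn_Icc hT _ hz.1)

/-- At an interior time the strip is a neighbourhood of the point, so the one-sided total derivative
is an ordinary one and the chain rule applies. -/
theorem hasDerivAt_along (hT : 0 < T)
    (hf : ContDiffOn ℝ 1 (fun z : ℝ × ℝ => f z.1 z.2) (Icc 0 T ×ˢ univ)) {x : ℝ → ℝ} {s v : ℝ}
    (hs : s ∈ Ioo 0 T) (hx : HasDerivAt x v s) :
    HasDerivAt (fun ξ => f ξ (x ξ))
      (derivWithin (fun r => f r (x s)) (Icc 0 T) s + deriv (fun y => f s y) (x s) * v) s := by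
  have hs' := Ioo_subset_Icc_self hs
  rw [(hasDerivAt_snd_fderivWithin hf hs' (x s)).deriv,
    (hasDerivWithinAt_fst_fderivWithin hf hs' (x s)).derivWithin (uniqueDiffOn_Icc hT _ hs')]
  have h1 : HasFDerivAt (fun z : ℝ × ℝ => f z.1 z.2) _ (s, x s) :=
    (hasFDerivWithinAt_strip hf hs' (x s)).hasFDerivAt
      (prod_mem_nhds (Icc_mem_nhds hs.1 hs.2) univ_mem)
  have h2 := h1.comp_hasDerivAt (f := fun ξ : ℝ => (ξ, x ξ)) s ((hasDerivAt_id s).prodMk hx)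
  refine h2.congr_deriv ?_
  set D := fderivWithin ℝ (fun z : ℝ × ℝ => f z.1 z.2) (Icc 0 T ×ˢ univ) (s, x s)
  have : ((1 : ℝ), v) = (1, 0) + v • ((0 : ℝ), (1 : ℝ)) := by simp
  rw [this, map_add, map_smul, smul_eq_mul, mul_comm]

theorem isCompact_strip (T R : ℝ) : IsCompact (Icc 0 T ×ˢ Icc (-R) R) :=
  isCompact_Icc.prod isCompact_Icc

theorem exists_bound_strip {h : ℝ × ℝ → ℝ} (hh : ContinuousOn h (Icc 0 T ×ˢ univ)) (R : ℝ) :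
    ∃ M, 0 ≤ M ∧ ∀ ξ ∈ Icc 0 T, ∀ y, |y| ≤ R → |h (ξ, y)| ≤ M := by
  obtain ⟨M, hM⟩ := (isCompact_strip T R).exists_bound_of_continuousOn
    (hh.mono (prod_mono le_rfl (subset_univ _)))
  refine ⟨|M|, abs_nonneg M, fun ξ hξ y hy => (hM (ξ, y) ⟨hξ, abs_le.1 hy⟩).trans (le_abs_self M)⟩

theorem exists_modulus_strip {h : ℝ × ℝ → ℝ} (hh : ContinuousOn h (Icc 0 T ×ˢ univ)) (R : ℝ)
    {ε : ℝ} (hε : 0 < ε) :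
    ∃ δ, 0 < δ ∧ ∀ ξ ∈ Icc 0 T, ∀ y y', |y| ≤ R → |y'| ≤ R → |y' - y| ≤ δ →
      |h (ξ, y') - h (ξ, y)| ≤ ε := by
  have hu := (isCompact_strip T R).uniformContinuousOn_of_continuous
    (hh.mono (prod_mono le_rfl (subset_univ _)))
  obtain ⟨δ, hδ, H⟩ := Metric.uniformContinuousOn_iff.1 hu ε hε
  refine ⟨δ / 2, by positivity, fun ξ hξ y y' hy hy' hd => ?_⟩
  refine (H (ξ, y') ⟨hξ, abs_le.1 hy'⟩ (ξ, y) ⟨hξ, abs_le.1 hy⟩ ?_).le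
  rw [Prod.dist_eq, dist_self, Real.dist_eq, max_eq_right (abs_nonneg _)]
  linarith

theorem continuousOn_along {h : ℝ × ℝ → ℝ} (hh : ContinuousOn h (Icc 0 T ×ˢ univ)) {x : ℝ → ℝ}
    {S : Set ℝ} (hS : S ⊆ Icc 0 T) (hx : ContinuousOn x S) :
    ContinuousOn (fun ξ => h (ξ, x ξ)) S :=
  hh.comp (continuousOn_id.prodMk hx) fun _ hξ => ⟨hS hξ, mem_univ _⟩

theorem abs_sub_le_of_deriv_bound {h h' : ℝ → ℝ} {y y' M : ℝ}
    (hd : ∀ w, HasDerivAt h (h' w) w) (hM : ∀ w ∈ uIcc y y', |h' w| ≤ M) :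
    |h y' - h y| ≤ M * |y' - y| :=
  (convex_uIcc y y').norm_image_sub_le_of_norm_hasDerivWithin_le
    (fun w _ => (hd w).hasDerivWithinAt) hM left_mem_uIcc right_mem_uIcc

theorem abs_le_of_mem_uIcc {y y' w R : ℝ} (hy : |y| ≤ R) (hy' : |y'| ≤ R) (hw : w ∈ uIcc y y') :
    |w| ≤ R :=
  abs_le.2 ((uIcc_subset_Icc (abs_le.1 hy) (abs_le.1 hy')) hw)

theorem exists_lipschitz_strip (hT : 0 < T)
    (hf : ContDiffOn ℝ 1 (fun z : ℝ × ℝ => f z.1 z.2) (Icc 0 T ×ˢ univ)) (R : ℝ) :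
    ∃ L, 0 ≤ L ∧ ∀ ξ ∈ Icc 0 T, ∀ y y', |y| ≤ R → |y'| ≤ R → |f ξ y' - f ξ y| ≤ L * |y' - y| := by
  obtain ⟨L, hL, H⟩ := exists_bound_strip (continuousOn_strip_snd hT hf) R
  refine ⟨L, hL, fun ξ hξ y y' hy hy' => ?_⟩
  exact abs_sub_le_of_deriv_bound
    (fun w => (hasDerivAt_snd_fderivWithin hf hξ w).differentiableAt.hasDerivAt)
    fun w hw => H ξ hξ w (abs_le_of_mem_uIcc hy hy' hw)

/-- Mean value inequality for `f ξ w` minus its tangent at `y`: its derivative is an increment of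
`∂f/∂x`, uniformly small by compactness. -/
theorem exists_linearization_strip (hT : 0 < T)
    (hf : ContDiffOn ℝ 1 (fun z : ℝ × ℝ => f z.1 z.2) (Icc 0 T ×ˢ univ)) (R : ℝ)
    {ε : ℝ} (hε : 0 < ε) :
    ∃ δ, 0 < δ ∧ ∀ ξ ∈ Icc 0 T, ∀ y y', |y| ≤ R → |y'| ≤ R → |y' - y| ≤ δ →
      |f ξ y' - f ξ y - deriv (fun z => f ξ z) y * (y' - y)| ≤ ε * |y' - y| := by
  obtain ⟨δ, hδ, H⟩ := exists_modulus_strip (continuousOn_strip_snd hT hf) R hε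
  refine ⟨δ, hδ, fun ξ hξ y y' hy hy' hd => ?_⟩
  have h1 := abs_sub_le_of_deriv_bound (y := y) (y' := y') (M := ε)
    (h := fun w => f ξ w - deriv (fun z => f ξ z) y * w)
    (h' := fun w => deriv (fun z => f ξ z) w - deriv (fun z => f ξ z) y)
    (fun w => by
      have := (hasDerivAt_snd_fderivWithin hf hξ w).differentiableAt.hasDerivAt.sub
        ((hasDerivAt_id w).const_mul (deriv (fun z => f ξ z) y))
      exact this.congr_deriv (by simp))
    fun w hw => H ξ hξ y w hy (abs_le_of_mem_uIcc hy hy' hw)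
      ((abs_sub_left_of_mem_uIcc hw).trans hd)
  refine le_trans (le_of_eq ?_) h1
  congr 1
  ring

end Smooth

/-! ### Splitting a function of class `AC^α` at time `t` into history and future. -/

section Extension

variable {α T : ℝ} {g : InitialData α T} {x y l : ℝ → ℝ}

theorem IsAC.continuousOn {t : ℝ} (hα0 : 0 < α) (hα1 : α < 1) (ht : 0 ≤ t) (hx : IsAC α t x) :
    ContinuousOn x (Icc 0 t) := by
  have hl := hx.memLp_caputoDeriv hα0 hα1 ht
  obtain ⟨C, -, hC⟩ := memLp_top_bound hl
  refine ContinuousOn.congr (f := fun τ => x 0 + fracInt α 0 (caputoDeriv α x) τ) ?_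
    (hx.eq_fracInt hα0 hα1 ht)
  refine continuousOn_const.add (continuousOn_fracInt_of_bounded hα0 hα1.le ?_ hC)
  rw [restrict_Ioc_eq_restrict_Icc]
  exact hl.aestronglyMeasurable

theorem IsAC.caputoDeriv_bounded {t : ℝ} (hα0 : 0 < α) (hα1 : α < 1) (ht : 0 ≤ t)
    (hx : IsAC α t x) :
    AEStronglyMeasurable (caputoDeriv α x) (volume.restrict (Ioc 0 t)) ∧
      ∃ C, 0 ≤ C ∧ ∀ᵐ ξ ∂(volume.restrict (Ioc 0 t)), |caputoDeriv α x ξ| ≤ C := by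
  have hl := hx.memLp_caputoDeriv hα0 hα1 ht
  refine ⟨?_, memLp_top_bound hl⟩
  rw [restrict_Ioc_eq_restrict_Icc]
  exact hl.aestronglyMeasurable

theorem memLp_top_of_bounded {d C : ℝ}
    (hl : AEStronglyMeasurable l (volume.restrict (Ioc 0 d)))
    (hC : ∀ᵐ ξ ∂(volume.restrict (Ioc 0 d)), |l ξ| ≤ C) :
    MemLp l ⊤ (volume.restrict (Icc 0 d)) := by
  rw [← restrict_Ioc_eq_restrict_Icc]
  exact memLp_top_of_bound hl C hC

/-- Splitting of the fractional integral of a bounded function. -/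
theorem fracInt_split {c u s d C : ℝ} (hα0 : 0 < α)
    (hl : AEStronglyMeasurable l (volume.restrict (Ioc c d)))
    (hC : ∀ᵐ ξ ∂(volume.restrict (Ioc c d)), |l ξ| ≤ C) (hcu : c ≤ u) (hus : u ≤ s) (hsd : s ≤ d) :
    fracInt α c l s = 1 / Real.Gamma α * (∫ ξ in c..u, l ξ / (s - ξ) ^ (1 - α)) +
      fracInt α u l s := by
  have i1 := intervalIntegrable_kernel_of_bounded hα0 (s := s) hcu hus
    (aestronglyMeasurable_mono_Ioc le_rfl (hus.trans hsd) hl)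
    (ae_mono_Ioc le_rfl (hus.trans hsd) hC)
  have i2 := intervalIntegrable_kernel_of_bounded hα0 (s := s) hus le_rfl
    (aestronglyMeasurable_mono_Ioc hcu hsd hl) (ae_mono_Ioc hcu hsd hC)
  rw [fracInt, fracInt, ← intervalIntegral.integral_add_adjacent_intervals i1 i2, mul_add]

/-- The contribution of the past `[0, t]` to the fractional integral after time `t`. -/
def memory (g : InitialData α T) (s : ℝ) : ℝ :=
  g.w 0 + 1 / Real.Gamma α * ∫ ξ in (0 : ℝ)..g.t, caputoDeriv α g.w ξ / (s - ξ) ^ (1 - α)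

theorem caputoDeriv_ae_congr {t : ℝ} (h : ∀ ξ ∈ Icc 0 t, x ξ = y ξ) :
    ∀ᵐ ξ ∂(volume.restrict (Ioc 0 t)), caputoDeriv α x ξ = caputoDeriv α y ξ :=
  ae_Ioc_of_forall_Ioo fun _ hξ => caputoDeriv_congr h hξ

/-- Gluing the Caputo derivative of `w` before `t` to `l` after `t` gives one bounded density on
`[0, T]`, whose fractional integral from `0` splits at `t` into `memory` and `I^α l`. -/
theorem isAC_of_eq_memory_add (hα0 : 0 < α) (hα1 : α < 1) {C : ℝ}
    (hl : AEStronglyMeasurable l (volume.restrict (Ioc g.t T)))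
    (hC : ∀ᵐ ξ ∂(volume.restrict (Ioc g.t T)), |l ξ| ≤ C)
    (hx1 : ∀ s ∈ Icc 0 g.t, x s = g.w s)
    (hx2 : ∀ s ∈ Ioc g.t T, x s = memory g s + fracInt α g.t l s) :
    IsAC α T x ∧ ∀ᵐ ξ ∂(volume.restrict (Ioc g.t T)), caputoDeriv α x ξ = l ξ := by
  have ht := g.t_mem.1
  have htT := g.t_mem.2.le
  obtain ⟨hm1, C1, -, hC1⟩ := g.w_isAC.caputoDeriv_bounded hα0 hα1 ht
  set k : ℝ → ℝ := fun ξ => if ξ ≤ g.t then caputoDeriv α g.w ξ else l ξ with hk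
  have k1 : ∀ᵐ ξ ∂(volume.restrict (Ioc 0 g.t)), caputoDeriv α g.w ξ = k ξ :=
    (ae_restrict_iff' measurableSet_Ioc).2 (ae_of_all _ fun ξ hξ => by simp [hk, hξ.2])
  have k2 : ∀ᵐ ξ ∂(volume.restrict (Ioc g.t T)), l ξ = k ξ :=
    (ae_restrict_iff' measurableSet_Ioc).2 (ae_of_all _ fun ξ hξ => by
      simp [hk, not_le.2 hξ.1])
  have hU : Ioc 0 T = Ioc 0 g.t ∪ Ioc g.t T := (Ioc_union_Ioc_eq_Ioc ht htT).symm
  have hkm : AEStronglyMeasurable k (volume.restrict (Ioc 0 T)) := by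
    rw [hU, aestronglyMeasurable_union_iff]
    exact ⟨hm1.congr k1, hl.congr k2⟩
  have hkC : ∀ᵐ ξ ∂(volume.restrict (Ioc 0 T)), |k ξ| ≤ max C1 C := by
    rw [hU, ae_restrict_union_iff]
    constructor
    · filter_upwards [k1, hC1] with ξ h1 h2
      rw [← h1]; exact h2.trans (le_max_left _ _)
    · filter_upwards [k2, hC] with ξ h1 h2
      rw [← h1]; exact h2.trans (le_max_right _ _)
  have hmem := memLp_top_of_bounded hkm hkC
  have h0 : x 0 = g.w 0 := hx1 0 ⟨le_rfl, ht⟩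
  have hrep : ∀ τ ∈ Icc 0 T, x τ = x 0 + fracInt α 0 k τ := by
    intro τ hτ
    rcases le_or_gt τ g.t with h | h
    · rw [hx1 τ ⟨hτ.1, h⟩, g.w_isAC.eq_fracInt hα0 hα1 ht τ ⟨hτ.1, h⟩, h0]
      congr 1
      exact fracInt_congr_ae hτ.1 (ae_mono_Ioc le_rfl h k1)
    · rw [hx2 τ ⟨h, hτ.2⟩, h0, memory, fracInt_split hα0 hkm hkC ht h.le hτ.2, add_assoc]
      congr 2
      · congr 1
        rw [intervalIntegral.integral_of_le ht, intervalIntegral.integral_of_le ht]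
        refine integral_congr_ae ?_
        filter_upwards [k1] with ξ hξ
        rw [hξ]
      · exact fracInt_congr_ae h.le (ae_mono_Ioc le_rfl hτ.2 k2)
  refine ⟨⟨k, hmem, hrep⟩, ?_⟩
  have := ae_mono_Ioc ht le_rfl (caputoDeriv_ae_eq hα0 hα1 (ht.trans htT) hmem hrep)
  filter_upwards [this, k2] with ξ h1 h2
  rw [h1, h2]

/-- By locality the densities of `x` and `w` agree before `t`, so the part of the integral over `[0,
t]` depends on `w` only. -/
theorem IsAC.eq_memory_add (hα0 : 0 < α) (hα1 : α < 1) (hx : IsAC α T x)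
    (hx1 : ∀ s ∈ Icc 0 g.t, x s = g.w s) :
    ∀ s ∈ Icc g.t T, x s = memory g s + fracInt α g.t (caputoDeriv α x) s := by
  have ht := g.t_mem.1
  have htT := g.t_mem.2.le
  obtain ⟨hm, C, -, hC⟩ := hx.caputoDeriv_bounded hα0 hα1 (ht.trans htT)
  intro s hs
  rw [hx.eq_fracInt hα0 hα1 (ht.trans htT) s ⟨ht.trans hs.1, hs.2⟩,
    fracInt_split hα0 hm hC ht hs.1 hs.2, memory, hx1 0 ⟨le_rfl, ht⟩, add_assoc]
  congr 3
  rw [intervalIntegral.integral_of_le ht, intervalIntegral.integral_of_le ht]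
  refine integral_congr_ae ?_
  filter_upwards [caputoDeriv_ae_congr (α := α) hx1] with ξ hξ
  rw [hξ]

/-- Admissible extensions with a prescribed Caputo derivative after time `t`. -/
theorem exists_extension (hα0 : 0 < α) (hα1 : α < 1) {C : ℝ}
    (hl : AEStronglyMeasurable l (volume.restrict (Ioc g.t T)))
    (hC : ∀ᵐ ξ ∂(volume.restrict (Ioc g.t T)), |l ξ| ≤ C) :
    ∃ y, IsAC α T y ∧ (∀ s ∈ Icc 0 g.t, y s = g.w s) ∧
      (∀ s ∈ Icc g.t T, y s = memory g s + fracInt α g.t l s) ∧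
      ∀ᵐ ξ ∂(volume.restrict (Ioc g.t T)), caputoDeriv α y ξ = l ξ := by
  set y : ℝ → ℝ := fun s => if s ≤ g.t then g.w s else memory g s + fracInt α g.t l s with hy
  have hy1 : ∀ s ∈ Icc 0 g.t, y s = g.w s := fun s hs => by simp [hy, hs.2]
  obtain ⟨h1, h2⟩ := isAC_of_eq_memory_add hα0 hα1 hl hC hy1
    fun s hs => by simp [hy, not_le.2 hs.1]
  refine ⟨y, h1, hy1, fun s hs => ?_, h2⟩
  rw [h1.eq_memory_add hα0 hα1 hy1 s hs, fracInt_congr_ae hs.1 (ae_mono_Ioc le_rfl hs.2 h2)]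

/-- On `[t, T]` the memory term is itself the admissible extension with zero Caputo derivative, and
therefore continuous, including at `t`. -/
theorem continuousOn_memory (hα0 : 0 < α) (hα1 : α < 1) (g : InitialData α T) :
    ContinuousOn (memory g) (Icc g.t T) := by
  obtain ⟨y, h1, -, h3, -⟩ := exists_extension (g := g) (l := fun _ => 0) (C := 0) hα0 hα1
    aestronglyMeasurable_const (by simp)
  have ht := g.t_mem.1
  refine ((h1.continuousOn hα0 hα1 (ht.trans g.t_mem.2.le)).mono
    (Icc_subset_Icc_left ht)).congr fun s hs => ?_
  rw [h3 s hs]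
  simp [fracInt]

end Extension

/-! ### Well-posedness of the Cauchy problem. -/

/-- A priori bound for Volterra equations with linear growth. -/
theorem exists_apriori_bound {α : ℝ} (hα0 : 0 < α) (hα1 : α ≤ 1) {T γ : ℝ} (hT : 0 < T)
    (hγ : 0 ≤ γ) :
    ∃ B, 0 < B ∧ ∀ (c d M : ℝ) (z F : ℝ → ℝ), d ≤ c + T → 0 ≤ M → (∃ C, ∀ s ∈ Ioc c d, |z s| ≤ C) →
      ContinuousOn z (Ioc c d) →
      (∀ ξ ∈ Ioc c d, |F ξ| ≤ γ * (1 + |z ξ|)) →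
      (∀ s ∈ Ioc c d, |z s| ≤ M + |fracInt α c F s|) →
      ∀ s ∈ Ioc c d, |z s| ≤ B * (M + 1) := by
  obtain ⟨B, hB, H⟩ := fractional_gronwall hα0 hα1 one_pos (Or.inr rfl) T γ hγ
  -- Bounds `γ I^α 1`, the contribution of the constant in the growth condition, over any interval
  -- of length at most `T`.
  set D := γ * (Real.Gamma 1 / Real.Gamma (1 + α)) * T ^ α
  have hΓ : 0 < Real.Gamma 1 / Real.Gamma (1 + α) :=
    div_pos (Real.Gamma_pos_of_pos one_pos) (Real.Gamma_pos_of_pos (by linarith))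
  have hD : 0 ≤ D := by positivity
  refine ⟨B * (1 + D), by positivity, fun c d M z F hd hM hz hzc hF hle s hs => ?_⟩
  obtain ⟨C, hC⟩ := hz
  have hzW : WCont 1 c d z := WCont.of_bounded le_rfl hzc hC
  have hzW' : WCont 1 c d fun ξ => |z ξ| :=
    WCont.of_bounded le_rfl hzc.abs fun s hs => by rw [abs_abs]; exact hC s hs
  have h1W : WCont 1 c d fun _ => (1 : ℝ) :=
    WCont.of_bounded le_rfl continuousOn_const fun _ _ => le_rfl
  have key := H c d (M + D) z hd (by positivity) ⟨C, fun s hs => by simpa using hC s hs⟩ ?_ s hs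
  · simp only [sub_self, Real.rpow_zero, mul_one] at key
    refine key.trans ?_
    rw [mul_assoc]
    refine mul_le_mul_of_nonneg_left ?_ hB.le
    nlinarith [mul_nonneg hD hM]
  · intro s hs
    have hsd : s ∈ Icc c d := Ioc_subset_Icc_self hs
    have h1 : |fracInt α c F s| ≤ fracInt α c (fun ξ => γ * (1 + |z ξ|)) s :=
      abs_fracInt_le hα0 hs.1.le
        (((h1W.add hzW').const_mul γ).intervalIntegrable_kernel hα0 one_pos hsd)
        (ae_Ioc_of_forall_Ioo fun ξ hξ => hF ξ ⟨hξ.1, hξ.2.le.trans hs.2⟩)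
    rw [fracInt_const_mul, fracInt_add (h1W.intervalIntegrable_kernel hα0 one_pos hsd)
      (hzW'.intervalIntegrable_kernel hα0 one_pos hsd)] at h1
    have h2 : fracInt α c (fun _ => (1 : ℝ)) s ≤
        (Real.Gamma 1 / Real.Gamma (1 + α)) * T ^ α := by
      have := abs_fracInt_le_rpow (φ := fun _ => (1 : ℝ)) (C := 1) hα0 one_pos hs.1
        (ae_of_all _ fun _ => by simp)
      refine (le_abs_self _).trans (this.trans ?_)
      rw [one_mul, show 1 + α - 1 = α by ring]
      refine mul_le_mul_of_nonneg_left ?_ hΓ.le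
      exact Real.rpow_le_rpow (sub_pos.2 hs.1).le (by linarith [hs.2]) hα0.le
    have h3 := mul_le_mul_of_nonneg_left h2 hγ
    simp only [sub_self, Real.rpow_zero, mul_one]
    have h4 := hle s hs
    simp only [D]
    rw [mul_add] at h1
    linarith [mul_assoc γ (Real.Gamma 1 / Real.Gamma (1 + α)) (T ^ α)]

section Cauchy

variable {α T : ℝ} {f : ℝ → ℝ → ℝ} {g : InitialData α T} {x x' : ℝ → ℝ}

theorem InitialData.Icc_subset (g : InitialData α T) : Icc g.t T ⊆ Icc 0 T :=
  Icc_subset_Icc_left g.t_mem.1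

theorem InitialData.Ioc_subset (g : InitialData α T) : Ioc g.t T ⊆ Icc 0 T :=
  Ioc_subset_Icc_self.trans g.Icc_subset

theorem IsCauchySolution.continuousOn (hα0 : 0 < α) (hα1 : α < 1) (hT : 0 < T)
    (hx : IsCauchySolution α T f g x) : ContinuousOn x (Icc 0 T) :=
  hx.1.continuousOn hα0 hα1 hT.le

theorem IsCauchySolution.ae_eq (hx : IsCauchySolution α T f g x) :
    ∀ᵐ ξ ∂(volume.restrict (Ioc g.t T)), caputoDeriv α x ξ = f ξ (x ξ) :=
  ae_restrict_Icc_iff.1 hx.2.2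

theorem IsCauchySolution.eq_volterra (hα0 : 0 < α) (hα1 : α < 1)
    (hx : IsCauchySolution α T f g x) {s : ℝ} (hs : s ∈ Icc g.t T) :
    x s = memory g s + fracInt α g.t (fun ξ => f ξ (x ξ)) s := by
  rw [hx.1.eq_memory_add hα0 hα1 hx.2.1 s hs,
    fracInt_congr_ae hs.1 (ae_mono_Ioc le_rfl hs.2 hx.ae_eq)]

/-- A function of class `C^1` is only locally Lipschitz, so the equation is solved with its argument
clamped to `[-R, R]`; the a priori bound shows that the clamp never acts. -/
theorem exists_isCauchySolution (hα0 : 0 < α) (hα1 : α < 1) (hT : 0 < T)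
    (hf : ContDiffOn ℝ 1 (fun z : ℝ × ℝ => f z.1 z.2) (Icc 0 T ×ˢ univ))
    (hgrowth : ∃ γ : ℝ, 0 ≤ γ ∧ ∀ τ ∈ Icc 0 T, ∀ x : ℝ, |f τ x| ≤ γ * (1 + |x|))
    (g : InitialData α T) : ∃ x, IsCauchySolution α T f g x := by
  obtain ⟨γ, hγ, hg⟩ := hgrowth
  obtain ⟨B, hB, HB⟩ := exists_apriori_bound hα0 hα1.le hT hγ
  have hmem := continuousOn_memory hα0 hα1 g
  obtain ⟨M, hM⟩ := isCompact_Icc.exists_bound_of_continuousOn hmem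
  set R := B * (|M| + 1)
  have hR : 0 ≤ R := by positivity
  obtain ⟨L, hL, HL⟩ := exists_lipschitz_strip hT hf R
  obtain ⟨A, hA, HA⟩ := exists_bound_strip hf.continuousOn R
  set cl : ℝ → ℝ := fun y => max (-R) (min y R) with hcl
  have cl1 : ∀ y, |cl y| ≤ R := fun y =>
    abs_le.2 ⟨le_max_left _ _, max_le (by linarith) (min_le_right _ _)⟩
  have cl2 : ∀ y, |y| ≤ R → cl y = y := fun y hy => by
    rw [hcl]; simp only [min_eq_left (abs_le.1 hy).2, max_eq_right (abs_le.1 hy).1]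
  have cl3 : ∀ y y', |cl y - cl y'| ≤ |y - y'| := fun y y' => by
    refine (abs_max_sub_max_le_max _ _ _ _).trans ?_
    rw [sub_self, abs_zero, max_eq_right (abs_nonneg _)]
    refine (abs_min_sub_min_le_max _ _ _ _).trans ?_
    rw [sub_self, abs_zero, max_eq_left (abs_nonneg _)]
  have cl4 : ∀ y, |cl y| ≤ |y| := fun y => by
    have := cl3 y 0
    rwa [cl2 0 (by simpa using hR), sub_zero, sub_zero] at this
  have clc : Continuous cl := by fun_prop
  have hNc : ∀ z, ContinuousOn z (Ioc g.t T) → ContinuousOn (fun ξ => f ξ (cl (z ξ))) (Ioc g.t T) :=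
    fun z hz => continuousOn_along (h := fun z : ℝ × ℝ => f z.1 z.2) hf.continuousOn g.Ioc_subset
      (clc.comp_continuousOn hz)
  have hNb : ∀ z : ℝ → ℝ, ∀ s ∈ Ioc g.t T, |f s (cl (z s))| ≤ A := fun z s hs =>
    HA s (g.Ioc_subset hs) _ (cl1 _)
  obtain ⟨z, hzW, hz⟩ := exists_volterra_solution (c := g.t) (d := T) (K := L)
    (N := fun ξ y => f ξ (cl y)) (h := memory g) hα0 hα1.le hL
    (fun ξ hξ y y' => (HL ξ (g.Ioc_subset hξ) _ _ (cl1 _) (cl1 _)).trans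
      (mul_le_mul_of_nonneg_left (cl3 y y') hL))
    (fun z hz => WCont.of_bounded hα1.le (hNc z hz.1) (hNb z))
    (WCont.of_continuousOn_Icc hα1.le hmem)
  have hFW : WCont 1 g.t T fun ξ => f ξ (cl (z ξ)) :=
    WCont.of_bounded le_rfl (hNc z hzW.1) (hNb z)
  obtain ⟨C, hC⟩ := (hFW.fracInt hα0 one_pos le_rfl).2
  simp only [sub_self, Real.rpow_zero, mul_one] at hC
  -- Clamping does not increase absolute values, so the truncated nonlinearity satisfies the same
  -- growth condition and the bound chosen beforehand as `R` applies.
  have hzb : ∀ s ∈ Ioc g.t T, |z s| ≤ R := by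
    refine HB g.t T |M| z (fun ξ => f ξ (cl (z ξ))) (by linarith [g.t_mem.1]) (abs_nonneg M)
      ⟨|M| + C, fun s hs => ?_⟩ hzW.1 (fun ξ hξ => ?_) (fun s hs => ?_)
    · rw [hz s hs]
      exact (abs_add_le _ _).trans (add_le_add
        ((hM s (Ioc_subset_Icc_self hs)).trans (le_abs_self M)) (hC s hs))
    · refine (hg ξ (g.Ioc_subset hξ) _).trans (mul_le_mul_of_nonneg_left ?_ hγ)
      linarith [cl4 (z ξ)]
    · rw [hz s hs]
      exact (abs_add_le _ _).trans (add_le_add_left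
        ((hM s (Ioc_subset_Icc_self hs)).trans (le_abs_self M)) _)
  obtain ⟨x, hx1, hx2, hx3, hx4⟩ := exists_extension (g := g) hα0 hα1
    (hFW.aestronglyMeasurable le_rfl)
    ((ae_restrict_iff' measurableSet_Ioc).2 (ae_of_all _ (hNb z)))
  refine ⟨x, hx1, hx2, ?_⟩
  rw [ae_restrict_Icc_iff]
  filter_upwards [hx4, ae_restrict_mem measurableSet_Ioc] with ξ h1 h2
  rw [h1, hx3 ξ (Ioc_subset_Icc_self h2), ← hz ξ h2, cl2 _ (hzb ξ h2)]

/-- Both solutions are bounded, so `f` is Lipschitz on a range containing them and Gronwall applies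
to the difference with zero free term. -/
theorem IsCauchySolution.unique (hα0 : 0 < α) (hα1 : α < 1) (hT : 0 < T)
    (hf : ContDiffOn ℝ 1 (fun z : ℝ × ℝ => f z.1 z.2) (Icc 0 T ×ˢ univ))
    (hx : IsCauchySolution α T f g x) (hx' : IsCauchySolution α T f g x') :
    EqOn x' x (Icc 0 T) := by
  have hxc := hx.continuousOn hα0 hα1 hT
  have hxc' := hx'.continuousOn hα0 hα1 hT
  obtain ⟨R1, hR1⟩ := isCompact_Icc.exists_bound_of_continuousOn hxc
  obtain ⟨R2, hR2⟩ := isCompact_Icc.exists_bound_of_continuousOn hxc'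
  obtain ⟨L, hL, HL⟩ := exists_lipschitz_strip hT hf (max R1 R2)
  obtain ⟨B, hB, H⟩ := fractional_gronwall hα0 hα1.le one_pos (Or.inr rfl) T L hL
  have hc : ∀ {x : ℝ → ℝ}, ContinuousOn x (Icc 0 T) →
      WCont 1 g.t T fun ξ => f ξ (x ξ) := fun hx =>
    WCont.of_continuousOn_Icc le_rfl (continuousOn_along (h := fun z : ℝ × ℝ => f z.1 z.2)
      hf.continuousOn g.Icc_subset (hx.mono g.Icc_subset))
  have hd : WCont 1 g.t T fun s => |x' s - x s| :=
    WCont.of_continuousOn_Icc le_rfl ((hxc'.sub hxc).mono g.Icc_subset).abs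
  have key := H g.t T 0 (fun s => x' s - x s) (by linarith [g.t_mem.1]) le_rfl
    (by simpa using hd.2) (fun s hs => by
      have hs' := Ioc_subset_Icc_self hs
      rw [hx.eq_volterra hα0 hα1 hs', hx'.eq_volterra hα0 hα1 hs', add_sub_add_left_eq_sub,
        ← fracInt_sub ((hc hxc').intervalIntegrable_kernel hα0 one_pos hs')
          ((hc hxc).intervalIntegrable_kernel hα0 one_pos hs'), zero_mul, zero_add,
        ← fracInt_const_mul]
      refine abs_fracInt_le hα0 hs.1.le
        ((hd.const_mul L).intervalIntegrable_kernel hα0 one_pos hs')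
        (ae_Ioc_of_forall_Ioo fun ξ hξ => ?_)
      have hξ' : ξ ∈ Icc 0 T := g.Ioc_subset ⟨hξ.1, hξ.2.le.trans hs.2⟩
      exact HL ξ hξ' _ _ ((hR1 ξ hξ').trans (le_max_left _ _))
        ((hR2 ξ hξ').trans (le_max_right _ _)))
  intro s hs
  rcases le_or_gt s g.t with h | h
  · rw [hx.2.1 s ⟨hs.1, h⟩, hx'.2.1 s ⟨hs.1, h⟩]
  · have := key s ⟨h, hs.2⟩
    rw [mul_zero, zero_mul] at this
    exact sub_eq_zero.1 (abs_nonpos_iff.1 this)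

theorem rho_eq (hα0 : 0 < α) (hα1 : α < 1) (hT : 0 < T)
    (hf : ContDiffOn ℝ 1 (fun z : ℝ × ℝ => f z.1 z.2) (Icc 0 T ×ˢ univ))
    (hx : IsCauchySolution α T f g x) : rho α T f g = x T := by
  have h : ∃ x, IsCauchySolution α T f g x := ⟨x, hx⟩
  rw [rho, dif_pos h]
  exact IsCauchySolution.unique hα0 hα1 hT hf hx h.choose_spec ⟨hT.le, le_rfl⟩

end Cauchy

/-! ### The free terms and their derivatives. -/

section Memory

variable {α T : ℝ}

/-- The derivative of `memory`. -/
def dmemory (g : InitialData α T) (s : ℝ) : ℝ :=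
  -((1 - α) / Real.Gamma α) *
    ∫ ξ in (0 : ℝ)..g.t, caputoDeriv α g.w ξ / (s - ξ) ^ (2 - α)

theorem memory_t (hα0 : 0 < α) (hα1 : α < 1) (g : InitialData α T) : memory g g.t = g.w g.t := by
  have ht := g.t_mem.1
  rw [g.w_isAC.eq_fracInt hα0 hα1 ht g.t ⟨ht, le_rfl⟩]
  rfl

theorem integral_sub_rpow_of_pos {α : ℝ} (hα1 : α < 1) {u v s : ℝ} (huv : u ≤ v) (hvs : v < s) :
    ∫ ξ in u..v, (s - ξ) ^ (α - 2) = ((s - v) ^ (α - 1) - (s - u) ^ (α - 1)) / (1 - α) := by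
  rw [intervalIntegral.integral_comp_sub_left (fun x => x ^ (α - 2)), integral_rpow]
  · rw [show α - 2 + 1 = -(1 - α) by ring, show α - 1 = -(1 - α) by ring, div_neg, ← neg_div]
    congr 1
    ring
  · refine Or.inr ⟨by linarith, ?_⟩
    rw [uIcc_of_le (by linarith)]
    exact fun h => by linarith [h.1]

theorem integral_rpow_sub_of_pos {α : ℝ} (hα1 : α < 1) {u v ξ : ℝ} (huv : u ≤ v) (hvs : ξ < u) :
    ∫ r in u..v, (r - ξ) ^ (α - 2) = ((u - ξ) ^ (α - 1) - (v - ξ) ^ (α - 1)) / (1 - α) := by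
  rw [intervalIntegral.integral_comp_sub_right (fun x => x ^ (α - 2)), integral_rpow]
  · rw [show α - 2 + 1 = -(1 - α) by ring, show α - 1 = -(1 - α) by ring, div_neg, ← neg_div]
    congr 1
    ring
  · refine Or.inr ⟨by linarith, ?_⟩
    rw [uIcc_of_le (by linarith)]
    exact fun h => by linarith [h.1]

theorem div_rpow_two_sub {y : ℝ} (hy : 0 ≤ y) (u a : ℝ) : u / y ^ (2 - a) = u * y ^ (a - 2) := by
  rw [show a - 2 = -(2 - a) by ring, Real.rpow_neg hy, div_eq_mul_inv]

theorem intervalIntegrable_sub_rpow_of_pos (r : ℝ) {u v s : ℝ} (huv : u ≤ v) (hvs : v < s) :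
    IntervalIntegrable (fun ξ => (s - ξ) ^ r) volume u v := by
  refine ContinuousOn.intervalIntegrable ?_
  rw [uIcc_of_le huv]
  exact (continuousOn_const.sub continuousOn_id).rpow_const fun ξ hξ =>
    Or.inl (sub_pos.2 (hξ.2.trans_lt hvs)).ne'

/-- With a bounded density, integrating the exponent `α - 2` over the past leaves `(s - t)^(α-1) /
(1 - α)`, and the prefactor cancels `1 - α`. Continuity is by dominated convergence away from `t`.
-/
theorem wCont_dmemory (hα0 : 0 < α) (hα1 : α < 1) (g : InitialData α T) :
    WCont α g.t T (dmemory g) := by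
  have ht := g.t_mem.1
  have hΓ := Real.Gamma_pos_of_pos hα0
  obtain ⟨hm, C, hC0, hC⟩ := g.w_isAC.caputoDeriv_bounded hα0 hα1 ht
  constructor
  · refine continuousOn_const.mul ?_
    intro s₀ hs₀
    have hr : 0 < (s₀ - g.t) / 2 := by linarith [hs₀.1]
    refine intervalIntegral.continuousWithinAt_of_dominated_interval
      (bound := fun _ => C * ((s₀ - g.t) / 2) ^ (α - 2)) ?_ ?_ ?_ ?_
    · refine Eventually.of_forall fun s => ?_
      rw [uIoc_of_le ht]
      simp_rw [div_eq_mul_inv]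
      exact hm.mul (by fun_prop :
        Measurable fun ξ : ℝ => ((s - ξ) ^ (2 - α))⁻¹).aestronglyMeasurable
    · have : ∀ᶠ s in 𝓝[Ioc g.t T] s₀, (s₀ + g.t) / 2 < s :=
        mem_nhdsWithin_of_mem_nhds (lt_mem_nhds (by linarith [hs₀.1]))
      filter_upwards [this] with s h1
      rw [uIoc_of_le ht]
      refine (ae_restrict_iff' measurableSet_Ioc).1 ?_
      filter_upwards [hC, ae_restrict_mem measurableSet_Ioc] with ξ h2 h3
      have h4 : (s₀ - g.t) / 2 ≤ s - ξ := by linarith [h3.2]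
      rw [div_rpow_two_sub (hr.le.trans h4), norm_mul, Real.norm_eq_abs, Real.norm_eq_abs,
        abs_of_nonneg (Real.rpow_nonneg (hr.le.trans h4) _)]
      exact mul_le_mul h2 (Real.rpow_le_rpow_of_nonpos hr h4 (by linarith))
        (Real.rpow_nonneg (hr.le.trans h4) _) hC0
    · exact intervalIntegrable_const
    · refine ae_of_all _ fun ξ hξ => ?_
      rw [uIoc_of_le ht] at hξ
      have h5 : 0 < s₀ - ξ := by linarith [hs₀.1, hξ.2]
      refine ContinuousAt.continuousWithinAt ?_
      refine continuousAt_const.div ((continuousAt_id.sub continuousAt_const).rpow_const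
        (Or.inl h5.ne')) (Real.rpow_pos_of_pos h5 _).ne'
  · refine ⟨C / Real.Gamma α, fun s hs => ?_⟩
    have h1α : 0 < 1 - α := sub_pos.2 hα1
    have h1 : |∫ ξ in (0 : ℝ)..g.t, caputoDeriv α g.w ξ / (s - ξ) ^ (2 - α)| ≤
        ∫ ξ in (0 : ℝ)..g.t, C * (s - ξ) ^ (α - 2) := by
      rw [intervalIntegral.integral_of_le ht, intervalIntegral.integral_of_le ht,
        ← Real.norm_eq_abs]
      refine (norm_integral_le_integral_norm _).trans ?_
      refine integral_mono_of_nonneg (ae_of_all _ fun _ => norm_nonneg _)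
        ((intervalIntegrable_iff_integrableOn_Ioc_of_le ht).1
        ((intervalIntegrable_sub_rpow_of_pos _ ht hs.1).const_mul C)) ?_
      filter_upwards [hC, ae_restrict_mem measurableSet_Ioc] with ξ h2 h3
      have h4 : 0 ≤ s - ξ := by linarith [h3.2, hs.1]
      rw [div_rpow_two_sub h4, norm_mul, Real.norm_eq_abs, Real.norm_eq_abs,
        abs_of_nonneg (Real.rpow_nonneg h4 _)]
      exact mul_le_mul_of_nonneg_right h2 (Real.rpow_nonneg h4 _)
    rw [intervalIntegral.integral_const_mul, integral_sub_rpow_of_pos hα1 ht hs.1] at h1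
    have h6 : 0 ≤ (s - 0) ^ (α - 1) := Real.rpow_nonneg (by linarith [hs.1]) _
    rw [dmemory, abs_mul, abs_neg, abs_of_pos (div_pos h1α hΓ)]
    calc _ ≤ (1 - α) / Real.Gamma α *
          (C * (((s - g.t) ^ (α - 1)) / (1 - α))) := by
          refine mul_le_mul_of_nonneg_left (h1.trans ?_) (div_pos h1α hΓ).le
          refine mul_le_mul_of_nonneg_left ?_ hC0
          exact div_le_div_of_nonneg_right (by linarith) h1α.le
      _ = _ := by field_simp

/-- Fubini avoids differentiating under the integral sign at the singular time `t`: for fixed `ξ <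
t`, integrating the differentiated kernel in `r` gives back a difference of two kernels, each
integrable in `ξ`. -/
theorem memory_eq_integral (hα0 : 0 < α) (hα1 : α < 1) (g : InitialData α T) {s : ℝ}
    (hs : g.t ≤ s) : memory g s = g.w g.t + ∫ r in g.t..s, dmemory g r := by
  have ht := g.t_mem.1
  have h1α : 0 < 1 - α := sub_pos.2 hα1
  obtain ⟨hm, C, hC0, hC⟩ := g.w_isAC.caputoDeriv_bounded hα0 hα1 ht
  set l := caputoDeriv α g.w with hl
  have inner : ∀ ξ ∈ Ioo 0 g.t, ∫ r in g.t..s, (r - ξ) ^ (α - 2) * l ξ =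
      (l ξ / (g.t - ξ) ^ (1 - α) - l ξ / (s - ξ) ^ (1 - α)) / (1 - α) := by
    intro ξ hξ
    rw [intervalIntegral.integral_mul_const, integral_rpow_sub_of_pos hα1 hs hξ.2,
      div_rpow_one_sub (sub_pos.2 hξ.2).le, div_rpow_one_sub (by linarith [hξ.2])]
    ring
  have i1 := intervalIntegrable_kernel_of_bounded hα0 (s := g.t) ht le_rfl hm hC
  have i2 := intervalIntegrable_kernel_of_bounded hα0 (s := s) ht hs hm hC
  have hint : Integrable (fun p : ℝ × ℝ => (p.1 - p.2) ^ (α - 2) * l p.2)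
      ((volume.restrict (Ioc g.t s)).prod (volume.restrict (Ioc 0 g.t))) := by
    rw [integrable_prod_iff' (aestronglyMeasurable_comp_snd_mul hm (by fun_prop))]
    have icont : ∀ ξ ∈ Ioo 0 g.t, IntervalIntegrable (fun r => (r - ξ) ^ (α - 2)) volume g.t s := by
      intro ξ hξ
      refine ContinuousOn.intervalIntegrable ?_
      rw [uIcc_of_le hs]
      exact (continuousOn_id.sub continuousOn_const).rpow_const fun r hr =>
        Or.inl (sub_pos.2 (hξ.2.trans_le hr.1)).ne'
    constructor
    · refine ae_Ioc_of_forall_Ioo fun ξ hξ => ?_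
      exact ((intervalIntegrable_iff_integrableOn_Ioc_of_le hs).1 (icont ξ hξ)).mul_const (l ξ)
    · have j1 := (intervalIntegrable_iff_integrableOn_Ioc_of_le ht).1
        ((i1.norm.sub i2.norm).div_const (1 - α))
      refine j1.congr (ae_Ioc_of_forall_Ioo fun ξ hξ => ?_)
      have : ∫ r in Ioc g.t s, ‖(r - ξ) ^ (α - 2) * l ξ‖ =
          ∫ r in g.t..s, (r - ξ) ^ (α - 2) * |l ξ| := by
        rw [intervalIntegral.integral_of_le hs]
        refine setIntegral_congr_fun measurableSet_Ioc fun r hr => ?_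
        rw [norm_mul, Real.norm_eq_abs, Real.norm_eq_abs,
          abs_of_nonneg (Real.rpow_nonneg (by linarith [hr.1, hξ.2]) _)]
      simp only
      rw [this, intervalIntegral.integral_mul_const, integral_rpow_sub_of_pos hα1 hs hξ.2,
        div_rpow_one_sub (sub_pos.2 hξ.2).le, div_rpow_one_sub (by linarith [hξ.2]),
        norm_mul, norm_mul, Real.norm_eq_abs, Real.norm_eq_abs, Real.norm_eq_abs,
        abs_of_nonneg (Real.rpow_nonneg (sub_pos.2 hξ.2).le _),
        abs_of_nonneg (Real.rpow_nonneg (by linarith [hξ.2] : 0 ≤ s - ξ) _)]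
      ring
  have swap := integral_integral_swap (f := fun r ξ => (r - ξ) ^ (α - 2) * l ξ) hint
  have e1 : ∫ r in g.t..s, dmemory g r = -((1 - α) / Real.Gamma α) *
      ∫ r in Ioc g.t s, ∫ ξ in Ioc 0 g.t, (r - ξ) ^ (α - 2) * l ξ := by
    simp only [dmemory, intervalIntegral.integral_const_mul]
    congr 1
    rw [intervalIntegral.integral_of_le hs]
    refine setIntegral_congr_fun measurableSet_Ioc fun r hr => ?_
    rw [intervalIntegral.integral_of_le ht]
    refine setIntegral_congr_fun measurableSet_Ioc fun ξ hξ => ?_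
    rw [div_rpow_two_sub (by linarith [hr.1, hξ.2]), mul_comm]
  have e2 : ∫ ξ in Ioc 0 g.t, ∫ r in Ioc g.t s, (r - ξ) ^ (α - 2) * l ξ =
      ((∫ ξ in (0 : ℝ)..g.t, l ξ / (g.t - ξ) ^ (1 - α)) -
        ∫ ξ in (0 : ℝ)..g.t, l ξ / (s - ξ) ^ (1 - α)) / (1 - α) := by
    rw [← intervalIntegral.integral_sub i1 i2, ← intervalIntegral.integral_div,
      intervalIntegral.integral_of_le ht]
    refine integral_congr_ae (ae_Ioc_of_forall_Ioo fun ξ hξ => ?_)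
    simp only
    rw [← inner ξ hξ, intervalIntegral.integral_of_le hs]
  rw [e1, swap, e2, ← memory_t hα0 hα1 g, memory, memory]
  field_simp
  ring

theorem qBar_eq {g : InitialData α T} {s : ℝ} (hs : g.t ≤ s) :
    qBar g s = 1 / Real.Gamma α * (s - g.t) ^ (α - 1) := by
  rw [← div_rpow_one_sub (sub_nonneg.2 hs), qBar, div_div]

theorem wCont_qBar (g : InitialData α T) : WCont α g.t T (qBar g) := by
  refine WCont.congr (φ := fun s => 1 / Real.Gamma α * (s - g.t) ^ (α - 1)) ?_
    fun s hs => qBar_eq hs.1.le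
  refine WCont.const_mul ⟨?_, 1, fun s hs => ?_⟩ _
  · exact (continuousOn_id.sub continuousOn_const).rpow_const
      fun s hs => Or.inl (sub_pos.2 hs.1).ne'
  · rw [one_mul, abs_of_nonneg (Real.rpow_nonneg (sub_pos.2 hs.1).le _)]

theorem fracInt_one_eq (hα0 : 0 < α) {c s : ℝ} (hs : c ≤ s) :
    fracInt α c (fun _ => (1 : ℝ)) s = 1 / Real.Gamma α * ((s - c) ^ α / α) := by
  rw [fracInt]
  congr 1
  have := integral_sub_right_rpow hα0 (c := c) (d := s) (s := s)
  rw [sub_self, Real.zero_rpow hα0.ne', sub_zero] at this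
  rw [← this]
  refine intervalIntegral.integral_congr fun ξ hξ => ?_
  rw [uIcc_of_le hs] at hξ
  rw [div_rpow_one_sub (sub_nonneg.2 hξ.2), one_mul]

theorem integral_qBar (hα0 : 0 < α) (g : InitialData α T) {s : ℝ} (hs : g.t ≤ s) :
    ∫ r in g.t..s, qBar g r = fracInt α g.t (fun _ => (1 : ℝ)) s := by
  rw [fracInt_one_eq hα0 hs, ← integral_sub_left_rpow hα0, ← intervalIntegral.integral_const_mul]
  refine intervalIntegral.integral_congr fun ξ hξ => ?_
  rw [uIcc_of_le hs] at hξ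
  exact qBar_eq hξ.1

end Memory

/-! ### Primitives of weighted functions and iterated Volterra inequalities. -/

section Primitive

variable {b c d : ℝ} {v x : ℝ → ℝ} {x₀ : ℝ}

theorem WCont.continuousOn_primitive (hv : WCont b c d v) (hb : 0 < b) (hcd : c ≤ d) :
    ContinuousOn (fun s => ∫ ξ in c..s, v ξ) (Icc c d) := by
  have := hv.intervalIntegrable hb (right_mem_Icc.2 hcd)
  rw [intervalIntegrable_iff_integrableOn_Icc_of_le hcd, ← uIcc_of_le hcd] at this
  rw [← uIcc_of_le hcd]
  exact intervalIntegral.continuousOn_primitive_interval this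

theorem WCont.hasDerivAt_primitive (hv : WCont b c d v) (hb : 0 < b)
    (hx : ∀ s ∈ Icc c d, x s = x₀ + ∫ ξ in c..s, v ξ) {s : ℝ} (hs : s ∈ Ioo c d) :
    HasDerivAt x (v s) s := by
  have h1 : HasDerivAt (fun s => x₀ + ∫ ξ in c..s, v ξ) (v s) s := by
    refine HasDerivAt.const_add x₀ ?_
    refine intervalIntegral.integral_hasDerivAt_right
      (hv.intervalIntegrable hb (Ioo_subset_Icc_self hs)) ?_
      (hv.1.continuousAt (Ioc_mem_nhds hs.1 hs.2))
    exact (hv.1.mono Ioo_subset_Ioc_self).stronglyMeasurableAtFilter isOpen_Ioo s hs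
  refine h1.congr_of_eventuallyEq ?_
  filter_upwards [Ioo_mem_nhds hs.1 hs.2] with r hr using hx r (Ioo_subset_Icc_self hr)

end Primitive

theorem WCont.abs {b c d : ℝ} {φ : ℝ → ℝ} (hφ : WCont b c d φ) : WCont b c d fun s => |φ s| :=
  ⟨hφ.1.abs, hφ.2.imp fun C hC s hs => by rw [abs_abs]; exact hC s hs⟩

theorem one_le_wt_one {lam c s : ℝ} (hlam : 0 ≤ lam) (hs : c ≤ s) : 1 ≤ wt 1 lam c s := by
  simpa using rpow_le_wt (b := 1) hlam hs

/-- A sequence of functions with `|z (n + 1)| ≤ M + K I^a |z n|` is uniformly bounded. -/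
theorem exists_uniform_bound {a c d K M : ℝ} (ha : 0 < a) (ha1 : a ≤ 1) (hK : 0 ≤ K)
    {z : ℕ → ℝ → ℝ} (h0 : ∃ C, ∀ s ∈ Ioc c d, |z 0 s| ≤ C)
    (hz : ∀ n, ∀ s ∈ Ioc c d, |z (n + 1) s| ≤ M + K * |fracInt a c (fun ξ => |z n ξ|) s|) :
    ∃ R, ∀ n, ∀ s ∈ Ioc c d, |z n s| ≤ R := by
  obtain ⟨lam, hlam, hw⟩ := exists_wt_contraction ha ha1 one_pos (Or.inr rfl) (d - c) K hK
  obtain ⟨C, hC⟩ := h0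
  -- Chosen so that it dominates the initial function and `M + D / 2 ≤ D`, hence is preserved by the
  -- iteration.
  set D := max |C| (2 * |M|)
  have hD0 : 0 ≤ D := (abs_nonneg C).trans (le_max_left _ _)
  have step : ∀ n, ∀ s ∈ Ioc c d, |z n s| ≤ D * wt 1 lam c s := by
    intro n
    induction n with
    | zero =>
      intro s hs
      exact ((hC s hs).trans ((le_abs_self C).trans (le_max_left _ _))).trans
        (le_mul_of_one_le_right hD0 (one_le_wt_one hlam.le hs.1.le))
    | succ n ih =>
      intro s hs
      have h1 := abs_fracInt_le_wt (φ := fun ξ => |z n ξ|) ha one_pos hlam hK hD0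
        (fun s hs => hw c s hs.1 (by linarith [hs.2]))
        (fun s hs => by rw [abs_abs]; exact ih s hs) s hs
      have h2 : M ≤ D / 2 * wt 1 lam c s := by
        have : |M| ≤ D / 2 := by linarith [le_max_right |C| (2 * |M|)]
        exact (le_abs_self M).trans (this.trans
          (le_mul_of_one_le_right (by positivity) (one_le_wt_one hlam.le hs.1.le)))
      linarith [hz n s hs]
  refine ⟨D * Real.exp (lam * (d - c)), fun n s hs => (step n s hs).trans ?_⟩
  refine mul_le_mul_of_nonneg_left ?_ hD0
  simpa using wt_le_rpow (b := 1) (T := d - c) hlam.le hs.1.le (by linarith [hs.2])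

/-- A sequence of functions with `|z (n + 1)| ≤ η n (s - c) ^ (b - 1) + K I^a |z n|` and `η → 0`
tends to `0` in the weighted norm. -/
theorem tendsto_zero_of_volterra_ineq {a b c d K : ℝ} (ha : 0 < a) (ha1 : a ≤ 1) (hb : 0 < b)
    (hba : b ≤ a ∨ b = 1) (hK : 0 ≤ K) {z : ℕ → ℝ → ℝ}
    (h0 : ∀ n, ∃ C, ∀ s ∈ Ioc c d, |z n s| ≤ C * (s - c) ^ (b - 1))
    (hz : ∀ ε > 0, ∃ n₀, ∀ n ≥ n₀, ∀ s ∈ Ioc c d,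
      |z (n + 1) s| ≤ ε * (s - c) ^ (b - 1) + K * |fracInt a c (fun ξ => |z n ξ|) s|) :
    ∀ ε > 0, ∃ n₀, ∀ n ≥ n₀, ∀ s ∈ Ioc c d, |z n s| ≤ ε * (s - c) ^ (b - 1) := by
  obtain ⟨lam, hlam, hw⟩ := exists_wt_contraction ha ha1 hb hba (d - c) K hK
  intro ε hε
  set E := Real.exp (lam * (d - c))
  have hE : 0 < E := Real.exp_pos _
  have hε' : 0 < ε / E := by positivity
  -- Division by `E` pays for leaving the exponential weight. A free term of a quarter has fixed
  -- point one half; the other half absorbs the geometric remainder.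
  obtain ⟨n₀, hn₀⟩ := hz (ε / E / 4) (by positivity)
  obtain ⟨C, hC⟩ := h0 n₀
  have step : ∀ k, ∀ s ∈ Ioc c d,
      |z (n₀ + k) s| ≤ (ε / E / 2 + |C| / 2 ^ k) * wt b lam c s := by
    intro k
    induction k with
    | zero =>
      intro s hs
      have hr := Real.rpow_nonneg (sub_pos.2 hs.1).le (b - 1)
      refine (hC s hs).trans (mul_le_mul ?_ (rpow_le_wt hlam.le hs.1.le) hr (by positivity))
      rw [pow_zero, div_one]
      linarith [le_abs_self C]
    | succ k ih =>
      intro s hs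
      have h1 := abs_fracInt_le_wt (φ := fun ξ => |z (n₀ + k) ξ|) ha hb hlam hK
        (by positivity : 0 ≤ ε / E / 2 + |C| / 2 ^ k)
        (fun s hs => hw c s hs.1 (by linarith [hs.2]))
        (fun s hs => by rw [abs_abs]; exact ih s hs) s hs
      have h2 := mul_le_mul_of_nonneg_left (rpow_le_wt (b := b) hlam.le hs.1.le)
        (by positivity : 0 ≤ ε / E / 4)
      have h3 := hn₀ (n₀ + k) (by omega) s hs
      have e : (ε / E / 2 + |C| / 2 ^ (k + 1)) * wt b lam c s =
          ε / E / 4 * wt b lam c s + (ε / E / 2 + |C| / 2 ^ k) / 2 * wt b lam c s := by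
        rw [pow_succ]; ring
      rw [e, ← add_assoc]
      linarith
  have lim : Tendsto (fun k : ℕ => |C| / 2 ^ k) atTop (𝓝 0) := by
    have := (tendsto_pow_atTop_nhds_zero_of_lt_one (r := (1 / 2 : ℝ)) (by norm_num)
      (by norm_num)).const_mul |C|
    simpa [div_eq_mul_inv] using this
  obtain ⟨k₀, hk₀⟩ := eventually_atTop.1 (lim.eventually_le_const (half_pos hε'))
  refine ⟨n₀ + k₀, fun n hn s hs => ?_⟩
  obtain ⟨k, rfl⟩ : ∃ k, n = n₀ + k := ⟨n - n₀, by omega⟩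
  have h1 := step k s hs
  have h2 := hk₀ k (by omega)
  have hwp := (wt_pos (b := b) (lam := lam) hs.1).le
  calc |z (n₀ + k) s| ≤ (ε / E / 2 + |C| / 2 ^ k) * wt b lam c s := h1
    _ ≤ ε / E * wt b lam c s := mul_le_mul_of_nonneg_right (by linarith) hwp
    _ ≤ ε / E * (E * (s - c) ^ (b - 1)) := mul_le_mul_of_nonneg_left
        (wt_le_rpow hlam.le hs.1.le (by linarith [hs.2])) hε'.le
    _ = ε * (s - c) ^ (b - 1) := by field_simp

/-! ### Differentiability of the solution away from the singular time. -/

section Regularity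

variable {α T : ℝ} {f : ℝ → ℝ → ℝ} {g : InitialData α T} {x : ℝ → ℝ}

/-- The formal derivative of `ξ ↦ f(ξ, x(ξ))` when `v` is the derivative of `x`. -/
def chainDeriv (T : ℝ) (f : ℝ → ℝ → ℝ) (x v : ℝ → ℝ) (ξ : ℝ) : ℝ :=
  derivWithin (fun r => f r (x ξ)) (Icc 0 T) ξ + deriv (fun y => f ξ y) (x ξ) * v ξ

theorem wCont_chainDeriv (hα1 : α < 1) (hT : 0 < T)
    (hf : ContDiffOn ℝ 1 (fun z : ℝ × ℝ => f z.1 z.2) (Icc 0 T ×ˢ univ)) {v : ℝ → ℝ}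
    (hx : ContinuousOn x (Icc g.t T)) (hv : WCont α g.t T v) :
    WCont α g.t T (chainDeriv T f x v) := by
  have h1 := continuousOn_along (continuousOn_strip_fst hT hf) g.Icc_subset hx
  have h2 := continuousOn_along (continuousOn_strip_snd hT hf) g.Icc_subset hx
  obtain ⟨A, hA⟩ := isCompact_Icc.exists_bound_of_continuousOn h2
  exact (WCont.of_continuousOn_Icc hα1.le h1).add
    (hv.mul_left (h2.mono Ioc_subset_Icc_self) fun s hs => hA s (Ioc_subset_Icc_self hs))

theorem continuousOn_f_along
    (hf : ContDiffOn ℝ 1 (fun z : ℝ × ℝ => f z.1 z.2) (Icc 0 T ×ˢ univ))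
    (hx : ContinuousOn x (Icc g.t T)) : ContinuousOn (fun ξ => f ξ (x ξ)) (Icc g.t T) :=
  continuousOn_along (h := fun z : ℝ × ℝ => f z.1 z.2) hf.continuousOn g.Icc_subset hx

/-- The derivative may blow up at `t`, but continuity on the closed interval, the chain rule inside
and integrability of the singularity are enough for the fundamental theorem. -/
theorem f_along_eq_integral (hα0 : 0 < α) (hα1 : α < 1) (hT : 0 < T)
    (hf : ContDiffOn ℝ 1 (fun z : ℝ × ℝ => f z.1 z.2) (Icc 0 T ×ˢ univ)) {v : ℝ → ℝ}
    (hv : WCont α g.t T v)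
    (hx : ∀ s ∈ Icc g.t T, x s = g.w g.t + ∫ ξ in g.t..s, v ξ) {s : ℝ} (hs : s ∈ Icc g.t T) :
    f s (x s) = f g.t (g.w g.t) + ∫ ξ in g.t..s, chainDeriv T f x v ξ := by
  have htT := g.t_mem.2.le
  have hxc : ContinuousOn x (Icc g.t T) :=
    (continuousOn_const.add (hv.continuousOn_primitive hα0 htT)).congr hx
  have hxt : x g.t = g.w g.t := by rw [hx g.t ⟨le_rfl, htT⟩]; simp
  have h1 := intervalIntegral.integral_eq_sub_of_hasDerivAt_of_le hs.1
    ((continuousOn_f_along hf hxc).mono (Icc_subset_Icc_right hs.2))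
    (fun r hr => hasDerivAt_along hT hf
      ⟨g.t_mem.1.trans_lt hr.1, hr.2.trans_le hs.2⟩
      (hv.hasDerivAt_primitive hα0 hx ⟨hr.1, hr.2.trans_le hs.2⟩))
    ((wCont_chainDeriv hα1 hT hf hxc hv).intervalIntegrable hα0 hs)
  simp only [chainDeriv]
  rw [h1, hxt]
  ring

/-- Fractional integration by parts: `f` along `x` is its value at `t` plus `I^1` of the chain-rule
derivative, and `I^α I^1 = I^(α+1)`. -/
theorem fracInt_f_along (hα0 : 0 < α) (hα1 : α < 1) (hT : 0 < T)
    (hf : ContDiffOn ℝ 1 (fun z : ℝ × ℝ => f z.1 z.2) (Icc 0 T ×ˢ univ)) {v : ℝ → ℝ}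
    (hv : WCont α g.t T v)
    (hx : ∀ s ∈ Icc g.t T, x s = g.w g.t + ∫ ξ in g.t..s, v ξ) {s : ℝ} (hs : s ∈ Icc g.t T) :
    fracInt α g.t (fun ξ => f ξ (x ξ)) s =
      f g.t (g.w g.t) * fracInt α g.t (fun _ => 1) s +
        fracInt (α + 1) g.t (chainDeriv T f x v) s := by
  have htT := g.t_mem.2.le
  have hxc : ContinuousOn x (Icc g.t T) :=
    (continuousOn_const.add (hv.continuousOn_primitive hα0 htT)).congr hx
  have hW := wCont_chainDeriv hα1 hT hf hxc hv
  have h1 : WCont 1 g.t T fun _ => f g.t (g.w g.t) * 1 :=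
    WCont.of_continuousOn_Icc le_rfl continuousOn_const
  have h2 : WCont 1 g.t T (fracInt 1 g.t (chainDeriv T f x v)) := by
    refine WCont.of_continuousOn_Icc le_rfl ?_
    simp_rw [funext (fracInt_one g.t (chainDeriv T f x v))]
    exact hW.continuousOn_primitive hα0 htT
  rw [← fracInt_const_mul, ← fracInt_fracInt hα0 one_pos (by linarith) hs.1
    (hW.intervalIntegrable hα0 hs), ← fracInt_add (h1.intervalIntegrable_kernel hα0 one_pos hs)
    (h2.intervalIntegrable_kernel hα0 one_pos hs)]
  refine fracInt_congr hs.1 fun ξ hξ => ?_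
  rw [f_along_eq_integral hα0 hα1 hT hf hv hx ⟨hξ.1.le, hξ.2.le.trans hs.2⟩, fracInt_one, mul_one]

/-- One Picard step for the derivative. -/
def picardDeriv (T : ℝ) (f : ℝ → ℝ → ℝ) (g : InitialData α T) (x v : ℝ → ℝ) (s : ℝ) : ℝ :=
  dmemory g s + f g.t (g.w g.t) * qBar g s + fracInt α g.t (chainDeriv T f x v) s

/-- One Picard step. -/
def picard (f : ℝ → ℝ → ℝ) (g : InitialData α T) (x : ℝ → ℝ) (s : ℝ) : ℝ :=
  memory g s + fracInt α g.t (fun ξ => f ξ (x ξ)) s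

theorem wCont_picardDeriv (hα0 : 0 < α) (hα1 : α < 1) (hT : 0 < T)
    (hf : ContDiffOn ℝ 1 (fun z : ℝ × ℝ => f z.1 z.2) (Icc 0 T ×ˢ univ)) {v : ℝ → ℝ}
    (hx : ContinuousOn x (Icc g.t T)) (hv : WCont α g.t T v) :
    WCont α g.t T (picardDeriv T f g x v) :=
  ((wCont_dmemory hα0 hα1 g).add ((wCont_qBar g).const_mul _)).add
    ((wCont_chainDeriv hα1 hT hf hx hv).fracInt hα0 hα0 hα1.le)

/-- `I^1 I^α` and `I^α I^1` coincide, so integrating the differentiated equation reproduces the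
Picard step; the primitive of `qBar` supplies the boundary term `f(t, w(t)) I^α 1`. -/
theorem picard_eq_integral (hα0 : 0 < α) (hα1 : α < 1) (hT : 0 < T)
    (hf : ContDiffOn ℝ 1 (fun z : ℝ × ℝ => f z.1 z.2) (Icc 0 T ×ˢ univ)) {v : ℝ → ℝ}
    (hv : WCont α g.t T v)
    (hx : ∀ s ∈ Icc g.t T, x s = g.w g.t + ∫ ξ in g.t..s, v ξ) {s : ℝ} (hs : s ∈ Icc g.t T) :
    picard f g x s = g.w g.t + ∫ ξ in g.t..s, picardDeriv T f g x v ξ := by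
  have htT := g.t_mem.2.le
  have hxc : ContinuousOn x (Icc g.t T) :=
    (continuousOn_const.add (hv.continuousOn_primitive hα0 htT)).congr hx
  have hW := wCont_chainDeriv hα1 hT hf hxc hv
  have i1 := (wCont_dmemory hα0 hα1 g).intervalIntegrable hα0 hs
  have i2 := ((wCont_qBar g).const_mul (f g.t (g.w g.t))).intervalIntegrable hα0 hs
  have i3 := (hW.fracInt hα0 hα0 hα1.le).intervalIntegrable hα0 hs
  simp only [picardDeriv]
  rw [intervalIntegral.integral_add (i1.add i2) i3, intervalIntegral.integral_add i1 i2,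
    intervalIntegral.integral_const_mul, integral_qBar hα0 g hs.1, picard,
    memory_eq_integral hα0 hα1 g hs.1, fracInt_f_along hα0 hα1 hT hf hv hx hs,
    ← fracInt_one g.t (fracInt α g.t (chainDeriv T f x v)),
    fracInt_fracInt one_pos hα0 (by linarith) hs.1 (hW.intervalIntegrable hα0 hs), add_comm α 1]
  ring

/-- The Picard iterates, together with their derivatives. -/
def picardSeq (T : ℝ) (f : ℝ → ℝ → ℝ) (g : InitialData α T) : ℕ → (ℝ → ℝ) × (ℝ → ℝ)
  | 0 => (fun _ => g.w g.t, fun _ => 0)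
  | n + 1 => (picard f g (picardSeq T f g n).1,
      picardDeriv T f g (picardSeq T f g n).1 (picardSeq T f g n).2)

theorem picardSeq_spec (hα0 : 0 < α) (hα1 : α < 1) (hT : 0 < T)
    (hf : ContDiffOn ℝ 1 (fun z : ℝ × ℝ => f z.1 z.2) (Icc 0 T ×ˢ univ)) (n : ℕ) :
    WCont α g.t T (picardSeq T f g n).2 ∧
      (∀ s ∈ Icc g.t T, (picardSeq T f g n).1 s =
        g.w g.t + ∫ ξ in g.t..s, (picardSeq T f g n).2 ξ) ∧
      ContinuousOn (picardSeq T f g n).1 (Icc g.t T) := by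
  have htT := g.t_mem.2.le
  induction n with
  | zero =>
    exact ⟨WCont.of_continuousOn_Icc hα1.le continuousOn_const, fun s _ => by simp [picardSeq],
      continuousOn_const⟩
  | succ n ih =>
    have h1 : WCont α g.t T (picardSeq T f g (n + 1)).2 :=
      wCont_picardDeriv hα0 hα1 hT hf ih.2.2 ih.1
    have h2 : ∀ s ∈ Icc g.t T, (picardSeq T f g (n + 1)).1 s =
        g.w g.t + ∫ ξ in g.t..s, (picardSeq T f g (n + 1)).2 ξ := fun s hs =>
      picard_eq_integral hα0 hα1 hT hf ih.1 ih.2.1 hs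
    exact ⟨h1, h2, (continuousOn_const.add (h1.continuousOn_primitive hα0 htT)).congr h2⟩

/-- The iteration uses `f` without truncation, so linear growth must first confine all iterates to
one compact range before Lipschitz bounds can be used. -/
theorem exists_picardSeq_bound (hα0 : 0 < α) (hα1 : α < 1) (hT : 0 < T)
    (hf : ContDiffOn ℝ 1 (fun z : ℝ × ℝ => f z.1 z.2) (Icc 0 T ×ˢ univ))
    (hgrowth : ∃ γ : ℝ, 0 ≤ γ ∧ ∀ τ ∈ Icc 0 T, ∀ x : ℝ, |f τ x| ≤ γ * (1 + |x|))
    (g : InitialData α T) :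
    ∃ R, ∀ n, ∀ s ∈ Ioc g.t T, |(picardSeq T f g n).1 s| ≤ R := by
  obtain ⟨γ, hγ, hg⟩ := hgrowth
  obtain ⟨M, hM⟩ := isCompact_Icc.exists_bound_of_continuousOn (continuousOn_memory hα0 hα1 g)
  have h1W : WCont 1 g.t T fun _ => (1 : ℝ) :=
    WCont.of_continuousOn_Icc le_rfl continuousOn_const
  obtain ⟨C, hC⟩ := (h1W.fracInt hα0 one_pos le_rfl).2
  simp only [sub_self, Real.rpow_zero, mul_one] at hC
  refine exists_uniform_bound (a := α) (K := γ) (M := M + γ * C) hα0 hα1.le hγ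
    ⟨|g.w g.t|, fun s _ => le_rfl⟩ fun n s hs => ?_
  obtain ⟨-, -, hcn⟩ := picardSeq_spec hα0 hα1 hT hf (g := g) n
  set z := (picardSeq T f g n).1
  have hs' := Ioc_subset_Icc_self hs
  have hzW : WCont 1 g.t T fun ξ => |z ξ| := WCont.of_continuousOn_Icc le_rfl hcn.abs
  change |memory g s + fracInt α g.t (fun ξ => f ξ (z ξ)) s| ≤ _
  have h2 : |fracInt α g.t (fun ξ => f ξ (z ξ)) s| ≤
      fracInt α g.t (fun ξ => γ * (1 + |z ξ|)) s :=
    abs_fracInt_le hα0 hs.1.le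
      (((h1W.add hzW).const_mul γ).intervalIntegrable_kernel hα0 one_pos hs')
      (ae_Ioc_of_forall_Ioo fun ξ hξ => hg ξ (g.Ioc_subset ⟨hξ.1, hξ.2.le.trans hs.2⟩) _)
  rw [fracInt_const_mul, fracInt_add (h1W.intervalIntegrable_kernel hα0 one_pos hs')
    (hzW.intervalIntegrable_kernel hα0 one_pos hs')] at h2
  have h3 := mul_le_mul_of_nonneg_left ((le_abs_self _).trans (hC s hs)) hγ
  have h4 := mul_le_mul_of_nonneg_left (le_abs_self (fracInt α g.t (fun ξ => |z ξ|) s)) hγ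
  have h5 : |memory g s| ≤ M := hM s hs'
  refine (abs_add_le _ _).trans ?_
  rw [mul_add] at h2
  linarith

/-- The solution of the Cauchy problem is the primitive of a weighted continuous function `v`
satisfying the formally differentiated equation. -/
theorem IsCauchySolution.exists_deriv (hα0 : 0 < α) (hα1 : α < 1) (hT : 0 < T)
    (hf : ContDiffOn ℝ 1 (fun z : ℝ × ℝ => f z.1 z.2) (Icc 0 T ×ˢ univ))
    (hgrowth : ∃ γ : ℝ, 0 ≤ γ ∧ ∀ τ ∈ Icc 0 T, ∀ x : ℝ, |f τ x| ≤ γ * (1 + |x|))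
    (hx : IsCauchySolution α T f g x) :
    ∃ v, WCont α g.t T v ∧ (∀ s ∈ Icc g.t T, x s = g.w g.t + ∫ ξ in g.t..s, v ξ) ∧
      ∀ s ∈ Ioc g.t T, v s = picardDeriv T f g x v s := by
  have htT := g.t_mem.2.le
  have hxc := (hx.continuousOn hα0 hα1 hT).mono g.Icc_subset
  obtain ⟨R1, hR1⟩ := isCompact_Icc.exists_bound_of_continuousOn hxc
  obtain ⟨R2, hR2⟩ := exists_picardSeq_bound hα0 hα1 hT hf hgrowth g
  set R := max R1 R2
  set X : ℕ → ℝ → ℝ := fun n => (picardSeq T f g n).1 with hX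
  set V : ℕ → ℝ → ℝ := fun n => (picardSeq T f g n).2 with hV
  have bx : ∀ s ∈ Ioc g.t T, |x s| ≤ R := fun s hs =>
    (hR1 s (Ioc_subset_Icc_self hs)).trans (le_max_left _ _)
  have bX : ∀ n, ∀ s ∈ Ioc g.t T, |X n s| ≤ R := fun n s hs => (hR2 n s hs).trans (le_max_right _ _)
  have spec := fun n => picardSeq_spec hα0 hα1 hT hf (g := g) n
  obtain ⟨L, hL, HL⟩ := exists_lipschitz_strip hT hf R
  obtain ⟨A, hA, HA⟩ := exists_bound_strip (continuousOn_strip_snd hT hf) R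
  have hft := continuousOn_along (continuousOn_strip_fst hT hf) g.Icc_subset hxc
  have hfx := continuousOn_along (continuousOn_strip_snd hT hf) g.Icc_subset hxc
  -- The candidate derivative solves a linear equation with coefficients frozen along the solution
  -- `x` already known; that it is the derivative is proved afterwards.
  obtain ⟨v, hvW, hv⟩ := exists_volterra_solution (c := g.t) (d := T) (K := A)
    (N := fun ξ y => derivWithin (fun r => f r (x ξ)) (Icc 0 T) ξ +
      deriv (fun y => f ξ y) (x ξ) * y)
    (h := fun s => dmemory g s + f g.t (g.w g.t) * qBar g s) hα0 hα1.le hA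
    (fun ξ hξ y y' => by
      rw [add_sub_add_left_eq_sub, ← mul_sub, abs_mul]
      exact mul_le_mul_of_nonneg_right (HA ξ (g.Ioc_subset hξ) _ (bx ξ hξ)) (abs_nonneg _))
    (fun z hz => wCont_chainDeriv hα1 hT hf hxc hz)
    ((wCont_dmemory hα0 hα1 g).add ((wCont_qBar g).const_mul _))
  have hWx : WCont 1 g.t T fun ξ => f ξ (x ξ) :=
    WCont.of_continuousOn_Icc le_rfl (continuousOn_f_along hf hxc)
  have hWX : ∀ n, WCont 1 g.t T fun ξ => f ξ (X n ξ) := fun n =>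
    WCont.of_continuousOn_Icc le_rfl (continuousOn_f_along hf (spec n).2.2)
  have dX : ∀ n, WCont 1 g.t T fun s => X n s - x s := fun n =>
    WCont.of_continuousOn_Icc le_rfl ((spec n).2.2.sub hxc)
  have convX : ∀ ε > 0, ∃ n₀, ∀ n ≥ n₀, ∀ s ∈ Ioc g.t T, |X n s - x s| ≤ ε := by
    have := tendsto_zero_of_volterra_ineq (z := fun n s => X n s - x s) (c := g.t) (d := T)
      hα0 hα1.le one_pos (Or.inr rfl) hL (fun n => (dX n).2) fun ε hε => ⟨0, fun n _ s hs => ?_⟩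
    · simpa using this
    have hs' := Ioc_subset_Icc_self hs
    have e : X (n + 1) s - x s = fracInt α g.t (fun ξ => f ξ (X n ξ) - f ξ (x ξ)) s := by
      rw [hx.eq_volterra hα0 hα1 hs',
        fracInt_sub ((hWX n).intervalIntegrable_kernel hα0 one_pos hs')
        (hWx.intervalIntegrable_kernel hα0 one_pos hs')]
      exact add_sub_add_left_eq_sub _ _ _
    have h1 : |fracInt α g.t (fun ξ => f ξ (X n ξ) - f ξ (x ξ)) s| ≤
        fracInt α g.t (fun ξ => L * |X n ξ - x ξ|) s := by
      refine abs_fracInt_le hα0 hs.1.le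
        (((dX n).abs.const_mul L).intervalIntegrable_kernel hα0 one_pos hs')
        (ae_Ioc_of_forall_Ioo fun ξ hξ => ?_)
      have hξ' : ξ ∈ Ioc g.t T := ⟨hξ.1, hξ.2.le.trans hs.2⟩
      exact HL ξ (g.Ioc_subset hξ') _ _ (bx ξ hξ') (bX n ξ hξ')
    rw [fracInt_const_mul] at h1
    simp only [sub_self, Real.rpow_zero, mul_one]
    rw [e]
    have h2 := mul_le_mul_of_nonneg_left
      (le_abs_self (fracInt α g.t (fun ξ => |X n ξ - x ξ|) s)) hL
    linarith
  have h1v : WCont α g.t T fun s => 1 + |v s| :=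
    (WCont.of_continuousOn_Icc hα1.le continuousOn_const).add hvW.abs
  obtain ⟨D, hD⟩ := (h1v.fracInt (a := α) hα0 hα0 hα1.le).2
  -- Uniform convergence of the iterates gives uniform convergence of both partial derivatives along
  -- them; the rest is a linear Volterra inequality in the weighted norm.
  have convV : ∀ ε > 0, ∃ n₀, ∀ n ≥ n₀, ∀ s ∈ Ioc g.t T,
      |V n s - v s| ≤ ε * (s - g.t) ^ (α - 1) := by
    refine tendsto_zero_of_volterra_ineq (z := fun n s => V n s - v s)
      hα0 hα1.le hα0 (Or.inl le_rfl) hA (fun n => ((spec n).1.sub hvW).2) fun ε hε => ?_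
    set η := ε / (|D| + 1)
    have hη : 0 < η := by positivity
    obtain ⟨δ1, hδ1, M1⟩ := exists_modulus_strip (continuousOn_strip_fst hT hf) R hη
    obtain ⟨δ2, hδ2, M2⟩ := exists_modulus_strip (continuousOn_strip_snd hT hf) R hη
    obtain ⟨n₀, hn₀⟩ := convX (min δ1 δ2) (lt_min hδ1 hδ2)
    refine ⟨n₀, fun n hn s hs => ?_⟩
    have hs' := Ioc_subset_Icc_self hs
    have dV := (spec n).1.sub hvW
    have e : V (n + 1) s - v s =
        fracInt α g.t (fun ξ => chainDeriv T f (X n) (V n) ξ - chainDeriv T f x v ξ) s := by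
      rw [hv s hs, fracInt_sub
        ((wCont_chainDeriv hα1 hT hf (spec n).2.2 (spec n).1).intervalIntegrable_kernel hα0 hα0 hs')
        ((wCont_chainDeriv hα1 hT hf hxc hvW).intervalIntegrable_kernel hα0 hα0 hs')]
      exact add_sub_add_left_eq_sub _ _ _
    have h1 : |fracInt α g.t (fun ξ => chainDeriv T f (X n) (V n) ξ - chainDeriv T f x v ξ) s| ≤
        fracInt α g.t (fun ξ => η * (1 + |v ξ|) + A * |V n ξ - v ξ|) s := by
      refine abs_fracInt_le hα0 hs.1.le
        (((h1v.const_mul η).add (dV.abs.const_mul A)).intervalIntegrable_kernel hα0 hα0 hs')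
        (ae_Ioc_of_forall_Ioo fun ξ hξ => ?_)
      have hξ' : ξ ∈ Ioc g.t T := ⟨hξ.1, hξ.2.le.trans hs.2⟩
      have hξ0 := g.Ioc_subset hξ'
      have c0 := hn₀ n hn ξ hξ'
      have c1 := M1 ξ hξ0 _ _ (bx ξ hξ') (bX n ξ hξ') (c0.trans (min_le_left _ _))
      have c2 := M2 ξ hξ0 _ _ (bx ξ hξ') (bX n ξ hξ') (c0.trans (min_le_right _ _))
      have c3 := HA ξ hξ0 _ (bX n ξ hξ')
      simp only at c1 c2 c3
      -- The change of coefficient is paired with the fixed `v`, not with `V n`, so that the small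
      -- term needs no bound on the derivatives uniform in `n`.
      have e2 : chainDeriv T f (X n) (V n) ξ - chainDeriv T f x v ξ =
        (derivWithin (fun r => f r (X n ξ)) (Icc 0 T) ξ -
          derivWithin (fun r => f r (x ξ)) (Icc 0 T) ξ) +
        (deriv (fun y => f ξ y) (X n ξ) - deriv (fun y => f ξ y) (x ξ)) * v ξ +
        deriv (fun y => f ξ y) (X n ξ) * (V n ξ - v ξ) := by
        simp only [chainDeriv]; ring
      rw [e2]
      refine (abs_add_three _ _ _).trans ?_
      rw [abs_mul, abs_mul]
      have c4 := mul_le_mul_of_nonneg_right c2 (abs_nonneg (v ξ))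
      have c5 := mul_le_mul_of_nonneg_right c3 (abs_nonneg (V n ξ - v ξ))
      rw [mul_add, mul_one]
      linarith
    rw [fracInt_add ((h1v.const_mul η).intervalIntegrable_kernel hα0 hα0 hs')
      ((dV.abs.const_mul A).intervalIntegrable_kernel hα0 hα0 hs'),
      fracInt_const_mul, fracInt_const_mul] at h1
    rw [e]
    have h2 := mul_le_mul_of_nonneg_left
      (le_abs_self (fracInt α g.t (fun ξ => |V n ξ - v ξ|) s)) hA
    have hr := Real.rpow_nonneg (sub_pos.2 hs.1).le (α - 1)
    have h3 : η * fracInt α g.t (fun ξ => 1 + |v ξ|) s ≤ ε * (s - g.t) ^ (α - 1) := by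
      calc _ ≤ η * (D * (s - g.t) ^ (α - 1)) :=
            mul_le_mul_of_nonneg_left ((le_abs_self _).trans (hD s hs)) hη.le
        _ ≤ η * ((|D| + 1) * (s - g.t) ^ (α - 1)) := by
            refine mul_le_mul_of_nonneg_left (mul_le_mul_of_nonneg_right ?_ hr) hη.le
            linarith [le_abs_self D]
        _ = _ := by simp only [η]; field_simp
    linarith
  refine ⟨v, hvW, fun s hs => ?_, hv⟩
  rcases hs.1.eq_or_lt with h | h
  · rw [← h, intervalIntegral.integral_same, add_zero, hx.2.1 g.t ⟨g.t_mem.1, le_rfl⟩]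
  have hs' : s ∈ Ioc g.t T := ⟨h, hs.2⟩
  set Q := Real.Gamma α / Real.Gamma (α + 1) * (s - g.t) ^ (α + 1 - 1)
  -- The integral relation passes to the limit: weighted convergence of `V n` implies convergence of
  -- the integrals because the weight is integrable.
  refine eq_of_forall_dist_le fun ε hε => ?_
  obtain ⟨n1, hn1⟩ := convX (ε / 2) (by positivity)
  obtain ⟨n2, hn2⟩ := convV (ε / 2 / (|Q| + 1)) (by positivity)
  set n := max n1 n2
  have h1 := hn1 n (le_max_left _ _) s hs'
  have h2 : |fracInt 1 g.t (fun ξ => V n ξ - v ξ) s| ≤ ε / 2 := by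
    refine (abs_fracInt_le_rpow one_pos hα0 h (C := ε / 2 / (|Q| + 1))
      (ae_Ioc_of_forall_Ioo fun ξ hξ =>
        hn2 n (le_max_right _ _) ξ ⟨hξ.1, hξ.2.le.trans hs.2⟩)).trans ?_
    rw [mul_assoc, div_mul_eq_mul_div, div_le_iff₀ (by positivity)]
    refine mul_le_mul_of_nonneg_left ?_ (by positivity)
    change Q ≤ _
    linarith [le_abs_self Q]
  rw [fracInt_one, intervalIntegral.integral_sub ((spec n).1.intervalIntegrable hα0 hs)
    (hvW.intervalIntegrable hα0 hs)] at h2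
  have h3 : X n s = g.w g.t + ∫ ξ in g.t..s, V n ξ := (spec n).2.1 s hs
  rw [h3] at h1
  rw [Real.dist_eq]
  rw [abs_le] at h1 h2 ⊢
  constructor <;> linarith [h1.1, h1.2, h2.1, h2.2]

end Regularity

/-! ### The linear equations for `p` and `q` and the relation between them. -/

section LinearEquations

variable {α T : ℝ} {f : ℝ → ℝ → ℝ} {g : InitialData α T} {x : ℝ → ℝ}

theorem isWeightedContinuous_iff {t : ℝ} {p : ℝ → ℝ} :
    IsWeightedContinuous α t T p ↔ WCont α t T p := by
  have key : ∀ s ∈ Ioc t T, ∀ C, |(s - t) ^ (1 - α) * p s| ≤ C ↔ |p s| ≤ C * (s - t) ^ (α - 1) := by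
    intro s hs C
    have h0 : 0 < s - t := sub_pos.2 hs.1
    have h1 := Real.rpow_pos_of_pos h0 (1 - α)
    rw [abs_mul, abs_of_pos h1, ← div_rpow_one_sub h0.le, le_div_iff₀ h1, mul_comm]
  constructor
  · rintro ⟨h, C, hC⟩
    exact ⟨h, C, fun s hs => (key s hs C).1 (hC s hs)⟩
  · rintro ⟨h, C, hC⟩
    exact ⟨h, C, fun s hs => (key s hs C).2 (hC s hs)⟩

/-- Uniqueness for linear Volterra equations. -/
theorem linear_volterra_unique {c d A : ℝ} {h a b z z' : ℝ → ℝ} (hα0 : 0 < α) (hα1 : α ≤ 1)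
    (hac : ContinuousOn a (Ioc c d)) (hA : ∀ s ∈ Ioc c d, |a s| ≤ A) (hb : WCont α c d b)
    (hz : WCont α c d z) (hz' : WCont α c d z')
    (ez : ∀ s ∈ Ioc c d, z s = h s + fracInt α c (fun ξ => a ξ * z ξ + b ξ) s)
    (ez' : ∀ s ∈ Ioc c d, z' s = h s + fracInt α c (fun ξ => a ξ * z' ξ + b ξ) s) :
    EqOn z' z (Ioc c d) := by
  intro s hs
  have hA0 : 0 ≤ A := (abs_nonneg _).trans (hA s hs)
  obtain ⟨B, hB, H⟩ := fractional_gronwall hα0 hα1 hα0 (Or.inl le_rfl) (d - c) A hA0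
  have key := H c d 0 (fun s => z' s - z s) (by linarith) le_rfl (hz'.sub hz).2 (fun s hs => by
    have hs' := Ioc_subset_Icc_self hs
    rw [ez s hs, ez' s hs, add_sub_add_left_eq_sub,
      ← fracInt_sub (((hz'.mul_left hac hA).add hb).intervalIntegrable_kernel hα0 hα0 hs')
        (((hz.mul_left hac hA).add hb).intervalIntegrable_kernel hα0 hα0 hs'), zero_mul, zero_add,
      ← fracInt_const_mul]
    refine abs_fracInt_le hα0 hs.1.le
      (((hz'.sub hz).abs.const_mul A).intervalIntegrable_kernel hα0 hα0 hs')
      (ae_Ioc_of_forall_Ioo fun ξ hξ => ?_)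
    rw [add_sub_add_right_eq_sub, ← mul_sub, abs_mul]
    exact mul_le_mul_of_nonneg_right (hA ξ ⟨hξ.1, hξ.2.le.trans hs.2⟩) (abs_nonneg _)) s hs
  rw [mul_zero, zero_mul] at key
  exact sub_eq_zero.1 (abs_nonpos_iff.1 key)

/-- Write `T - s = (T - ξ) - (s - ξ)` under the integral: the factor `s - ξ` raises the kernel to
order `α + 1`, and `Γ(α + 1) = α Γ(α)` gives the coefficient `α`. -/
theorem sub_mul_fracInt {c s : ℝ} {φ : ℝ → ℝ} (hα0 : 0 < α) (hφ : WCont α c T φ)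
    (hs : s ∈ Icc c T) :
    (T - s) * fracInt α c φ s =
      fracInt α c (fun ξ => (T - ξ) * φ ξ) s - α * fracInt (α + 1) c φ s := by
  have hΓ := (Real.Gamma_pos_of_pos hα0).ne'
  have hW : WCont α c T fun ξ => (T - ξ) * φ ξ := by
    refine hφ.mul_left (M := T - c) (by fun_prop) fun ξ hξ => ?_
    rw [abs_of_nonneg (sub_nonneg.2 hξ.2)]
    linarith [hξ.1]
  have e : α * fracInt (α + 1) c φ s = fracInt α c (fun ξ => (T - ξ) * φ ξ - (T - s) * φ ξ) s := by
    rw [fracInt, fracInt, Real.Gamma_add_one hα0.ne', ← mul_assoc]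
    congr 1
    · field_simp
    · refine intervalIntegral.integral_congr_ae ?_
      have : ∀ᵐ ξ : ℝ, ξ ≠ s := by simp [ae_iff, measure_singleton]
      filter_upwards [this] with ξ h1 h2
      rw [uIoc_of_le hs.1] at h2
      have h3 : 0 < s - ξ := sub_pos.2 (lt_of_le_of_ne h2.2 h1)
      rw [div_rpow_one_sub h3.le, div_rpow_one_sub h3.le, add_sub_cancel_right,
        Real.rpow_sub_one h3.ne']
      field_simp
      ring
  rw [e, fracInt_sub (hW.intervalIntegrable_kernel hα0 hα0 hs)
    ((hφ.const_mul (T - s)).intervalIntegrable_kernel hα0 hα0 hs), fracInt_const_mul]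
  ring

theorem coeffA_continuousOn (hT : 0 < T)
    (hf : ContDiffOn ℝ 1 (fun z : ℝ × ℝ => f z.1 z.2) (Icc 0 T ×ˢ univ))
    (hx : ContinuousOn x (Icc 0 T)) : ContinuousOn (coeffA f x) (Icc 0 T) :=
  continuousOn_along (continuousOn_strip_snd hT hf) le_rfl hx

theorem coeffB_continuousOn (hT : 0 < T)
    (hf : ContDiffOn ℝ 1 (fun z : ℝ × ℝ => f z.1 z.2) (Icc 0 T ×ˢ univ))
    (hx : ContinuousOn x (Icc 0 T)) (t : ℝ) : ContinuousOn (coeffB α T t f x) (Icc 0 T) := by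
  have h1 := continuousOn_along (continuousOn_strip_fst hT hf) le_rfl hx
  have h2 := continuousOn_along (h := fun z : ℝ × ℝ => f z.1 z.2) hf.continuousOn le_rfl hx
  exact (ContinuousOn.mul (by fun_prop) h1).sub ((continuousOn_const.mul h2).div_const _)

/-- The derivative of `x`, multiplied by the linear weight vanishing at `T`, solves the Volterra
equation with free term `pBar + f(t, w(t)) qBar`. -/
theorem IsCauchySolution.exists_weighted_deriv (hα0 : 0 < α) (hα1 : α < 1) (hT : 0 < T)
    (hf : ContDiffOn ℝ 1 (fun z : ℝ × ℝ => f z.1 z.2) (Icc 0 T ×ˢ univ))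
    (hgrowth : ∃ γ : ℝ, 0 ≤ γ ∧ ∀ τ ∈ Icc 0 T, ∀ x : ℝ, |f τ x| ≤ γ * (1 + |x|))
    (hx : IsCauchySolution α T f g x) :
    ∃ u, WCont α g.t T u ∧ u T = 0 ∧ ∀ s ∈ Ioc g.t T,
      u s = pBar g s + f g.t (g.w g.t) * qBar g s +
        fracInt α g.t (fun ξ => coeffA f x ξ * u ξ + coeffB α T g.t f x ξ) s := by
  obtain ⟨v, hvW, hxv, hv⟩ := hx.exists_deriv hα0 hα1 hT hf hgrowth
  have htT : 0 < T - g.t := sub_pos.2 g.t_mem.2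
  have hΓ := (Real.Gamma_pos_of_pos hα0).ne'
  have hxc := (hx.continuousOn hα0 hα1 hT).mono g.Icc_subset
  refine ⟨fun s => (T - s) / (T - g.t) * v s, ?_, by simp, fun s hs => ?_⟩
  · refine hvW.mul_left (M := 1) (by fun_prop) fun s hs => ?_
    rw [abs_of_nonneg (div_nonneg (sub_nonneg.2 hs.2) htT.le), div_le_one htT]
    linarith [hs.1]
  have hs' := Ioc_subset_Icc_self hs
  have hφ := wCont_chainDeriv hα1 hT hf hxc hvW
  have hF : WCont α g.t T fun ξ => α * f ξ (x ξ) :=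
    (WCont.of_continuousOn_Icc hα1.le (continuousOn_f_along hf hxc)).const_mul α
  have hTφ : WCont α g.t T fun ξ => (T - ξ) * chainDeriv T f x v ξ := by
    refine hφ.mul_left (M := T - g.t) (by fun_prop) fun ξ hξ => ?_
    rw [abs_of_nonneg (sub_nonneg.2 hξ.2)]
    linarith [hξ.1]
  have e1 := sub_mul_fracInt hα0 hφ hs'
  have e2 := fracInt_f_along hα0 hα1 hT hf hvW hxv hs'
  have e3 : α * fracInt α g.t (fun _ => (1 : ℝ)) s = (s - g.t) * qBar g s := by
    rw [fracInt_one_eq hα0 hs.1.le, qBar_eq hs.1.le, Real.rpow_sub_one (sub_pos.2 hs.1).ne']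
    have := (sub_pos.2 hs.1).ne'
    field_simp
  have e4 : fracInt α g.t (fun ξ => coeffA f x ξ * ((T - ξ) / (T - g.t) * v ξ) +
      coeffB α T g.t f x ξ) s = 1 / (T - g.t) *
        (fracInt α g.t (fun ξ => (T - ξ) * chainDeriv T f x v ξ) s -
          α * fracInt α g.t (fun ξ => f ξ (x ξ)) s) := by
    rw [← fracInt_const_mul (φ := fun ξ => f ξ (x ξ)),
      ← fracInt_sub (hTφ.intervalIntegrable_kernel hα0 hα0 hs')
      (hF.intervalIntegrable_kernel hα0 hα0 hs'), ← fracInt_const_mul]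
    congr 1
    ext ξ
    simp only [coeffA, coeffB, chainDeriv]
    field_simp
    ring
  have e5 : pBar g s = (T - s) / (T - g.t) * dmemory g s := by
    rw [pBar, dmemory]; ring
  have e6 : v s = dmemory g s + f g.t (g.w g.t) * qBar g s +
      fracInt α g.t (chainDeriv T f x v) s := hv s hs
  simp only
  rw [e4, e5, e6]
  have e7 : (T - s) / (T - g.t) * (dmemory g s + f g.t (g.w g.t) * qBar g s +
      fracInt α g.t (chainDeriv T f x v) s) = (T - s) / (T - g.t) * dmemory g s +
      (T - s) / (T - g.t) * (f g.t (g.w g.t) * qBar g s) +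
      1 / (T - g.t) * ((T - s) * fracInt α g.t (chainDeriv T f x v) s) := by ring
  -- The commutator term is turned back into `I^α f`, which accounts for the term `-α f / (T - t)`
  -- in `b`. Its boundary term carries `(s - t) qBar`, which adds to `(T - s) qBar` to give `(T - t)
  -- qBar`.
  have e8 : α * fracInt (α + 1) g.t (chainDeriv T f x v) s =
      α * fracInt α g.t (fun ξ => f ξ (x ξ)) s -
        f g.t (g.w g.t) * ((s - g.t) * qBar g s) := by
    rw [e2, ← e3]; ring
  rw [e7, e1, e8]
  field_simp
  ring

/-- The equations for `p` and `q` are uniquely solvable, and `p(T) = -f(t, w(t)) q(T)`. -/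
theorem IsCauchySolution.exists_solutionP_solutionQ (hα0 : 0 < α) (hα1 : α < 1) (hT : 0 < T)
    (hf : ContDiffOn ℝ 1 (fun z : ℝ × ℝ => f z.1 z.2) (Icc 0 T ×ˢ univ))
    (hgrowth : ∃ γ : ℝ, 0 ≤ γ ∧ ∀ τ ∈ Icc 0 T, ∀ x : ℝ, |f τ x| ≤ γ * (1 + |x|))
    (hx : IsCauchySolution α T f g x) :
    ∃ p q : ℝ → ℝ,
      (IsSolutionP f g x p ∧ ∀ p', IsSolutionP f g x p' → EqOn p' p (Ioc g.t T)) ∧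
      (IsSolutionQ f g x q ∧ ∀ q', IsSolutionQ f g x q' → EqOn q' q (Ioc g.t T)) ∧
      p T = -f g.t (g.w g.t) * q T := by
  obtain ⟨u, huW, huT, hu⟩ := hx.exists_weighted_deriv hα0 hα1 hT hf hgrowth
  have hxc := hx.continuousOn hα0 hα1 hT
  have hac := coeffA_continuousOn hT hf hxc
  obtain ⟨A, hA⟩ := isCompact_Icc.exists_bound_of_continuousOn hac
  have hA0 : 0 ≤ A := (norm_nonneg _).trans (hA 0 ⟨le_rfl, hT.le⟩)
  have hac' := hac.mono g.Ioc_subset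
  have hA' : ∀ s ∈ Ioc g.t T, |coeffA f x s| ≤ A := fun s hs => hA s (g.Ioc_subset hs)
  have hbW : WCont α g.t T (coeffB α T g.t f x) :=
    WCont.of_continuousOn_Icc hα1.le ((coeffB_continuousOn hT hf hxc g.t).mono g.Icc_subset)
  obtain ⟨q, hqW, hq⟩ := exists_volterra_solution (c := g.t) (d := T) (K := A)
    (N := fun ξ y => coeffA f x ξ * y) (h := qBar g) hα0 hα1.le hA0
    (fun ξ hξ y y' => by
      rw [← mul_sub, abs_mul]
      exact mul_le_mul_of_nonneg_right (hA' ξ hξ) (abs_nonneg _))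
    (fun z hz => hz.mul_left hac' hA') (wCont_qBar g)
  set k := f g.t (g.w g.t)
  -- Subtracting `k q` removes exactly the surplus free term `k qBar` from the equation for `u`;
  -- since `u T = 0`, the value at `T` is read off.
  set p : ℝ → ℝ := fun s => u s - k * q s with hp
  have hpW : WCont α g.t T p := huW.sub (hqW.const_mul k)
  have hpe : ∀ s ∈ Ioc g.t T, p s = pBar g s +
      fracInt α g.t (fun ξ => coeffA f x ξ * p ξ + coeffB α T g.t f x ξ) s := by
    intro s hs
    have hs' := Ioc_subset_Icc_self hs
    have e : fracInt α g.t (fun ξ => coeffA f x ξ * p ξ + coeffB α T g.t f x ξ) s =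
        fracInt α g.t (fun ξ => coeffA f x ξ * u ξ + coeffB α T g.t f x ξ) s -
        k * fracInt α g.t (fun ξ => coeffA f x ξ * q ξ) s := by
      rw [← fracInt_const_mul, ← fracInt_sub
        (((huW.mul_left hac' hA').add hbW).intervalIntegrable_kernel hα0 hα0 hs')
        (((hqW.mul_left hac' hA').const_mul k).intervalIntegrable_kernel hα0 hα0 hs')]
      congr 1
      ext ξ
      simp only [hp]
      ring
    rw [e, hp]
    simp only
    rw [hu s hs, hq s hs]
    ring
  refine ⟨p, q, ⟨⟨isWeightedContinuous_iff.2 hpW, hpe⟩, fun p' hp' => ?_⟩,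
    ⟨⟨isWeightedContinuous_iff.2 hqW, hq⟩, fun q' hq' => ?_⟩, ?_⟩
  · exact linear_volterra_unique hα0 hα1.le hac' hA' hbW hpW (isWeightedContinuous_iff.1 hp'.1)
      hpe hp'.2
  · refine linear_volterra_unique (b := fun _ => 0) (h := qBar g) hα0 hα1.le hac' hA'
      (WCont.of_continuousOn_Icc hα1.le continuousOn_const) hqW (isWeightedContinuous_iff.1 hq'.1)
      ?_ ?_
    · simpa only [add_zero] using hq
    · simp only [add_zero]
      exact hq'.2
  · simp only [hp, huT]
    ring

end LinearEquations

/-! ### First-order response of a Volterra equation to a short perturbation. -/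

theorem abs_integral_kernel_le_mul {a u v s : ℝ} {l k : ℝ → ℝ} (ha1 : a ≤ 1) (huv : u ≤ v)
    (hvs : v < s) (hk : IntervalIntegrable k volume u v)
    (hl : ∀ᵐ ξ ∂(volume.restrict (Ioc u v)), |l ξ| ≤ k ξ) :
    |∫ ξ in u..v, l ξ / (s - ξ) ^ (1 - a)| ≤ (∫ ξ in u..v, k ξ) * (s - v) ^ (a - 1) := by
  rw [← intervalIntegral.integral_mul_const, intervalIntegral.integral_of_le huv,
    intervalIntegral.integral_of_le huv, ← Real.norm_eq_abs]
  refine (norm_integral_le_integral_norm _).trans ?_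
  refine integral_mono_of_nonneg (ae_of_all _ fun _ => norm_nonneg _)
    ((intervalIntegrable_iff_integrableOn_Ioc_of_le huv).1 (hk.mul_const _)) ?_
  filter_upwards [hl, ae_restrict_mem measurableSet_Ioc] with ξ h1 h2
  have h3 : 0 < s - v := sub_pos.2 hvs
  have h4 : s - v ≤ s - ξ := by linarith [h2.2]
  have h5 := Real.rpow_nonneg (h3.le.trans h4) (a - 1)
  rw [div_rpow_one_sub (h3.le.trans h4), norm_mul, Real.norm_eq_abs, Real.norm_eq_abs,
    abs_of_nonneg h5]
  exact mul_le_mul h1 (Real.rpow_le_rpow_of_nonpos h3 h4 (by linarith)) h5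
    ((abs_nonneg _).trans h1)

/-- With `r = δ / y` this is `1 - (1 + r)^(a-1) ≤ r^κ`: trivial for `r ≥ 1`, and for `r ≤ 1` a
consequence of `a - 1 ≥ -1`. It buys a factor `δ^κ` at the price of a singularity worse by `κ`. -/
theorem rpow_sub_rpow_add_le {a κ y δ : ℝ} (ha0 : 0 < a) (hκ : 0 < κ) (hκ1 : κ ≤ 1)
    (hy : 0 < y) (hδ : 0 < δ) :
    y ^ (a - 1) - (y + δ) ^ (a - 1) ≤ δ ^ κ * y ^ (a - κ - 1) := by
  have hya := Real.rpow_pos_of_pos hy (a - 1)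
  have e : δ ^ κ * y ^ (a - κ - 1) = y ^ (a - 1) * (δ / y) ^ κ := by
    rw [Real.div_rpow hδ.le hy.le, show a - κ - 1 = (a - 1) - κ by ring, Real.rpow_sub hy]
    ring
  rw [e]
  have hr : 0 < δ / y := div_pos hδ hy
  have e2 : (y + δ) ^ (a - 1) = y ^ (a - 1) * (1 + δ / y) ^ (a - 1) := by
    rw [← Real.mul_rpow hy.le (by positivity)]
    congr 1
    field_simp
  have h1 : 0 ≤ (1 + δ / y) ^ (a - 1) := by positivity
  rw [e2, ← mul_one_sub]
  refine mul_le_mul_of_nonneg_left ?_ hya.le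
  rcases le_total 1 (δ / y) with h | h
  · have := Real.one_le_rpow h hκ.le
    linarith
  · have h2 : (1 + δ / y) ^ (-1 : ℝ) ≤ (1 + δ / y) ^ (a - 1) :=
      Real.rpow_le_rpow_of_exponent_le (by linarith) (by linarith)
    rw [Real.rpow_neg_one] at h2
    have h3 : 1 - δ / y ≤ (1 + δ / y)⁻¹ := by
      rw [← one_div, le_div_iff₀ (by positivity)]
      nlinarith
    have h4 : δ / y ≤ (δ / y) ^ κ := by
      conv_lhs => rw [← Real.rpow_one (δ / y)]
      exact Real.rpow_le_rpow_of_exponent_ge hr h hκ1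
    linarith

/-- Measures the error of concentrating `l` as a point mass at `u`: it is of order `(v - u)^(1 +
κ)`, hence negligible against `v - u`. -/
theorem abs_integral_kernel_sub_le_mul {a κ u v s M : ℝ} {l : ℝ → ℝ} (ha0 : 0 < a) (ha1 : a ≤ 1)
    (hκ : 0 < κ) (hκ1 : κ ≤ 1) (huv : u < v) (hvs : v < s) (hM : 0 ≤ M)
    (hl : ∀ᵐ ξ ∂(volume.restrict (Ioc u v)), |l ξ| ≤ M) :
    |∫ ξ in u..v, l ξ * ((s - ξ) ^ (a - 1) - (s - u) ^ (a - 1))| ≤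
      M * (v - u) ^ (1 + κ) * (s - v) ^ (a - κ - 1) := by
  have hδ : 0 < v - u := sub_pos.2 huv
  have hy : 0 < s - v := sub_pos.2 hvs
  have h0 : ‖∫ ξ in u..v, l ξ * ((s - ξ) ^ (a - 1) - (s - u) ^ (a - 1))‖ ≤
      (M * ((v - u) ^ κ * (s - v) ^ (a - κ - 1))) * |v - u| := by
    refine intervalIntegral.norm_integral_le_of_norm_le_const_ae ?_
    rw [uIoc_of_le huv.le]
    refine (ae_restrict_iff' measurableSet_Ioc).1 ?_
    filter_upwards [hl, ae_restrict_mem measurableSet_Ioc] with ξ h1 h2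
    have h3 : (s - u) ^ (a - 1) ≤ (s - ξ) ^ (a - 1) :=
      Real.rpow_le_rpow_of_nonpos (by linarith [h2.2]) (by linarith [h2.1]) (by linarith)
    have h4 : (s - ξ) ^ (a - 1) ≤ (s - v) ^ (a - 1) :=
      Real.rpow_le_rpow_of_nonpos hy (by linarith [h2.2]) (by linarith)
    have h5 := rpow_sub_rpow_add_le ha0 hκ hκ1 hy hδ
    rw [sub_add_sub_cancel] at h5
    rw [norm_mul, Real.norm_eq_abs, Real.norm_eq_abs, abs_of_nonneg (sub_nonneg.2 h3)]
    exact mul_le_mul h1 (by linarith) (sub_nonneg.2 h3) hM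
  rw [Real.norm_eq_abs, abs_of_pos hδ] at h0
  refine h0.trans_eq ?_
  rw [Real.rpow_add hδ, Real.rpow_one]
  ring

theorem rpow_le_mul_rpow {b b' y T : ℝ} (hbb : b ≤ b') (hy : 0 < y) (hyT : y ≤ T) :
    y ^ (b' - 1) ≤ T ^ (b' - b) * y ^ (b - 1) := by
  rw [show b' - 1 = (b' - b) + (b - 1) by ring, Real.rpow_add hy]
  exact mul_le_mul_of_nonneg_right (Real.rpow_le_rpow hy.le hyT (by linarith))
    (Real.rpow_nonneg hy.le _)

theorem fracInt_kernel_continuousOn {a c d : ℝ} {φ : ℝ → ℝ} (ha : 0 < a)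
    (hφ : ContinuousOn φ (Icc c d)) {s : ℝ} (hs : s ∈ Icc c d) :
    IntervalIntegrable (fun ξ => φ ξ / (s - ξ) ^ (1 - a)) volume c s :=
  (WCont.of_continuousOn_Icc (b := 1) le_rfl hφ).intervalIntegrable_kernel ha one_pos hs

/-- First-order effect, at the terminal time, of a perturbation `m` acting on `[t, σ]` upon the
solution of a Volterra equation, as `σ → t`. -/
theorem volterra_perturbation {α t T R L Cm : ℝ} {f a : ℝ → ℝ → ℝ} {x q m : ℝ → ℝ}
    {X : ℝ → ℝ → ℝ} (hα0 : 0 < α) (hα1 : α < 1) (htT : t < T)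
    (hfc : ∀ z, ∀ σ ∈ Ioo t T, ContinuousOn z (Icc σ T) →
      ContinuousOn (fun ξ => f ξ (z ξ)) (Icc σ T))
    (hL : 0 ≤ L)
    (hLip : ∀ ξ ∈ Icc t T, ∀ y y', |y| ≤ R → |y'| ≤ R → |f ξ y' - f ξ y| ≤ L * |y' - y|)
    (hlin : ∀ ε > 0, ∃ δ > 0, ∀ ξ ∈ Icc t T, ∀ y y', |y| ≤ R → |y'| ≤ R → |y' - y| ≤ δ →
      |f ξ y' - f ξ y - a ξ y * (y' - y)| ≤ ε * |y' - y|)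
    (hac : ContinuousOn (fun ξ => a ξ (x ξ)) (Icc t T))
    (haL : ∀ ξ ∈ Icc t T, |a ξ (x ξ)| ≤ L)
    (hxc : ContinuousOn x (Icc t T)) (hxR : ∀ ξ ∈ Icc t T, |x ξ| ≤ R)
    (hqW : WCont α t T q)
    (hq : ∀ s ∈ Ioc t T, q s = 1 / Real.Gamma α * (s - t) ^ (α - 1) +
      fracInt α t (fun ξ => a ξ (x ξ) * q ξ) s)
    (hm : AEStronglyMeasurable m (volume.restrict (Ioc t T))) (hCm : 0 ≤ Cm)
    (hmC : ∀ᵐ ξ ∂(volume.restrict (Ioc t T)), |m ξ| ≤ Cm)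
    (hXc : ∀ σ ∈ Ioo t T, ContinuousOn (X σ) (Icc σ T))
    (hXR : ∀ σ ∈ Ioo t T, ∀ ξ ∈ Icc σ T, |X σ ξ| ≤ R)
    (hX : ∀ σ ∈ Ioo t T, ∀ s ∈ Icc σ T, X σ s - x s =
      1 / Real.Gamma α * (∫ ξ in t..σ, m ξ / (s - ξ) ^ (1 - α)) +
        fracInt α σ (fun ξ => f ξ (X σ ξ) - f ξ (x ξ)) s) :
    ∀ ε > 0, ∃ δ > 0, ∀ σ ∈ Ioo t T, σ - t ≤ δ →
      |X σ T - x T - q T * ∫ ξ in t..σ, m ξ| ≤ ε * (σ - t) := by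
  have hΓ := Real.Gamma_pos_of_pos hα0
  have hΓ' := one_div_pos.2 hΓ
  -- Half of the exponent `α` is spent on a gain `(σ - t)^β`; the remaining singularity `(s -
  -- σ)^(β-1)` is still integrable.
  set β := α / 2 with hβ
  have hβ0 : 0 < β := half_pos hα0
  have hr0 : 0 < T - t := sub_pos.2 htT
  obtain ⟨B1, hB1, H1⟩ := fractional_gronwall hα0 hα1.le hα0 (Or.inl le_rfl) (T - t) L hL
  obtain ⟨B2, hB2, H2⟩ := fractional_gronwall hα0 hα1.le one_pos (Or.inr rfl) (T - t) L hL
  obtain ⟨B3, hB3, H3⟩ := fractional_gronwall hα0 hα1.le hβ0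
    (Or.inl (by linarith : β ≤ α)) (T - t) L hL
  obtain ⟨Cq', hCq'⟩ := hqW.2
  set Cq := |Cq'|
  have hCq : ∀ s ∈ Ioc t T, |q s| ≤ Cq * (s - t) ^ (α - 1) := fun s hs =>
    (hCq' s hs).trans (mul_le_mul_of_nonneg_right (le_abs_self _)
      (Real.rpow_nonneg (sub_pos.2 hs.1).le _))
  have hCq0 : 0 ≤ Cq := abs_nonneg _
  set C1 := B1 * (1 / Real.Gamma α * Cm)
  set C2 := B2 * (1 / Real.Gamma α * (Cm / α))
  have hC1 : 0 ≤ C1 := by positivity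
  have hC2 : 0 ≤ C2 := by positivity
  set G := Real.Gamma α / Real.Gamma (α + α)
  have hG : 0 ≤ G := (div_pos hΓ (Real.Gamma_pos_of_pos (by linarith))).le
  set E1 := 1 / Real.Gamma α * Cm
  set E2 := Cm * (1 / Real.Gamma α * (L * Cq / α)) * (T - t) ^ β
  set E3 := C1 * G * (T - t) ^ (α + α - β)
  have hE1 : 0 ≤ E1 := by positivity
  have hE2 : 0 ≤ E2 := by positivity
  have hE3 : 0 ≤ E3 := by positivity
  set W := B3 * ((T - t) / 2) ^ (β - 1)
  have hW : 0 < W := by positivity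
  have main : ∀ η > 0, ∀ δ₀ > 0,
      (∀ ξ ∈ Icc t T, ∀ y y', |y| ≤ R → |y'| ≤ R → |y' - y| ≤ δ₀ →
        |f ξ y' - f ξ y - a ξ y * (y' - y)| ≤ η * |y' - y|) →
      ∀ σ ∈ Ioo t T, σ - t ≤ (T - t) / 2 → C2 * (σ - t) ^ α ≤ δ₀ →
      |X σ T - x T - q T * ∫ ξ in t..σ, m ξ| ≤
        W * (E1 * (σ - t) ^ β + E2 * (σ - t) ^ α + E3 * η) * (σ - t) := by
    intro η hη δ₀ hδ₀ hlin' σ hσ hσh hσδ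
    have hδ : 0 < σ - t := sub_pos.2 hσ.1
    have hsub : Icc σ T ⊆ Icc t T := Icc_subset_Icc_left hσ.1.le
    have hsub' : Icc σ T ⊆ Ioc t T := fun s hs => ⟨hσ.1.trans_le hs.1, hs.2⟩
    have hmσ := ae_mono_Ioc le_rfl hσ.2.le hmC
    have hmm := aestronglyMeasurable_mono_Ioc le_rfl hσ.2.le hm
    have hmi : IntervalIntegrable m volume t σ := by
      simpa using intervalIntegrable_kernel_of_bounded one_pos hσ.1.le le_rfl hmm hmσ
    set μ := ∫ ξ in t..σ, m ξ with hμ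
    have hμC : |μ| ≤ Cm * (σ - t) := by
      have : ‖∫ ξ in t..σ, m ξ‖ ≤ Cm * |σ - t| := by
        refine intervalIntegral.norm_integral_le_of_norm_le_const_ae ?_
        rw [uIoc_of_le hσ.1.le]
        exact (ae_restrict_iff' measurableSet_Ioc).1 hmσ
      rwa [abs_of_pos hδ] at this
    have hxcσ := hxc.mono hsub
    have hacσ := hac.mono hsub
    have hqσ : ContinuousOn q (Icc σ T) := hqW.1.mono hsub'
    have hfX := hfc _ σ hσ (hXc σ hσ)
    have hfx := hfc _ σ hσ hxcσ
    set z : ℝ → ℝ := fun s => X σ s - x s with hz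
    have hzc : ContinuousOn z (Icc σ T) := (hXc σ hσ).sub hxcσ
    set h : ℝ → ℝ := fun s => 1 / Real.Gamma α * ∫ ξ in t..σ, m ξ / (s - ξ) ^ (1 - α) with hh
    have hd : T ≤ σ + (T - t) := by linarith [hσ.1]
    have zle : ∀ s ∈ Ioc σ T, |z s| ≤ |h s| + L * fracInt α σ (fun ξ => |z ξ|) s := by
      intro s hs
      have hs' := Ioc_subset_Icc_self hs
      rw [hz]
      simp only
      rw [hX σ hσ s hs']
      refine (abs_add_le _ _).trans (add_le_add le_rfl ?_)
      rw [← fracInt_const_mul]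
      refine abs_fracInt_le hα0 hs.1.le
        (fracInt_kernel_continuousOn hα0 (continuousOn_const.mul hzc.abs) hs')
        (ae_Ioc_of_forall_Ioo fun ξ hξ => ?_)
      have hξ' : ξ ∈ Icc σ T := ⟨hξ.1.le, hξ.2.le.trans hs.2⟩
      exact hLip ξ (hsub hξ') _ _ (hxR ξ (hsub hξ')) (hXR σ hσ ξ hξ')
    -- Two bounds on the deviation are needed: this one has the sharp order `σ - t` but is singular
    -- at `σ`; the next is uniform but only of order `(σ - t)^α`, and serves to enter the range
    -- where the linearization holds.
    have z1 : ∀ s ∈ Ioc σ T, |z s| ≤ C1 * (σ - t) * (s - σ) ^ (α - 1) := by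
      have := H1 σ T (1 / Real.Gamma α * Cm * (σ - t)) z hd (by positivity)
        (WCont.of_continuousOn_Icc hα1.le hzc).2 fun s hs => (zle s hs).trans
          (add_le_add ?_ le_rfl)
      · intro s hs
        refine (this s hs).trans_eq ?_
        simp only [C1]; ring
      · have := abs_integral_kernel_le_mul hα1.le hσ.1.le hs.1 intervalIntegrable_const hmσ
        rw [intervalIntegral.integral_const, smul_eq_mul] at this
        rw [hh]
        simp only
        rw [abs_mul, abs_of_pos hΓ', mul_assoc, mul_assoc]
        refine mul_le_mul_of_nonneg_left (this.trans_eq ?_) hΓ'.le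
        ring
    have z2 : ∀ s ∈ Ioc σ T, |z s| ≤ C2 * (σ - t) ^ α := by
      have := H2 σ T (1 / Real.Gamma α * (Cm / α) * (σ - t) ^ α) z hd (by positivity)
        (WCont.of_continuousOn_Icc le_rfl hzc).2 fun s hs => (zle s hs).trans
          (add_le_add ?_ le_rfl)
      · intro s hs
        refine (this s hs).trans_eq ?_
        rw [sub_self, Real.rpow_zero]
        simp only [C2]; ring
      · have h1 := abs_integral_kernel_le hα0 hσ.1.le hs.1.le hmσ
        have h2 := Real.rpow_add_le_add_rpow (sub_pos.2 hs.1).le hδ.le hα0.le hα1.le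
        rw [sub_add_sub_cancel] at h2
        rw [hh, sub_self, Real.rpow_zero, mul_one]
        simp only
        rw [abs_mul, abs_of_pos hΓ', mul_assoc]
        refine mul_le_mul_of_nonneg_left (h1.trans ?_) hΓ'.le
        rw [div_mul_eq_mul_div, mul_div_assoc]
        refine mul_le_mul_of_nonneg_left ?_ hCm
        exact div_le_div_of_nonneg_right (by linarith) hα0.le
    -- The remainder solves the linearized equation from `σ` on, with three small free terms:
    -- concentrating `m` at `t`, the part of the equation for `q` over `[t, σ]`, and the
    -- linearization error `N`.
    set r : ℝ → ℝ := fun s => z s - μ * q s with hr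
    have hrc : ContinuousOn r (Icc σ T) := hzc.sub (continuousOn_const.mul hqσ)
    set aq : ℝ → ℝ := fun ξ => a ξ (x ξ) * q ξ with haq
    have haqW : WCont α t T aq := hqW.mul_left (hac.mono Ioc_subset_Icc_self)
      fun ξ hξ => haL ξ (Ioc_subset_Icc_self hξ)
    set k : ℝ → ℝ := fun s => 1 / Real.Gamma α * ∫ ξ in t..σ, aq ξ / (s - ξ) ^ (1 - α) with hk
    set N : ℝ → ℝ := fun ξ => f ξ (X σ ξ) - f ξ (x ξ) - a ξ (x ξ) * z ξ with hN
    have hNc : ContinuousOn N (Icc σ T) := (hfX.sub hfx).sub (hacσ.mul hzc)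
    have rrep : ∀ s ∈ Ioc σ T, r s =
        (h s - μ * (1 / Real.Gamma α * (s - t) ^ (α - 1))) - μ * k s + fracInt α σ N s +
          fracInt α σ (fun ξ => a ξ (x ξ) * r ξ) s := by
      intro s hs
      have hs' := Ioc_subset_Icc_self hs
      have i1 : IntervalIntegrable (fun ξ => aq ξ / (s - ξ) ^ (1 - α)) volume t s :=
        haqW.intervalIntegrable_kernel hα0 hα0 (hsub hs')
      have i2 := i1.mono_set (c := t) (d := σ) (by
        rw [uIcc_of_le hσ.1.le, uIcc_of_le (hσ.1.le.trans hs.1.le)]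
        exact Icc_subset_Icc_right hs.1.le)
      have i3 := i1.mono_set (c := σ) (d := s) (by
        rw [uIcc_of_le hs.1.le, uIcc_of_le (hσ.1.le.trans hs.1.le)]
        exact Icc_subset_Icc_left hσ.1.le)
      have e1 : fracInt α t aq s = k s + fracInt α σ aq s := by
        rw [fracInt, ← intervalIntegral.integral_add_adjacent_intervals i2 i3, mul_add]
        rfl
      have e2 : q s = 1 / Real.Gamma α * (s - t) ^ (α - 1) + (k s + fracInt α σ aq s) := by
        rw [hq s (hsub' hs'), ← e1]
      have e3 : z s = h s + fracInt α σ (fun ξ => f ξ (X σ ξ) - f ξ (x ξ)) s := hX σ hσ s hs'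
      have e4 : fracInt α σ (fun ξ => f ξ (X σ ξ) - f ξ (x ξ)) s - μ * fracInt α σ aq s =
          fracInt α σ N s + fracInt α σ (fun ξ => a ξ (x ξ) * r ξ) s := by
        rw [← fracInt_const_mul, ← fracInt_sub
          (φ := fun ξ => f ξ (X σ ξ) - f ξ (x ξ)) (ψ := fun ξ => μ * aq ξ)
          (fracInt_kernel_continuousOn hα0 (hfX.sub hfx) hs')
          (fracInt_kernel_continuousOn hα0 (continuousOn_const.mul (hacσ.mul hqσ)) hs'),
          ← fracInt_add (φ := N) (ψ := fun ξ => a ξ (x ξ) * r ξ)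
            (fracInt_kernel_continuousOn hα0 hNc hs')
          (fracInt_kernel_continuousOn hα0 (hacσ.mul hrc) hs')]
        congr 1
        ext ξ
        simp only [hN, hr, haq]
        ring
      simp only [hr]
      rw [e3, e2]
      linarith
    have t1 : ∀ s ∈ Ioc σ T, |h s - μ * (1 / Real.Gamma α * (s - t) ^ (α - 1))| ≤
        E1 * (σ - t) ^ (1 + β) * (s - σ) ^ (β - 1) := by
      intro s hs
      have i1 := intervalIntegrable_kernel_of_bounded hα0 hσ.1.le hs.1.le hmm hmσ
      have e : h s - μ * (1 / Real.Gamma α * (s - t) ^ (α - 1)) = 1 / Real.Gamma α *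
          ∫ ξ in t..σ, m ξ * ((s - ξ) ^ (α - 1) - (s - t) ^ (α - 1)) := by
        have e' : ∫ ξ in t..σ, m ξ * ((s - ξ) ^ (α - 1) - (s - t) ^ (α - 1)) =
            (∫ ξ in t..σ, m ξ / (s - ξ) ^ (1 - α)) - ∫ ξ in t..σ, m ξ * (s - t) ^ (α - 1) := by
          rw [← intervalIntegral.integral_sub i1 (hmi.mul_const _)]
          refine intervalIntegral.integral_congr fun ξ hξ => ?_
          rw [uIcc_of_le hσ.1.le] at hξ
          rw [div_rpow_one_sub (by linarith [hξ.2, hs.1])]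
          ring
        rw [e', intervalIntegral.integral_mul_const]
        simp only [hh, hμ]
        ring
      have b := abs_integral_kernel_sub_le_mul hα0 hα1.le hβ0 (by linarith) hσ.1 hs.1 hCm hmσ
      rw [show α - β - 1 = β - 1 by rw [hβ]; ring] at b
      rw [e, abs_mul, abs_of_pos hΓ']
      refine (mul_le_mul_of_nonneg_left b hΓ'.le).trans_eq ?_
      simp only [E1]; ring
    have hpow : ∀ s ∈ Ioc σ T, (s - σ) ^ (α - 1) ≤ (T - t) ^ β * (s - σ) ^ (β - 1) := by
      intro s hs
      have := rpow_le_mul_rpow (b := β) (b' := α) (T := T - t) (by linarith) (sub_pos.2 hs.1)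
        (by linarith [hs.2, hσ.1])
      rwa [show α - β = β by rw [hβ]; ring] at this
    have t2 : ∀ s ∈ Ioc σ T, |μ * k s| ≤ E2 * (σ - t) ^ α * (σ - t) * (s - σ) ^ (β - 1) := by
      intro s hs
      have b := abs_integral_kernel_le_mul (l := aq) (k := fun ξ => L * Cq * (ξ - t) ^ (α - 1))
        hα1.le hσ.1.le hs.1 ((intervalIntegrable_sub_left_rpow hα0 t t σ).const_mul _)
        (ae_Ioc_of_forall_Ioo fun ξ hξ => by
          have hξ' : ξ ∈ Ioc t T := ⟨hξ.1, (hξ.2.trans hσ.2).le⟩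
          simp only [haq]
          rw [abs_mul, mul_assoc]
          exact mul_le_mul (haL ξ (Ioc_subset_Icc_self hξ')) (hCq ξ hξ') (abs_nonneg _) hL)
      rw [intervalIntegral.integral_const_mul, integral_sub_left_rpow hα0] at b
      have hδα := Real.rpow_pos_of_pos hδ α
      have hk' : |k s| ≤ 1 / Real.Gamma α * (L * Cq * ((σ - t) ^ α / α) *
          ((T - t) ^ β * (s - σ) ^ (β - 1))) := by
        simp only [hk]
        rw [abs_mul, abs_of_pos hΓ']
        refine mul_le_mul_of_nonneg_left (b.trans ?_) hΓ'.le
        exact mul_le_mul_of_nonneg_left (hpow s hs) (by positivity)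
      rw [abs_mul]
      refine (mul_le_mul hμC hk' (abs_nonneg _) (by positivity)).trans_eq ?_
      simp only [E2]; ring
    have t3 : ∀ s ∈ Ioc σ T, |fracInt α σ N s| ≤ E3 * η * (σ - t) * (s - σ) ^ (β - 1) := by
      intro s hs
      have b := abs_fracInt_le_rpow (φ := N) (C := η * (C1 * (σ - t))) hα0 hα0 hs.1
        (ae_Ioc_of_forall_Ioo fun ξ hξ => by
          have hξ1 : ξ ∈ Ioc σ T := ⟨hξ.1, hξ.2.le.trans hs.2⟩
          have hξ' := Ioc_subset_Icc_self hξ1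
          refine (hlin' ξ (hsub hξ') _ _ (hxR ξ (hsub hξ')) (hXR σ hσ ξ hξ')
            ((z2 ξ hξ1).trans hσδ)).trans ?_
          rw [mul_assoc]
          exact mul_le_mul_of_nonneg_left (z1 ξ hξ1) hη.le)
      have := rpow_le_mul_rpow (b := β) (b' := α + α) (T := T - t) (by linarith) (sub_pos.2 hs.1)
        (by linarith [hs.2, hσ.1])
      refine b.trans ((mul_le_mul_of_nonneg_left this (by positivity)).trans_eq ?_)
      simp only [E3, G]; ring
    set M := E1 * (σ - t) ^ (1 + β) + E2 * (σ - t) ^ α * (σ - t) + E3 * η * (σ - t) with hM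
    have hM0 : 0 ≤ M := by positivity
    have key := H3 σ T M r hd hM0 (WCont.of_continuousOn_Icc (by linarith) hrc).2
      (fun s hs => by
        have hs' := Ioc_subset_Icc_self hs
        have t4 : |fracInt α σ (fun ξ => a ξ (x ξ) * r ξ) s| ≤
            L * fracInt α σ (fun ξ => |r ξ|) s := by
          rw [← fracInt_const_mul]
          refine abs_fracInt_le hα0 hs.1.le
            (fracInt_kernel_continuousOn hα0 (continuousOn_const.mul hrc.abs) hs')
            (ae_Ioc_of_forall_Ioo fun ξ hξ => ?_)
          rw [abs_mul]
          exact mul_le_mul_of_nonneg_right (haL ξ (hsub ⟨hξ.1.le, hξ.2.le.trans hs.2⟩))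
            (abs_nonneg _)
        rw [rrep s hs]
        refine (abs_add_le _ _).trans (add_le_add ?_ t4)
        refine (abs_add_le _ _).trans ?_
        refine (add_le_add (abs_sub _ _) le_rfl).trans ?_
        rw [hM, add_mul, add_mul]
        exact add_le_add (add_le_add (t1 s hs) (t2 s hs)) (t3 s hs)) T ⟨hσ.2, le_rfl⟩
    -- For `σ` in the first half of the interval, the singularity at `σ` is harmless at the terminal
    -- time.
    have hTσ : (T - σ) ^ (β - 1) ≤ ((T - t) / 2) ^ (β - 1) :=
      Real.rpow_le_rpow_of_nonpos (by positivity) (by linarith) (by linarith)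
    have e : X σ T - x T - q T * μ = r T := by
      simp only [hr, hz]; ring
    rw [e]
    refine key.trans ((mul_le_mul_of_nonneg_left hTσ (by positivity)).trans_eq ?_)
    simp only [hM, W]
    rw [Real.rpow_add hδ, Real.rpow_one]
    ring
  intro ε hε
  -- The linearization error does not shrink with `σ - t` by itself, so `η` is fixed first, with `W
  -- * E3 * η ≤ ε / 2`; the powers of `σ - t` use the other half.
  set η := ε / (2 * (W * E3 + 1)) with hη
  have hη0 : 0 < η := by positivity
  obtain ⟨δ₀, hδ₀, hlin'⟩ := hlin η hη0
  have lim1 : Tendsto (fun d : ℝ => W * (E1 * d ^ β + E2 * d ^ α)) (𝓝 0) (𝓝 0) := by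
    have hc : Continuous fun d : ℝ => W * (E1 * d ^ β + E2 * d ^ α) :=
      continuous_const.mul ((continuous_const.mul (continuous_id.rpow_const
        fun _ => Or.inr hβ0.le)).add (continuous_const.mul (continuous_id.rpow_const
        fun _ => Or.inr hα0.le)))
    have := hc.tendsto 0
    simpa [Real.zero_rpow hβ0.ne', Real.zero_rpow hα0.ne'] using this
  have lim2 : Tendsto (fun d : ℝ => C2 * d ^ α) (𝓝 0) (𝓝 0) := by
    have hc : Continuous fun d : ℝ => C2 * d ^ α :=
      continuous_const.mul (continuous_id.rpow_const fun _ => Or.inr hα0.le)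
    have := hc.tendsto 0
    simpa [Real.zero_rpow hα0.ne'] using this
  obtain ⟨δ₁, hδ₁, hball⟩ := Metric.eventually_nhds_iff.1
    ((lim1.eventually_le_const (half_pos hε)).and (lim2.eventually_le_const hδ₀))
  refine ⟨min (δ₁ / 2) ((T - t) / 2), by positivity, fun σ hσ hσδ => ?_⟩
  have hδ : 0 < σ - t := sub_pos.2 hσ.1
  obtain ⟨b1, b2⟩ := hball (y := σ - t) (by
    rw [Real.dist_eq, sub_zero, abs_of_pos hδ]
    linarith [min_le_left (δ₁ / 2) ((T - t) / 2)])
  refine (main η hη0 δ₀ hδ₀ hlin' σ hσ (hσδ.trans (min_le_right _ _)) b2).trans ?_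
  refine mul_le_mul_of_nonneg_right ?_ hδ.le
  have b3 : W * (E3 * η) ≤ ε / 2 := by
    rw [hη, ← mul_assoc, ← mul_div_assoc, div_le_div_iff₀ (by positivity) two_pos]
    nlinarith [mul_nonneg hW.le hE3]
  rw [mul_add]
  linarith

/-! ### The `ci`-derivatives of the terminal value. -/

section CiDerivative

variable {α T : ℝ} {f : ℝ → ℝ → ℝ} {g : InitialData α T} {x y q : ℝ → ℝ}

/-- `ci`-derivatives are uniquely determined. -/
theorem HasCiDerivAt.unique (hα0 : 0 < α) (hα1 : α < 1) {φ : InitialData α T → ℝ} {d e d' e' : ℝ}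
    (h : HasCiDerivAt φ g d e) (h' : HasCiDerivAt φ g d' e') : d = d' ∧ e = e' := by
  have htT := g.t_mem.2
  -- Testing on the extension with constant Caputo derivative `c` after `t`; the values `c = 0` and
  -- `c = 1` determine both coefficients.
  have key : ∀ c : ℝ, d + e * c = d' + e' * c := by
    intro c
    obtain ⟨y, hy, hyw, -, hyc⟩ := exists_extension (g := g) (l := fun _ => c) (C := |c|) hα0 hα1
      aestronglyMeasurable_const (ae_of_all _ fun _ => le_rfl)
    obtain ⟨o, ho, H⟩ := h y hy hyw
    obtain ⟨o', ho', H'⟩ := h' y hy hyw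
    have lim := ho'.sub ho
    rw [sub_zero] at lim
    have hconst : (fun δ => o' δ / δ - o δ / δ) =ᶠ[𝓝[>] 0]
        fun _ => d + e * c - (d' + e' * c) := by
      filter_upwards [Ioo_mem_nhdsGT (sub_pos.2 htT)] with δ hδ
      have hτ : g.t + δ ∈ Ioo g.t T := ⟨by linarith [hδ.1], by linarith [hδ.2]⟩
      have e1 := H _ hτ
      have e2 := H' _ hτ
      have e3 : ∫ ξ in g.t..(g.t + δ), caputoDeriv α y ξ = c * δ := by
        rw [intervalIntegral.integral_of_le hτ.1.le,
          integral_congr_ae (ae_mono_Ioc le_rfl hτ.2.le hyc)]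
        simp [hδ.1.le, mul_comm]
      rw [e3, add_sub_cancel_left] at e1 e2
      rw [e1] at e2
      rw [← sub_div, div_eq_iff hδ.1.ne']
      linarith
    have := tendsto_nhds_unique (lim.congr' hconst) tendsto_const_nhds
    linarith
  have h0 := key 0
  have h1 := key 1
  simp only [mul_zero, mul_one, add_zero] at h0 h1
  exact ⟨h0, by linarith⟩

theorem IsAC.exists_memory_bound (hα0 : 0 < α) (hα1 : α < 1) (hy : IsAC α T y) (hT : 0 < T) :
    ∃ M, 0 ≤ M ∧ ∀ σ (hσ : σ ∈ Ico 0 T), ∀ s ∈ Icc σ T,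
      |memory (InitialData.ofRestrict y hy σ hσ) s| ≤ M := by
  obtain ⟨-, C, hC0, hC⟩ := hy.caputoDeriv_bounded hα0 hα1 hT.le
  have hΓ := one_div_pos.2 (Real.Gamma_pos_of_pos hα0)
  refine ⟨|y 0| + 1 / Real.Gamma α * (C * (T ^ α / α)), by positivity, fun σ hσ s hs => ?_⟩
  have hw : ∀ ξ ∈ Icc 0 σ, (InitialData.ofRestrict y hy σ hσ).w ξ = y ξ := fun ξ hξ =>
    indicator_of_mem hξ y
  have hb : ∀ᵐ ξ ∂(volume.restrict (Ioc 0 σ)),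
      |caputoDeriv α (InitialData.ofRestrict y hy σ hσ).w ξ| ≤ C := by
    filter_upwards [caputoDeriv_ae_congr (α := α) hw, ae_mono_Ioc le_rfl hσ.2.le hC] with ξ h1 h2
    rw [h1]; exact h2
  have h1 := abs_integral_kernel_le hα0 hσ.1 hs.1 hb
  rw [memory, hw 0 ⟨le_rfl, hσ.1⟩]
  refine (abs_add_le _ _).trans (add_le_add le_rfl ?_)
  rw [abs_mul, abs_of_pos hΓ]
  refine mul_le_mul_of_nonneg_left (h1.trans ?_) hΓ.le
  refine mul_le_mul_of_nonneg_left (div_le_div_of_nonneg_right ?_ hα0.le) hC0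
  have h2 : 0 ≤ (s - σ) ^ α := Real.rpow_nonneg (sub_nonneg.2 hs.1) _
  have h3 : (s - 0) ^ α ≤ T ^ α :=
    Real.rpow_le_rpow (by linarith [hσ.1, hs.1]) (by linarith [hs.2]) hα0.le
  linarith

/-- The solutions restarted at different times `σ` must share one range, so that one Lipschitz
constant and one linearization modulus serve as `σ → t`. The memory terms along `y` are bounded
uniformly and the a priori constant does not depend on `σ`. -/
theorem exists_uniform_solution_bound (hα0 : 0 < α) (hα1 : α < 1) (hT : 0 < T)
    (hgrowth : ∃ γ : ℝ, 0 ≤ γ ∧ ∀ τ ∈ Icc 0 T, ∀ x : ℝ, |f τ x| ≤ γ * (1 + |x|))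
    (hy : IsAC α T y) :
    ∃ R, ∀ σ (hσ : σ ∈ Ico 0 T) (z : ℝ → ℝ),
      IsCauchySolution α T f (InitialData.ofRestrict y hy σ hσ) z → ∀ s ∈ Icc σ T, |z s| ≤ R := by
  obtain ⟨γ, hγ, hg⟩ := hgrowth
  obtain ⟨B, hB, HB⟩ := exists_apriori_bound hα0 hα1.le hT hγ
  obtain ⟨M, hM0, hM⟩ := hy.exists_memory_bound hα0 hα1 hT
  obtain ⟨Y, hY⟩ := isCompact_Icc.exists_bound_of_continuousOn (hy.continuousOn hα0 hα1 hT.le)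
  refine ⟨max Y (B * (M + 1)), fun σ hσ z hz s hs => ?_⟩
  have hσs : Ioc σ T ⊆ Icc 0 T := fun s hs => ⟨hσ.1.trans hs.1.le, hs.2⟩
  rcases hs.1.eq_or_lt with h | h
  · subst h
    rw [hz.2.1 σ ⟨hσ.1, le_rfl⟩]
    change |(Icc 0 σ).indicator y σ| ≤ _
    rw [indicator_of_mem (right_mem_Icc.2 hσ.1)]
    exact (hY σ ⟨hσ.1, hσ.2.le⟩).trans (le_max_left _ _)
  · have hzc := hz.continuousOn hα0 hα1 hT
    obtain ⟨C, hC⟩ := isCompact_Icc.exists_bound_of_continuousOn hzc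
    refine (HB σ T M z (fun ξ => f ξ (z ξ)) (by linarith [hσ.1]) hM0
      ⟨C, fun s hs => hC s (hσs hs)⟩ (hzc.mono hσs) (fun ξ hξ => hg ξ (hσs hξ) _)
      (fun r hr => ?_) s ⟨h, hs.2⟩).trans (le_max_right _ _)
    have hr' := Ioc_subset_Icc_self hr
    rw [hz.eq_volterra hα0 hα1 (g := InitialData.ofRestrict y hy σ hσ) hr']
    exact (abs_add_le _ _).trans (add_le_add (hM σ hσ r hr') le_rfl)

/-- The difference of the two Caputo derivatives vanishes before `t`, is that of `y` and `x` on `[t,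
σ]`, and is a difference of values of `f` after `σ`; the fractional integral is split accordingly.
-/
theorem IsCauchySolution.sub_eq (hα0 : 0 < α) (hα1 : α < 1) (hT : 0 < T)
    (hx : IsCauchySolution α T f g x) (hy : IsAC α T y) (hyw : ∀ ξ ∈ Icc 0 g.t, y ξ = g.w ξ)
    {σ : ℝ} (hσ : σ ∈ Ioo g.t T) {z : ℝ → ℝ}
    (hz : IsCauchySolution α T f (InitialData.ofRestrict y hy σ (g.mem_Ico hσ)) z)
    {s : ℝ} (hs : s ∈ Icc σ T) :
    z s - x s = 1 / Real.Gamma α *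
        (∫ ξ in g.t..σ, (caputoDeriv α y ξ - caputoDeriv α x ξ) / (s - ξ) ^ (1 - α)) +
      fracInt α σ (fun ξ => f ξ (z ξ) - f ξ (x ξ)) s := by
  have ht := g.t_mem.1
  have hσ0 := ht.trans hσ.1.le
  have hs0 : s ∈ Icc 0 T := ⟨hσ0.trans hs.1, hs.2⟩
  obtain ⟨mz, Cz, -, hCz⟩ := hz.1.caputoDeriv_bounded hα0 hα1 hT.le
  obtain ⟨mx, Cx, -, hCx⟩ := hx.1.caputoDeriv_bounded hα0 hα1 hT.le
  set D : ℝ → ℝ := fun ξ => caputoDeriv α z ξ - caputoDeriv α x ξ with hD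
  have mD : AEStronglyMeasurable D (volume.restrict (Ioc 0 T)) := mz.sub mx
  have hCD : ∀ᵐ ξ ∂(volume.restrict (Ioc 0 T)), |D ξ| ≤ Cz + Cx := by
    filter_upwards [hCz, hCx] with ξ h1 h2
    exact (abs_sub _ _).trans (add_le_add h1 h2)
  have hzy : ∀ ξ ∈ Icc 0 σ, z ξ = y ξ := fun ξ hξ =>
    (hz.2.1 ξ hξ).trans (indicator_of_mem hξ y)
  have hxy : ∀ ξ ∈ Icc 0 g.t, y ξ = x ξ := fun ξ hξ => (hyw ξ hξ).trans (hx.2.1 ξ hξ).symm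
  have ezy := caputoDeriv_ae_congr (α := α) hzy
  have exy := caputoDeriv_ae_congr (α := α) hxy
  have e0 : z 0 = x 0 := (hzy 0 ⟨le_rfl, hσ0⟩).trans (hxy 0 ⟨le_rfl, ht⟩)
  have e1 : z s - x s = fracInt α 0 D s := by
    rw [hz.1.eq_fracInt hα0 hα1 hT.le s hs0, hx.1.eq_fracInt hα0 hα1 hT.le s hs0, e0,
      add_sub_add_left_eq_sub, ← fracInt_sub]
    · exact intervalIntegrable_kernel_of_bounded hα0 hs0.1 le_rfl
        (aestronglyMeasurable_mono_Ioc le_rfl hs0.2 mz) (ae_mono_Ioc le_rfl hs0.2 hCz)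
    · exact intervalIntegrable_kernel_of_bounded hα0 hs0.1 le_rfl
        (aestronglyMeasurable_mono_Ioc le_rfl hs0.2 mx) (ae_mono_Ioc le_rfl hs0.2 hCx)
  have e2 : ∫ ξ in (0 : ℝ)..g.t, D ξ / (s - ξ) ^ (1 - α) = 0 := by
    rw [intervalIntegral.integral_of_le ht]
    refine integral_eq_zero_of_ae ?_
    filter_upwards [ae_mono_Ioc le_rfl hσ.1.le ezy, exy] with ξ h1 h2
    simp [hD, h1, h2]
  rw [e1, fracInt_split hα0 mD hCD ht (hσ.1.le.trans hs.1) hs.2, e2, mul_zero, zero_add,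
    fracInt_split hα0 (aestronglyMeasurable_mono_Ioc ht le_rfl mD) (ae_mono_Ioc ht le_rfl hCD)
      hσ.1.le hs.1 hs.2]
  congr 1
  · congr 1
    rw [intervalIntegral.integral_of_le hσ.1.le, intervalIntegral.integral_of_le hσ.1.le]
    refine integral_congr_ae ?_
    filter_upwards [ae_mono_Ioc ht le_rfl ezy] with ξ h1
    simp only [hD, h1]
  · refine fracInt_congr_ae hs.1 ?_
    have a1 : ∀ᵐ ξ ∂(volume.restrict (Ioc σ T)), caputoDeriv α z ξ = f ξ (z ξ) := hz.ae_eq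
    filter_upwards [ae_mono_Ioc le_rfl hs.2 a1, ae_mono_Ioc hσ.1.le hs.2 hx.ae_eq] with ξ h1 h2
    simp only [hD, h1, h2]

theorem exists_integral_sub_le {F : ℝ → ℝ} {t T : ℝ} (htT : t < T)
    (hF : ContinuousOn F (Icc t T)) {ε : ℝ} (hε : 0 < ε) :
    ∃ δ > 0, ∀ σ ∈ Ioo t T, σ - t ≤ δ → |(∫ ξ in t..σ, F ξ) - F t * (σ - t)| ≤ ε * (σ - t) := by
  obtain ⟨δ, hδ, H⟩ := Metric.continuousWithinAt_iff.1 (hF t ⟨le_rfl, htT.le⟩) ε hε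
  refine ⟨δ / 2, by positivity, fun σ hσ hσδ => ?_⟩
  have hi : IntervalIntegrable F volume t σ :=
    (hF.mono (Icc_subset_Icc_right hσ.2.le)).intervalIntegrable_of_Icc hσ.1.le
  have e : (∫ ξ in t..σ, F ξ) - F t * (σ - t) = ∫ ξ in t..σ, (F ξ - F t) := by
    rw [intervalIntegral.integral_sub hi intervalIntegrable_const,
      intervalIntegral.integral_const, smul_eq_mul, mul_comm]
  have h1 : ‖∫ ξ in t..σ, (F ξ - F t)‖ ≤ ε * |σ - t| := by
    refine intervalIntegral.norm_integral_le_of_norm_le_const fun ξ hξ => ?_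
    rw [uIoc_of_le hσ.1.le] at hξ
    refine (H (x := ξ) ⟨hξ.1.le, hξ.2.trans hσ.2.le⟩ ?_).le
    rw [Real.dist_eq, abs_of_pos (sub_pos.2 hξ.1)]
    linarith [hξ.2]
  rw [e]
  rwa [abs_of_pos (sub_pos.2 hσ.1)] at h1

/-- The impulse of the perturbation is `∫ (Dy - Dx)`. The part with `Dy` yields the gradient term,
while `Dx = f(·, x)` averages to `f(t, w(t))` near `t` and yields the time derivative. -/
theorem IsCauchySolution.hasCiDerivAt_rho (hα0 : 0 < α) (hα1 : α < 1) (hT : 0 < T)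
    (hf : ContDiffOn ℝ 1 (fun z : ℝ × ℝ => f z.1 z.2) (Icc 0 T ×ˢ univ))
    (hgrowth : ∃ γ : ℝ, 0 ≤ γ ∧ ∀ τ ∈ Icc 0 T, ∀ x : ℝ, |f τ x| ≤ γ * (1 + |x|))
    (hx : IsCauchySolution α T f g x) (hq : IsSolutionQ f g x q) :
    HasCiDerivAt (rho α T f) g (-f g.t (g.w g.t) * q T) (q T) := by
  intro y hy hyw
  have ht := g.t_mem.1
  have htT := g.t_mem.2
  have hX : ∀ σ, ∃ X : ℝ → ℝ, ∀ hσ : σ ∈ Ioo g.t T,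
      IsCauchySolution α T f (InitialData.ofRestrict y hy σ (g.mem_Ico hσ)) X := by
    intro σ
    by_cases hσ : σ ∈ Ioo g.t T
    · obtain ⟨X, hX⟩ := exists_isCauchySolution hα0 hα1 hT hf hgrowth
        (InitialData.ofRestrict y hy σ (g.mem_Ico hσ))
      exact ⟨X, fun _ => hX⟩
    · exact ⟨0, fun h => absurd h hσ⟩
  choose X hX using hX
  obtain ⟨R1, hR1⟩ := exists_uniform_solution_bound hα0 hα1 hT hgrowth hy
  have hxc := hx.continuousOn hα0 hα1 hT
  obtain ⟨R2, hR2⟩ := isCompact_Icc.exists_bound_of_continuousOn hxc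
  set R := max R1 R2
  obtain ⟨L, hL, hLip⟩ := exists_lipschitz_strip hT hf R
  have hac := coeffA_continuousOn hT hf hxc
  obtain ⟨A, hA⟩ := isCompact_Icc.exists_bound_of_continuousOn hac
  have hA0 : 0 ≤ A := (norm_nonneg _).trans (hA 0 ⟨le_rfl, hT.le⟩)
  obtain ⟨my, Cy, hCy0, hCy⟩ := hy.caputoDeriv_bounded hα0 hα1 hT.le
  obtain ⟨mx, Cx, hCx0, hCx⟩ := hx.1.caputoDeriv_bounded hα0 hα1 hT.le
  have sub0 : ∀ {σ}, σ ∈ Ioo g.t T → Icc σ T ⊆ Icc 0 T := fun hσ =>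
    Icc_subset_Icc_left (ht.trans hσ.1.le)
  have pert := volterra_perturbation (t := g.t) (T := T) (R := R) (L := max L A) (Cm := Cy + Cx)
    (f := f) (a := fun ξ y => deriv (fun z => f ξ z) y) (x := x) (q := q)
    (m := fun ξ => caputoDeriv α y ξ - caputoDeriv α x ξ) (X := X) hα0 hα1 htT
    (fun z σ hσ hz => continuousOn_along (h := fun z : ℝ × ℝ => f z.1 z.2) hf.continuousOn
      (sub0 hσ) hz)
    (hL.trans (le_max_left _ _))
    (fun ξ hξ y y' h1 h2 => (hLip ξ (g.Icc_subset hξ) y y' h1 h2).trans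
      (mul_le_mul_of_nonneg_right (le_max_left _ _) (abs_nonneg _)))
    (fun ε hε => by
      obtain ⟨δ, hδ, H⟩ := exists_linearization_strip hT hf R hε
      exact ⟨δ, hδ, fun ξ hξ => H ξ (g.Icc_subset hξ)⟩)
    (hac.mono g.Icc_subset)
    (fun ξ hξ => (hA ξ (g.Icc_subset hξ)).trans (le_max_right _ _))
    (hxc.mono g.Icc_subset) (fun ξ hξ => (hR2 ξ (g.Icc_subset hξ)).trans (le_max_right _ _))
    (isWeightedContinuous_iff.1 hq.1)
    (fun s hs => by rw [← qBar_eq hs.1.le]; exact hq.2 s hs)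
    (aestronglyMeasurable_mono_Ioc ht le_rfl (my.sub mx)) (add_nonneg hCy0 hCx0)
    (by
      filter_upwards [ae_mono_Ioc ht le_rfl hCy, ae_mono_Ioc ht le_rfl hCx] with ξ h1 h2
      exact (abs_sub _ _).trans (add_le_add h1 h2))
    (fun σ hσ => ((hX σ hσ).continuousOn hα0 hα1 hT).mono (sub0 hσ))
    (fun σ hσ ξ hξ => (hR1 σ (g.mem_Ico hσ) _ (hX σ hσ) ξ hξ).trans (le_max_left _ _))
    (fun σ hσ s hs => hx.sub_eq hα0 hα1 hT hy hyw hσ (hX σ hσ) hs)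
  set k := f g.t (g.w g.t) with hk
  have hFc : ContinuousOn (fun ξ => f ξ (x ξ)) (Icc g.t T) :=
    continuousOn_f_along hf (hxc.mono g.Icc_subset)
  have hkx : f g.t (x g.t) = k := by rw [hx.2.1 g.t ⟨ht, le_rfl⟩]
  -- The remainder is taken to be the exact discrepancy, so the expansion is an identity and only
  -- its smallness needs proof.
  refine ⟨fun δ => X (g.t + δ) T - x T - (-k * q T * δ +
    q T * ∫ ξ in g.t..(g.t + δ), caputoDeriv α y ξ), ?_, fun τ hτ => ?_⟩
  · rw [Metric.tendsto_nhds]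
    intro ε hε
    obtain ⟨δ1, hδ1, P1⟩ := pert (ε / 4) (by positivity)
    obtain ⟨δ2, hδ2, P2⟩ := exists_integral_sub_le htT hFc
      (ε := ε / 4 / (|q T| + 1)) (by positivity)
    filter_upwards [Ioo_mem_nhdsGT (lt_min (sub_pos.2 htT) (lt_min hδ1 hδ2))] with δ hδ
    have b1 := hδ.2.trans_le (min_le_left _ _)
    have b2 := hδ.2.trans_le ((min_le_right _ _).trans (min_le_left _ _))
    have b3 := hδ.2.trans_le ((min_le_right _ _).trans (min_le_right _ _))
    have hτ : g.t + δ ∈ Ioo g.t T := ⟨by linarith [hδ.1], by linarith⟩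
    have c1 := P1 _ hτ (by linarith)
    have c2 := P2 _ hτ (by linarith)
    have iy : IntervalIntegrable (caputoDeriv α y) volume g.t (g.t + δ) := by
      simpa using intervalIntegrable_kernel_of_bounded one_pos hτ.1.le le_rfl
        (aestronglyMeasurable_mono_Ioc ht hτ.2.le my) (ae_mono_Ioc ht hτ.2.le hCy)
    have ix : IntervalIntegrable (caputoDeriv α x) volume g.t (g.t + δ) := by
      simpa using intervalIntegrable_kernel_of_bounded one_pos hτ.1.le le_rfl
        (aestronglyMeasurable_mono_Ioc ht hτ.2.le mx) (ae_mono_Ioc ht hτ.2.le hCx)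
    have ex : ∫ ξ in g.t..(g.t + δ), caputoDeriv α x ξ =
        ∫ ξ in g.t..(g.t + δ), f ξ (x ξ) := by
      rw [intervalIntegral.integral_of_le hτ.1.le, intervalIntegral.integral_of_le hτ.1.le]
      exact integral_congr_ae (ae_mono_Ioc le_rfl hτ.2.le hx.ae_eq)
    rw [intervalIntegral.integral_sub iy ix, ex] at c1
    rw [hkx] at c2
    rw [add_sub_cancel_left] at c1 c2
    set I := ∫ ξ in g.t..(g.t + δ), caputoDeriv α y ξ
    set J := ∫ ξ in g.t..(g.t + δ), f ξ (x ξ)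
    have c3 : |q T * (J - k * δ)| ≤ ε / 4 * δ := by
      rw [abs_mul]
      calc |q T| * |J - k * δ| ≤ (|q T| + 1) * (ε / 4 / (|q T| + 1) * δ) :=
            mul_le_mul (by linarith) c2 (abs_nonneg _) (by positivity)
        _ = _ := by field_simp
    rw [Real.dist_eq, sub_zero, abs_div, abs_of_pos hδ.1, div_lt_iff₀ hδ.1]
    -- Two errors remain: that of the perturbation expansion and that of replacing `f` along `x` by
    -- its value at `t`. Each is at most a quarter of `ε δ`, leaving room for the strict inequality.
    have e : X (g.t + δ) T - x T - (-k * q T * δ + q T * I) =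
        (X (g.t + δ) T - x T - q T * (I - J)) - q T * (J - k * δ) := by ring
    rw [e]
    have := mul_pos hε hδ.1
    calc _ ≤ ε / 4 * δ + ε / 4 * δ := (abs_sub _ _).trans (add_le_add c1 c3)
      _ < ε * δ := by linarith
  · rw [rho_eq hα0 hα1 hT hf hx, rho_eq hα0 hα1 hT hf (hX τ hτ)]
    simp only [add_sub_cancel]

end CiDerivative

end CaputoCauchy

end

theorem theorem3p1 (α T : ℝ) (hα0 : 0 < α) (hα1 : α < 1) (hT : 0 < T)
    (f : ℝ → ℝ → ℝ)
    (hf : ContDiffOn ℝ 1 (fun z : ℝ × ℝ => f z.1 z.2) (Icc 0 T ×ˢ univ))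
    (hgrowth : ∃ γ : ℝ, 0 ≤ γ ∧ ∀ τ ∈ Icc 0 T, ∀ x : ℝ, |f τ x| ≤ γ * (1 + |x|))
    (g : CaputoCauchy.InitialData α T) :
    ∃ x p q : ℝ → ℝ,
      (CaputoCauchy.IsCauchySolution α T f g x ∧
        ∀ x', CaputoCauchy.IsCauchySolution α T f g x' → EqOn x' x (Icc 0 T)) ∧
      (CaputoCauchy.IsSolutionP f g x p ∧
        ∀ p', CaputoCauchy.IsSolutionP f g x p' → EqOn p' p (Ioc g.t T)) ∧
      (CaputoCauchy.IsSolutionQ f g x q ∧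
        ∀ q', CaputoCauchy.IsSolutionQ f g x q' → EqOn q' q (Ioc g.t T)) ∧
      CaputoCauchy.HasCiDerivAt (CaputoCauchy.rho α T f) g (p T) (q T) ∧
      (∀ d e : ℝ, CaputoCauchy.HasCiDerivAt (CaputoCauchy.rho α T f) g d e →
        d = p T ∧ e = q T) := by
  obtain ⟨x, hx⟩ := CaputoCauchy.exists_isCauchySolution hα0 hα1 hT hf hgrowth g
  obtain ⟨p, q, hp, hq, hpq⟩ := hx.exists_solutionP_solutionQ hα0 hα1 hT hf hgrowth
  have hD : CaputoCauchy.HasCiDerivAt (CaputoCauchy.rho α T f) g (p T) (q T) := by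
    rw [hpq]
    exact hx.hasCiDerivAt_rho hα0 hα1 hT hf hgrowth hq.1
  exact ⟨x, p, q, ⟨hx, fun _ hx' => hx.unique hα0 hα1 hT hf hx'⟩, hp, hq, hD,
    fun _ _ h => h.unique hα0 hα1 hD⟩
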